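/- Let $R$ be a principal ideal domain. A graded Lie algebra over $R$ is a $\mathbb Z$-graded $R$-module $L=\bigoplus L_i$ with bilinear brackets $[\,,]:L_i\times L_j\to L_{i+j}$ and squaring operations $(\ )^2:L_i\to L_{2i}$ for $i$ odd, such that for homogeneous elements: $[x,y]=-(-1)^{|x||y|}[y,x]$; $[x,[y,z]]=[[x,y],z]+(-1)^{|x||y|}[y,[x,z]]$; $[x,x]=0$ for $|x|$ even; and, for $x,x'$ of the same odd degree, $a\in R$ and $y$ homogeneous, $(ax)^2=a^2x^2$, $(x+x')^2=x^2+x'^2+[x,x']$, $2x^2=[x,x]$, $[x,x^2]=0$, $[y,x^2]=[[y,x],x]$. Homomorphisms preserve degrees, brackets and squares; ideals are graded submodules closed under bracketing with arbitrary elements and under squaring of odd elements; $(r)$ denotes the smallest ideal containing $r$. $F(\cdot)$ denotes the free graded Lie algebra on a graded module, or on a set of generators with given degrees. Let $V$ be a free $R$-module of finite rank $k\ge 1$, placed in a single odd degree $m$. The tensor algebra $T(V)$ is a graded Lie algebra under the graded commutator $[a,b]=ab-(-1)^{|a||b|}ba$ and the squaring $a^2=a\otimes a$, and the inclusion $V\subset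 T(V)$ induces a homomorphism $F(V)\to T(V)$. Let $\mathcal L\in V\otimes V$ be a symmetric tensor (invariant under the interchange of factors) which is invertible, i.e. its $k\times k$ coefficient matrix with respect to any basis of $V$ is invertible over $R$. Let $W\subset V$ be a direct summand, free of rank $k-1$, with basis $v_1,\dots,v_{k-1}$. Then $\mathcal L$ is the image of a unique element of $F(V)_{2m}$, also denoted $\mathcal L$. Put $L(V,\mathcal L)=F(V)/(\mathcal L)$ and let $L^W(V,\mathcal L)\subset L(V,\mathcal L)$ be the graded Lie subalgebra that equals the image of $W$ in degree $m$ and all of $L(V,\mathcal L)_i$ in every degree $i\neq m$. There are $w_1,\dots,w_{k-1}\in V\otimes V$, each of them the image of an element of $F(V)_{2m}$ (again denoted $w_i$), such that: 1. $\sum_{i=1}^{k-1}[v_i,w_i]$ lies in the two-sided ideal of $T(V)$ generated by $\mathcal L$; 2. the classes of $w_1,\dots,w_{k-1}$ form a basis of the $R$-module $V\otimes V/\big(R\mathcal L+V\otimes W\big)$; 3. letting $F(v_1,\dots,v_{k-1},w_1,\dots,w_{k-1})$ be the free graded Lie algebra on generators $v_i$ of degree $m$ and $w_i$ of degree $2m$,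 the assignment $v_i\mapsto v_i$, $w_i\mapsto w_i$ induces an isomorphism of graded Lie algebras $$\frac{F(v_1,\dots,v_{k-1},w_1,\dots,w_{k-1})}{\big(\sum_{i=1}^{k-1}[v_i,w_i]\big)}\;\cong\;L^W(V,\mathcal L).$$ -/

import Mathlib

open scoped TensorProduct DirectSum

universe u v w

/-- The Koszul sign `(-1)^(i*j)`, as an element of the ground ring. -/
def koszulSign (R : Type u) [CommRing R] (i j : ℤ) : R :=
  (((i * j).negOnePow : ℤ) : R)

/-- A graded Lie algebra (with squaring) structure on the graded `R`-module `L = ⊕ L i`.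
The target degree `n` of `br` and `sq` is a variable together with a proof that it is `i + j`
(resp. `i + i`), so that no transport along equalities of degrees is ever needed. -/
class GLie (R : Type u) [CommRing R] (L : ℤ → Type v)
    [∀ i, AddCommGroup (L i)] [∀ i, Module R (L i)] where
  br : ∀ {i j n : ℤ}, i + j = n → (L i →ₗ[R] L j →ₗ[R] L n)
  sq : ∀ {i n : ℤ}, Odd i → i + i = n → L i → L n
  skew : ∀ {i j n : ℤ} (h : i + j = n) (h' : j + i = n) (x : L i) (y : L j),
    br h x y = -(koszulSign R i j • br h' y x)
  jacobi : ∀ {i j l a b c n : ℤ} (hyz : j + l = a) (hxa : i + a = n) (hxy : i + j = b)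
    (hbz : b + l = n) (hxz : i + l = c) (hyc : j + c = n) (x : L i) (y : L j) (z : L l),
    br hxa x (br hyz y z) = br hbz (br hxy x y) z + koszulSign R i j • br hyc y (br hxz x z)
  sq_smul : ∀ {i n : ℤ} (ho : Odd i) (h : i + i = n) (a : R) (x : L i),
    sq ho h (a • x) = a ^ 2 • sq ho h x
  sq_add : ∀ {i n : ℤ} (ho : Odd i) (h : i + i = n) (x y : L i),
    sq ho h (x + y) = sq ho h x + sq ho h y + br h x y
  br_self : ∀ {i n : ℤ} (_ : Even i) (h : i + i = n) (x : L i), br h x x = 0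
  two_sq : ∀ {i n : ℤ} (ho : Odd i) (h : i + i = n) (x : L i),
    (2 : R) • sq ho h x = br h x x
  br_self_sq : ∀ {i n p : ℤ} (ho : Odd i) (h : i + i = n) (h' : i + n = p) (x : L i),
    br h' x (sq ho h x) = 0
  br_sq : ∀ {i j n a p : ℤ} (ho : Odd i) (h : i + i = n) (h' : j + n = p) (h₁ : j + i = a)
    (h₂ : a + i = p) (y : L j) (x : L i), br h' y (sq ho h x) = br h₂ (br h₁ y x) x

/-- Homomorphisms of graded Lie algebras: linear, degree preserving, compatible with brackets and
squares. -/
structure GLieHom (R : Type u) [CommRing R] (L : ℤ → Type v) (L' : ℤ → Type w)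
    [∀ i, AddCommGroup (L i)] [∀ i, Module R (L i)] [GLie R L]
    [∀ i, AddCommGroup (L' i)] [∀ i, Module R (L' i)] [GLie R L'] where
  map : ∀ i, L i →ₗ[R] L' i
  map_br : ∀ {i j n : ℤ} (h : i + j = n) (x : L i) (y : L j),
    map n (GLie.br (R := R) h x y) = GLie.br (R := R) h (map i x) (map j y)
  map_sq : ∀ {i n : ℤ} (ho : Odd i) (h : i + i = n) (x : L i),
    map n (GLie.sq (R := R) ho h x) = GLie.sq (R := R) ho h (map i x)

/-! ### Subalgebras, ideals and quotients -/

section SubQuot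

/-- Graded Lie subalgebras. -/
structure GLieSub (R : Type u) [CommRing R] (L : ℤ → Type v)
    [∀ i, AddCommGroup (L i)] [∀ i, Module R (L i)] [GLie R L] where
  carrier : ∀ i, Submodule R (L i)
  br_mem : ∀ {i j n : ℤ} (h : i + j = n) (x : L i) (y : L j), x ∈ carrier i → y ∈ carrier j →
    GLie.br (R := R) h x y ∈ carrier n
  sq_mem : ∀ {i n : ℤ} (ho : Odd i) (h : i + i = n) (x : L i), x ∈ carrier i →
    GLie.sq (R := R) ho h x ∈ carrier n

/-- Graded Lie ideals. -/
structure GLieIdeal (R : Type u) [CommRing R] (L : ℤ → Type v)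
    [∀ i, AddCommGroup (L i)] [∀ i, Module R (L i)] [GLie R L] where
  carrier : ∀ i, Submodule R (L i)
  br_mem : ∀ {i j n : ℤ} (h : i + j = n) (x : L i) (y : L j), y ∈ carrier j →
    GLie.br (R := R) h x y ∈ carrier n
  sq_mem : ∀ {i n : ℤ} (ho : Odd i) (h : i + i = n) (x : L i), x ∈ carrier i →
    GLie.sq (R := R) ho h x ∈ carrier n

variable {R : Type u} [CommRing R] {L : ℤ → Type v}
  [∀ i, AddCommGroup (L i)] [∀ i, Module R (L i)] [GLie R L]

/-- The smallest graded Lie ideal containing the homogeneous element `r`. -/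
def GLieIdeal.gen {d : ℤ} (r : L d) : GLieIdeal R L where
  carrier i := ⨅ J : {J : GLieIdeal R L // r ∈ J.carrier d}, J.1.carrier i
  br_mem h x y hy := by
    simp only [Submodule.mem_iInf] at hy ⊢
    exact fun J => J.1.br_mem h x y (hy J)
  sq_mem ho h x hx := by
    simp only [Submodule.mem_iInf] at hx ⊢
    exact fun J => J.1.sq_mem ho h x (hx J)

/-- The graded module underlying a graded Lie subalgebra. -/
def GLieSub.Carrier (S : GLieSub R L) : ℤ → Type v := fun i => S.carrier i

instance (S : GLieSub R L) (i : ℤ) : AddCommGroup (S.Carrier i) :=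
  inferInstanceAs (AddCommGroup (S.carrier i))

instance (S : GLieSub R L) (i : ℤ) : Module R (S.Carrier i) :=
  inferInstanceAs (Module R (S.carrier i))

/-- The inclusion of a graded Lie subalgebra, degree by degree. -/
def GLieSub.incl (S : GLieSub R L) (i : ℤ) : S.Carrier i →ₗ[R] L i := (S.carrier i).subtype

theorem GLieSub.incl_injective (S : GLieSub R L) (i : ℤ) : Function.Injective (S.incl i) :=
  Subtype.val_injective

theorem GLieSub.incl_mem (S : GLieSub R L) {i : ℤ} (x : S.Carrier i) :
    S.incl i x ∈ S.carrier i :=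
  Subtype.property (p := fun y => y ∈ S.carrier i) x

/-- An element of the subalgebra, from an element of `L` and a membership proof. -/
def GLieSub.ofMem (S : GLieSub R L) {i : ℤ} (x : L i) (hx : x ∈ S.carrier i) : S.Carrier i :=
  (⟨x, hx⟩ : S.carrier i)

theorem GLieSub.incl_ofMem (S : GLieSub R L) {i : ℤ} (x : L i) (hx : x ∈ S.carrier i) :
    S.incl i (S.ofMem x hx) = x := rfl

instance (S : GLieSub R L) : GLie R S.Carrier where
  br {i j n} h := LinearMap.mk₂ R
    (fun x y => S.ofMem (GLie.br (R := R) h (S.incl i x) (S.incl j y))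
      (S.br_mem h _ _ (S.incl_mem x) (S.incl_mem y)))
    (fun x x' y => S.incl_injective n (by simp only [S.incl_ofMem, map_add, LinearMap.add_apply]))
    (fun a x y => S.incl_injective n (by
      simp only [S.incl_ofMem, map_smul, LinearMap.smul_apply]))
    (fun x y y' => S.incl_injective n (by simp only [S.incl_ofMem, map_add]))
    (fun a x y => S.incl_injective n (by simp only [S.incl_ofMem, map_smul]))
  sq {i n} ho h x :=
    S.ofMem (GLie.sq (R := R) ho h (S.incl i x)) (S.sq_mem ho h _ (S.incl_mem x))
  skew h h' x y := Subtype.ext (GLie.skew (R := R) h h' (S.incl _ x) (S.incl _ y))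
  jacobi h₁ h₂ h₃ h₄ h₅ h₆ x y z := Subtype.ext
    (GLie.jacobi (R := R) h₁ h₂ h₃ h₄ h₅ h₆ (S.incl _ x) (S.incl _ y) (S.incl _ z))
  sq_smul ho h a x := Subtype.ext (GLie.sq_smul (R := R) ho h a (S.incl _ x))
  sq_add ho h x y := Subtype.ext (GLie.sq_add (R := R) ho h (S.incl _ x) (S.incl _ y))
  br_self he h x := Subtype.ext (GLie.br_self (R := R) he h (S.incl _ x))
  two_sq ho h x := Subtype.ext (GLie.two_sq (R := R) ho h (S.incl _ x))
  br_self_sq ho h h' x := Subtype.ext (GLie.br_self_sq (R := R) ho h h' (S.incl _ x))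
  br_sq ho h h' h₁ h₂ y x :=
    Subtype.ext (GLie.br_sq (R := R) ho h h' h₁ h₂ (S.incl _ y) (S.incl _ x))

/-- The graded module `L / I`. -/
def GLieIdeal.Quot (I : GLieIdeal R L) : ℤ → Type v := fun i => L i ⧸ I.carrier i

instance (I : GLieIdeal R L) (i : ℤ) : AddCommGroup (I.Quot i) :=
  inferInstanceAs (AddCommGroup (L i ⧸ I.carrier i))

instance (I : GLieIdeal R L) (i : ℤ) : Module R (I.Quot i) :=
  inferInstanceAs (Module R (L i ⧸ I.carrier i))

/-- The projection `L → L / I`, degree by degree. -/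
def GLieIdeal.proj (I : GLieIdeal R L) (i : ℤ) : L i →ₗ[R] I.Quot i := (I.carrier i).mkQ

theorem GLieIdeal.proj_surjective (I : GLieIdeal R L) (i : ℤ) : Function.Surjective (I.proj i) :=
  Submodule.mkQ_surjective _

theorem GLieIdeal.proj_eq_iff (I : GLieIdeal R L) {i : ℤ} (x y : L i) :
    I.proj i x = I.proj i y ↔ x - y ∈ I.carrier i :=
  Submodule.Quotient.eq _

theorem GLieIdeal.proj_eq_zero (I : GLieIdeal R L) {i : ℤ} {x : L i} (h : x ∈ I.carrier i) :
    I.proj i x = 0 :=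
  (Submodule.Quotient.mk_eq_zero _).2 h

theorem GLieIdeal.br_mem' (I : GLieIdeal R L) {i j n : ℤ} (h : i + j = n) (x : L i) (y : L j)
    (hx : x ∈ I.carrier i) : GLie.br (R := R) h x y ∈ I.carrier n := by
  rw [GLie.skew h ((add_comm j i).trans h) x y]
  exact neg_mem (Submodule.smul_mem _ _ (I.br_mem _ _ _ hx))

/-- The bracket of `L / I`. -/
def GLieIdeal.quotBr (I : GLieIdeal R L) {i j n : ℤ} (h : i + j = n) :
    I.Quot i →ₗ[R] I.Quot j →ₗ[R] I.Quot n :=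
  (I.carrier i).liftQ
    (LinearMap.mk₂ R
      (fun (x : L i) (y : I.Quot j) =>
        ((I.carrier j).liftQ ((I.proj n).comp (GLie.br (R := R) h x)) (fun y hy =>
          I.proj_eq_zero (I.br_mem h x y hy)) y : I.Quot n))
      (fun x x' y => by
        obtain ⟨y, rfl⟩ := I.proj_surjective _ y
        change I.proj n _ = I.proj n _ + I.proj n _
        simp)
      (fun a x y => by
        obtain ⟨y, rfl⟩ := I.proj_surjective _ y
        change I.proj n _ = a • I.proj n _
        simp)
      (fun x y y' => map_add _ _ _) (fun a x y => map_smul _ _ _))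
    (fun x hx => by
      refine LinearMap.ext fun y => ?_
      obtain ⟨y, rfl⟩ := I.proj_surjective _ y
      exact I.proj_eq_zero (I.br_mem' h x y hx))

/-- The squaring of `L / I`. -/
def GLieIdeal.quotSq (I : GLieIdeal R L) {i n : ℤ} (ho : Odd i) (h : i + i = n) :
    I.Quot i → I.Quot n :=
  Quotient.lift (fun x : L i => I.proj n (GLie.sq (R := R) ho h x)) (fun x y hxy => by
    have hxy' : x - y ∈ I.carrier i := (Submodule.quotientRel_def _).1 hxy
    refine (I.proj_eq_iff _ _).2 ?_
    have e : GLie.sq (R := R) ho h x - GLie.sq (R := R) ho h y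
        = GLie.sq (R := R) ho h (x - y) + GLie.br (R := R) h (x - y) y := by
      have := GLie.sq_add (R := R) ho h (x - y) y
      rw [sub_add_cancel] at this
      rw [this]; abel
    rw [e]
    exact add_mem (I.sq_mem ho h _ hxy') (I.br_mem' h _ _ hxy'))

theorem GLieIdeal.quotBr_proj (I : GLieIdeal R L) {i j n : ℤ} (h : i + j = n)
    (x : L i) (y : L j) :
    I.quotBr h (I.proj i x) (I.proj j y) = I.proj n (GLie.br (R := R) h x y) := rfl

theorem GLieIdeal.quotSq_proj (I : GLieIdeal R L) {i n : ℤ} (ho : Odd i) (h : i + i = n)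
    (x : L i) : I.quotSq ho h (I.proj i x) = I.proj n (GLie.sq (R := R) ho h x) := rfl

instance (I : GLieIdeal R L) : GLie R I.Quot where
  br h := I.quotBr h
  sq ho h := I.quotSq ho h
  skew {i j n} h h' x y := by
    obtain ⟨x, rfl⟩ := I.proj_surjective _ x
    obtain ⟨y, rfl⟩ := I.proj_surjective _ y
    simp only [GLieIdeal.quotBr_proj, GLie.skew h h' x y, map_neg, map_smul]
  jacobi h₁ h₂ h₃ h₄ h₅ h₆ x y z := by
    obtain ⟨x, rfl⟩ := I.proj_surjective _ x
    obtain ⟨y, rfl⟩ := I.proj_surjective _ y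
    obtain ⟨z, rfl⟩ := I.proj_surjective _ z
    simp only [GLieIdeal.quotBr_proj, GLie.jacobi h₁ h₂ h₃ h₄ h₅ h₆ x y z, map_add, map_smul]
  sq_smul ho h a x := by
    obtain ⟨x, rfl⟩ := I.proj_surjective _ x
    simp only [← map_smul, GLieIdeal.quotSq_proj, GLie.sq_smul]
  sq_add ho h x y := by
    obtain ⟨x, rfl⟩ := I.proj_surjective _ x
    obtain ⟨y, rfl⟩ := I.proj_surjective _ y
    simp only [← map_add, GLieIdeal.quotSq_proj, GLieIdeal.quotBr_proj, GLie.sq_add]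
  br_self he h x := by
    obtain ⟨x, rfl⟩ := I.proj_surjective _ x
    simp only [GLieIdeal.quotBr_proj, GLie.br_self he, map_zero]
  two_sq ho h x := by
    obtain ⟨x, rfl⟩ := I.proj_surjective _ x
    simp only [GLieIdeal.quotSq_proj, GLieIdeal.quotBr_proj, ← GLie.two_sq ho, map_smul]
  br_self_sq ho h h' x := by
    obtain ⟨x, rfl⟩ := I.proj_surjective _ x
    simp only [GLieIdeal.quotSq_proj, GLieIdeal.quotBr_proj, GLie.br_self_sq, map_zero]
  br_sq ho h h' h₁ h₂ y x := by
    obtain ⟨x, rfl⟩ := I.proj_surjective _ x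
    obtain ⟨y, rfl⟩ := I.proj_surjective _ y
    simp only [GLieIdeal.quotSq_proj, GLieIdeal.quotBr_proj, GLie.br_sq ho h h' h₁ h₂]

end SubQuot

/-! ### The free graded Lie algebra on a graded module -/

/-- Formal expressions in the operations of a graded Lie algebra, with generators from the graded
module `V`. -/
inductive FreeGLie.Pre (R : Type u) (V : ℤ → Type v) : ℤ → Type (max u v)
  | of {n : ℤ} (x : V n) : Pre R V n
  | zero {n : ℤ} : Pre R V n
  | add {n : ℤ} (a b : Pre R V n) : Pre R V n
  | smul {n : ℤ} (r : R) (a : Pre R V n) : Pre R V n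
  | br {i j n : ℤ} (h : i + j = n) (a : Pre R V i) (b : Pre R V j) : Pre R V n
  | sq {i n : ℤ} (ho : Odd i) (h : i + i = n) (a : Pre R V i) : Pre R V n

section Rel
open FreeGLie.Pre

/-- The congruence generated by the linearity of `V → F(V)` and the axioms of graded Lie
algebras. -/
inductive FreeGLie.Rel (R : Type u) [CommRing R] (V : ℤ → Type v)
    [∀ i, AddCommGroup (V i)] [∀ i, Module R (V i)] :
    ∀ {n : ℤ}, FreeGLie.Pre R V n → FreeGLie.Pre R V n → Prop
  | refl {n : ℤ} (a : FreeGLie.Pre R V n) : Rel R V a a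
  | symm {n : ℤ} {a b : FreeGLie.Pre R V n} : Rel R V a b → Rel R V b a
  | trans {n : ℤ} {a b c : FreeGLie.Pre R V n} : Rel R V a b → Rel R V b c → Rel R V a c
  | add_congr {n : ℤ} {a a' b b' : FreeGLie.Pre R V n} : Rel R V a a' → Rel R V b b' →
      Rel R V (add a b) (add a' b')
  | smul_congr {n : ℤ} (r : R) {a a' : FreeGLie.Pre R V n} : Rel R V a a' →
      Rel R V (smul r a) (smul r a')
  | br_congr {i j n : ℤ} (h : i + j = n) {a a' : FreeGLie.Pre R V i}
      {b b' : FreeGLie.Pre R V j} : Rel R V a a' → Rel R V b b' → Rel R V (br h a b) (br h a' b')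
  | sq_congr {i n : ℤ} (ho : Odd i) (h : i + i = n) {a a' : FreeGLie.Pre R V i} : Rel R V a a' →
      Rel R V (sq ho h a) (sq ho h a')
  | add_assoc {n : ℤ} (a b c : FreeGLie.Pre R V n) :
      Rel R V (add (add a b) c) (add a (add b c))
  | add_comm {n : ℤ} (a b : FreeGLie.Pre R V n) : Rel R V (add a b) (add b a)
  | zero_add {n : ℤ} (a : FreeGLie.Pre R V n) : Rel R V (add zero a) a
  | neg_add {n : ℤ} (a : FreeGLie.Pre R V n) : Rel R V (add (smul (-1) a) a) zero
  | smul_add {n : ℤ} (r : R) (a b : FreeGLie.Pre R V n) :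
      Rel R V (smul r (add a b)) (add (smul r a) (smul r b))
  | add_smul {n : ℤ} (r s : R) (a : FreeGLie.Pre R V n) :
      Rel R V (smul (r + s) a) (add (smul r a) (smul s a))
  | mul_smul {n : ℤ} (r s : R) (a : FreeGLie.Pre R V n) :
      Rel R V (smul (r * s) a) (smul r (smul s a))
  | one_smul {n : ℤ} (a : FreeGLie.Pre R V n) : Rel R V (smul 1 a) a
  | of_add {n : ℤ} (x y : V n) : Rel R V (of (x + y)) (add (of x) (of y))
  | of_smul {n : ℤ} (r : R) (x : V n) : Rel R V (of (r • x)) (smul r (of x))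
  | br_add_left {i j n : ℤ} (h : i + j = n) (a a' : FreeGLie.Pre R V i)
      (b : FreeGLie.Pre R V j) : Rel R V (br h (add a a') b) (add (br h a b) (br h a' b))
  | br_smul_left {i j n : ℤ} (h : i + j = n) (r : R) (a : FreeGLie.Pre R V i)
      (b : FreeGLie.Pre R V j) : Rel R V (br h (smul r a) b) (smul r (br h a b))
  | br_add_right {i j n : ℤ} (h : i + j = n) (a : FreeGLie.Pre R V i)
      (b b' : FreeGLie.Pre R V j) : Rel R V (br h a (add b b')) (add (br h a b) (br h a b'))
  | br_smul_right {i j n : ℤ} (h : i + j = n) (r : R) (a : FreeGLie.Pre R V i)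
      (b : FreeGLie.Pre R V j) : Rel R V (br h a (smul r b)) (smul r (br h a b))
  | skew {i j n : ℤ} (h : i + j = n) (h' : j + i = n) (x : FreeGLie.Pre R V i)
      (y : FreeGLie.Pre R V j) :
      Rel R V (br h x y) (smul (-1) (smul (koszulSign R i j) (br h' y x)))
  | jacobi {i j l a b c n : ℤ} (hyz : j + l = a) (hxa : i + a = n) (hxy : i + j = b)
      (hbz : b + l = n) (hxz : i + l = c) (hyc : j + c = n) (x : FreeGLie.Pre R V i)
      (y : FreeGLie.Pre R V j) (z : FreeGLie.Pre R V l) :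
      Rel R V (br hxa x (br hyz y z))
        (add (br hbz (br hxy x y) z) (smul (koszulSign R i j) (br hyc y (br hxz x z))))
  | sq_smul {i n : ℤ} (ho : Odd i) (h : i + i = n) (r : R) (x : FreeGLie.Pre R V i) :
      Rel R V (sq ho h (smul r x)) (smul (r ^ 2) (sq ho h x))
  | sq_add {i n : ℤ} (ho : Odd i) (h : i + i = n) (x y : FreeGLie.Pre R V i) :
      Rel R V (sq ho h (add x y)) (add (add (sq ho h x) (sq ho h y)) (br h x y))
  | br_self {i n : ℤ} (he : Even i) (h : i + i = n) (x : FreeGLie.Pre R V i) :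
      Rel R V (br h x x) zero
  | two_sq {i n : ℤ} (ho : Odd i) (h : i + i = n) (x : FreeGLie.Pre R V i) :
      Rel R V (smul 2 (sq ho h x)) (br h x x)
  | br_self_sq {i n p : ℤ} (ho : Odd i) (h : i + i = n) (h' : i + n = p)
      (x : FreeGLie.Pre R V i) : Rel R V (br h' x (sq ho h x)) zero
  | br_sq {i j n a p : ℤ} (ho : Odd i) (h : i + i = n) (h' : j + n = p) (h₁ : j + i = a)
      (h₂ : a + i = p) (y : FreeGLie.Pre R V j) (x : FreeGLie.Pre R V i) :
      Rel R V (br h' y (sq ho h x)) (br h₂ (br h₁ y x) x)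

end Rel

section Free

variable (R : Type u) [CommRing R] (V : ℤ → Type v)
  [∀ i, AddCommGroup (V i)] [∀ i, Module R (V i)]

/-- The setoid of the congruence `FreeGLie.Rel`. -/
def FreeGLie.setoid (n : ℤ) : Setoid (FreeGLie.Pre R V n) where
  r := FreeGLie.Rel R V
  iseqv := ⟨FreeGLie.Rel.refl, FreeGLie.Rel.symm, FreeGLie.Rel.trans⟩

/-- The free graded Lie algebra `F(V)` on the graded module `V`, degree by degree. -/
def FreeGLie (n : ℤ) : Type (max u v) := Quotient (FreeGLie.setoid R V n)

namespace FreeGLie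

variable {R V}

/-- The class of a formal expression. -/
def mk {n : ℤ} (a : Pre R V n) : FreeGLie R V n := Quotient.mk (setoid R V n) a

theorem mk_surjective {n : ℤ} (x : FreeGLie R V n) : ∃ a : Pre R V n, mk a = x :=
  Quotient.exists_rep x

theorem mk_eq {n : ℤ} {a b : Pre R V n} (h : Rel R V a b) : mk a = mk b := Quotient.sound h

instance (n : ℤ) : Zero (FreeGLie R V n) := ⟨mk Pre.zero⟩

instance (n : ℤ) : Add (FreeGLie R V n) :=
  ⟨Quotient.map₂ Pre.add (fun _ _ h _ _ h' => Rel.add_congr h h')⟩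

instance (n : ℤ) : SMul R (FreeGLie R V n) :=
  ⟨fun r => Quotient.map (Pre.smul r) (fun _ _ h => Rel.smul_congr r h)⟩

instance (n : ℤ) : Neg (FreeGLie R V n) := ⟨fun x => (-1 : R) • x⟩

theorem mk_zero {n : ℤ} : mk (Pre.zero : Pre R V n) = 0 := rfl
theorem mk_add {n : ℤ} (a b : Pre R V n) : mk (a.add b) = mk a + mk b := rfl
theorem mk_smul {n : ℤ} (r : R) (a : Pre R V n) : mk (a.smul r) = r • mk a := rfl

instance (n : ℤ) : AddCommGroup (FreeGLie R V n) :=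
  { AddGroup.ofLeftAxioms
      (fun x y z => by
        obtain ⟨x, rfl⟩ := mk_surjective x
        obtain ⟨y, rfl⟩ := mk_surjective y
        obtain ⟨z, rfl⟩ := mk_surjective z
        exact mk_eq (Rel.add_assoc x y z))
      (fun x => by
        obtain ⟨x, rfl⟩ := mk_surjective x
        exact mk_eq (Rel.zero_add x))
      (fun x => by
        obtain ⟨x, rfl⟩ := mk_surjective x
        exact mk_eq (Rel.neg_add x)) with
    add_comm := fun x y => by
      obtain ⟨x, rfl⟩ := mk_surjective x
      obtain ⟨y, rfl⟩ := mk_surjective y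
      exact mk_eq (Rel.add_comm x y) }

instance (n : ℤ) : Module R (FreeGLie R V n) :=
  Module.ofMinimalAxioms
    (fun r x y => by
      obtain ⟨x, rfl⟩ := mk_surjective x
      obtain ⟨y, rfl⟩ := mk_surjective y
      exact mk_eq (Rel.smul_add r x y))
    (fun r s x => by
      obtain ⟨x, rfl⟩ := mk_surjective x
      exact mk_eq (Rel.add_smul r s x))
    (fun r s x => by
      obtain ⟨x, rfl⟩ := mk_surjective x
      exact mk_eq (Rel.mul_smul r s x))
    (fun x => by
      obtain ⟨x, rfl⟩ := mk_surjective x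
      exact mk_eq (Rel.one_smul x))

/-- The inclusion of the generators `V → F(V)`. -/
def of (n : ℤ) : V n →ₗ[R] FreeGLie R V n where
  toFun x := mk (Pre.of x)
  map_add' x y := mk_eq (Rel.of_add x y)
  map_smul' r x := mk_eq (Rel.of_smul r x)

/-- The bracket of `F(V)`. -/
def brk {i j n : ℤ} (h : i + j = n) :
    FreeGLie R V i →ₗ[R] FreeGLie R V j →ₗ[R] FreeGLie R V n :=
  LinearMap.mk₂ R
    (Quotient.map₂ (Pre.br h) (fun _ _ h₁ _ _ h₂ => Rel.br_congr h h₁ h₂))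
    (fun x x' y => by
      obtain ⟨x, rfl⟩ := mk_surjective x
      obtain ⟨x', rfl⟩ := mk_surjective x'
      obtain ⟨y, rfl⟩ := mk_surjective y
      exact mk_eq (Rel.br_add_left h x x' y))
    (fun r x y => by
      obtain ⟨x, rfl⟩ := mk_surjective x
      obtain ⟨y, rfl⟩ := mk_surjective y
      exact mk_eq (Rel.br_smul_left h r x y))
    (fun x y y' => by
      obtain ⟨x, rfl⟩ := mk_surjective x
      obtain ⟨y', rfl⟩ := mk_surjective y'
      obtain ⟨y, rfl⟩ := mk_surjective y
      exact mk_eq (Rel.br_add_right h x y y'))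
    (fun r x y => by
      obtain ⟨x, rfl⟩ := mk_surjective x
      obtain ⟨y, rfl⟩ := mk_surjective y
      exact mk_eq (Rel.br_smul_right h r x y))

theorem neg_eq {n : ℤ} (x : FreeGLie R V n) : -x = (-1 : R) • x := rfl

instance : GLie R (FreeGLie R V) where
  br h := brk h
  sq ho h := Quotient.map (Pre.sq ho h) (fun _ _ h' => Rel.sq_congr ho h h')
  skew h h' x y := by
    obtain ⟨x, rfl⟩ := mk_surjective x
    obtain ⟨y, rfl⟩ := mk_surjective y
    exact mk_eq (Rel.skew h h' x y)
  jacobi h₁ h₂ h₃ h₄ h₅ h₆ x y z := by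
    obtain ⟨x, rfl⟩ := mk_surjective x
    obtain ⟨y, rfl⟩ := mk_surjective y
    obtain ⟨z, rfl⟩ := mk_surjective z
    exact mk_eq (Rel.jacobi h₁ h₂ h₃ h₄ h₅ h₆ x y z)
  sq_smul ho h a x := by
    obtain ⟨x, rfl⟩ := mk_surjective x
    exact mk_eq (Rel.sq_smul ho h a x)
  sq_add ho h x y := by
    obtain ⟨x, rfl⟩ := mk_surjective x
    obtain ⟨y, rfl⟩ := mk_surjective y
    exact mk_eq (Rel.sq_add ho h x y)
  br_self he h x := by
    obtain ⟨x, rfl⟩ := mk_surjective x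
    exact mk_eq (Rel.br_self he h x)
  two_sq ho h x := by
    obtain ⟨x, rfl⟩ := mk_surjective x
    exact mk_eq (Rel.two_sq ho h x)
  br_self_sq ho h h' x := by
    obtain ⟨x, rfl⟩ := mk_surjective x
    exact mk_eq (Rel.br_self_sq ho h h' x)
  br_sq ho h h' h₁ h₂ y x := by
    obtain ⟨x, rfl⟩ := mk_surjective x
    obtain ⟨y, rfl⟩ := mk_surjective y
    exact mk_eq (Rel.br_sq ho h h' h₁ h₂ y x)

theorem mk_br {i j n : ℤ} (h : i + j = n) (a : Pre R V i) (b : Pre R V j) :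
    mk (Pre.br h a b) = GLie.br (R := R) h (mk a) (mk b) := rfl

theorem mk_sq {i n : ℤ} (ho : Odd i) (h : i + i = n) (a : Pre R V i) :
    mk (Pre.sq ho h a) = GLie.sq (R := R) ho h (mk a) := rfl

section Lift

variable {L : ℤ → Type w} [∀ i, AddCommGroup (L i)] [∀ i, Module R (L i)] [GLie R L]

/-- Evaluation of formal expressions in a graded Lie algebra. -/
def eval (f : ∀ i, V i →ₗ[R] L i) : ∀ {n : ℤ}, Pre R V n → L n
  | _, .of x => f _ x
  | _, .zero => 0
  | _, .add a b => eval f a + eval f b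
  | _, .smul r a => r • eval f a
  | _, .br h a b => GLie.br (R := R) h (eval f a) (eval f b)
  | _, .sq ho h a => GLie.sq (R := R) ho h (eval f a)

theorem eval_rel (f : ∀ i, V i →ₗ[R] L i) {n : ℤ} {a b : Pre R V n} (h : Rel R V a b) :
    eval f a = eval f b := by
  induction h with
  | refl => rfl
  | symm _ ih => exact ih.symm
  | trans _ _ ih ih' => exact ih.trans ih'
  | add_congr _ _ ih ih' => simp only [eval, ih, ih']
  | smul_congr _ _ ih => simp only [eval, ih]
  | br_congr _ _ _ ih ih' => simp only [eval, ih, ih']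
  | sq_congr _ _ _ ih => simp only [eval, ih]
  | add_assoc a b c => exact _root_.add_assoc _ _ _
  | add_comm a b => exact _root_.add_comm _ _
  | zero_add a => exact _root_.zero_add _
  | neg_add a => simp [eval]
  | smul_add r a b => exact _root_.smul_add _ _ _
  | add_smul r s a => exact _root_.add_smul _ _ _
  | mul_smul r s a => exact (smul_smul _ _ _).symm
  | one_smul a => exact _root_.one_smul _ _
  | of_add x y => exact map_add _ _ _
  | of_smul r x => exact map_smul _ _ _
  | br_add_left h a a' b => simp [eval]
  | br_smul_left h r a b => simp [eval]
  | br_add_right h a b b' => simp [eval]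
  | br_smul_right h r a b => simp [eval]
  | skew h h' x y => simp only [eval, GLie.skew h h' (eval f x) (eval f y), neg_smul,
      _root_.one_smul]
  | jacobi h₁ h₂ h₃ h₄ h₅ h₆ x y z => exact GLie.jacobi h₁ h₂ h₃ h₄ h₅ h₆ _ _ _
  | sq_smul ho h r x => exact GLie.sq_smul ho h _ _
  | sq_add ho h x y => exact GLie.sq_add ho h _ _
  | br_self he h x => exact GLie.br_self he h _
  | two_sq ho h x => exact GLie.two_sq ho h _
  | br_self_sq ho h h' x => exact GLie.br_self_sq ho h h' _
  | br_sq ho h h' h₁ h₂ y x => exact GLie.br_sq ho h h' h₁ h₂ _ _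

/-- The universal property of `F(V)`: linear degree-preserving maps `V → L` extend to
homomorphisms `F(V) → L`. -/
def lift (f : ∀ i, V i →ₗ[R] L i) : GLieHom R (FreeGLie R V) L where
  map i :=
    { toFun := Quotient.lift (eval f) (fun _ _ h => eval_rel f h)
      map_add' := fun x y => by
        obtain ⟨x, rfl⟩ := mk_surjective x
        obtain ⟨y, rfl⟩ := mk_surjective y
        rfl
      map_smul' := fun r x => by
        obtain ⟨x, rfl⟩ := mk_surjective x
        rfl }
  map_br h x y := by
    obtain ⟨x, rfl⟩ := mk_surjective x
    obtain ⟨y, rfl⟩ := mk_surjective y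
    rfl
  map_sq ho h x := by
    obtain ⟨x, rfl⟩ := mk_surjective x
    rfl

theorem lift_of (f : ∀ i, V i →ₗ[R] L i) {i : ℤ} (x : V i) : (lift f).map i (of i x) = f i x :=
  rfl

/-- Uniqueness in the universal property. -/
theorem hom_ext (φ ψ : GLieHom R (FreeGLie R V) L)
    (h : ∀ i (x : V i), φ.map i (of i x) = ψ.map i (of i x)) (i : ℤ) (x : FreeGLie R V i) :
    φ.map i x = ψ.map i x := by
  obtain ⟨x, rfl⟩ := mk_surjective x
  induction x with
  | of x => exact h _ x
  | zero => rw [mk_zero, map_zero, map_zero]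
  | add a b iha ihb => rw [mk_add, map_add, map_add, iha, ihb]
  | smul r a ih => rw [mk_smul, map_smul, map_smul, ih]
  | br h a b iha ihb => rw [mk_br, φ.map_br, ψ.map_br, iha, ihb]
  | sq ho h a ih => rw [mk_sq, φ.map_sq, ψ.map_sq, ih]

end Lift

/-- If `V` is concentrated in degree `m`, then `F(V)` vanishes outside the positive multiples of
`m`. -/
theorem eq_zero_of_degree {m : ℤ} (hV : ∀ i, i ≠ m → Subsingleton (V i)) {n : ℤ}
    (hn : ¬ ∃ r : ℕ, 1 ≤ r ∧ n = r * m) (x : FreeGLie R V n) : x = 0 := by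
  obtain ⟨x, rfl⟩ := mk_surjective x
  induction x with
  | @of n x =>
    have : Subsingleton (V n) := hV n (fun e => hn ⟨1, le_rfl, by simpa using e⟩)
    change of n x = 0
    rw [Subsingleton.elim x 0, map_zero]
  | zero => rfl
  | add a b iha ihb => rw [mk_add, iha hn, ihb hn, add_zero]
  | smul r a ih => rw [mk_smul, ih hn, smul_zero]
  | @br i j n h a b iha ihb =>
    rw [mk_br]
    by_cases hi : ∃ r : ℕ, 1 ≤ r ∧ i = r * m
    · by_cases hj : ∃ r : ℕ, 1 ≤ r ∧ j = r * m
      · obtain ⟨r, hr, rfl⟩ := hi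
        obtain ⟨s, hs, rfl⟩ := hj
        exact (hn ⟨r + s, by omega, by rw [← h]; push_cast; ring⟩).elim
      · rw [ihb hj, map_zero]
    · rw [iha hi, map_zero, LinearMap.zero_apply]
  | @sq i n ho h a ih =>
    rw [mk_sq]
    by_cases hi : ∃ r : ℕ, 1 ≤ r ∧ i = r * m
    · obtain ⟨r, hr, rfl⟩ := hi
      exact (hn ⟨r + r, by omega, by rw [← h]; push_cast; ring⟩).elim
    · rw [ih hi, ← zero_smul R (0 : FreeGLie R V i), GLie.sq_smul]
      simp

end FreeGLie

end Free

/-! ### The graded commutator and the tensor algebra -/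

section Assoc

variable (R : Type u) [CommRing R]

/-- The graded commutator `a b - (-1)^(i j) b a` of elements `a`, `b` of degrees `i`, `j`. -/
def gradedCommutator {A : Type v} [Ring A] [Algebra R A] (i j : ℤ) (a b : A) : A :=
  a * b - koszulSign R i j • (b * a)

/-- The graded module with a copy of `A` in every degree. -/
def AssocGLie (A : Type v) : ℤ → Type v := fun _ => A

variable {A : Type v} [Ring A] [Algebra R A]

instance (i : ℤ) : AddCommGroup (AssocGLie A i) := inferInstanceAs (AddCommGroup A)

instance (i : ℤ) : Module R (AssocGLie A i) := inferInstanceAs (Module R A)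

theorem koszulSign_comm (i j : ℤ) : koszulSign R i j = koszulSign R j i := by
  rw [koszulSign, koszulSign, mul_comm]

theorem koszulSign_mul_self (i j : ℤ) : koszulSign R i j * koszulSign R i j = 1 := by
  rw [koszulSign, ← Int.cast_mul, ← Units.val_mul, ← Int.negOnePow_add,
    Int.negOnePow_even _ ⟨_, rfl⟩]
  simp

theorem koszulSign_add_right (i j l : ℤ) :
    koszulSign R i (j + l) = koszulSign R i j * koszulSign R i l := by
  rw [koszulSign, mul_add, Int.negOnePow_add]
  simp [koszulSign]

theorem koszulSign_add_left (i j l : ℤ) :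
    koszulSign R (i + j) l = koszulSign R i l * koszulSign R j l := by
  rw [koszulSign_comm, koszulSign_add_right, koszulSign_comm R l i, koszulSign_comm R l j]

theorem koszulSign_odd {i : ℤ} (h : Odd i) : koszulSign R i i = -1 := by
  rw [koszulSign, Int.negOnePow_odd _ (h.mul h)]
  simp

theorem koszulSign_even {i : ℤ} (h : Even i) (j : ℤ) : koszulSign R i j = 1 := by
  rw [koszulSign, Int.negOnePow_even _ (h.mul_right j)]
  simp

/-- An associative algebra carries the graded commutator (for formal degrees `i`, `j`) and the
squaring `a ↦ a * a`.  For a graded algebra `A = ⊕ A i` the graded Lie algebra `i ↦ A i` sits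
inside this one. -/
instance : GLie R (AssocGLie A) where
  br {i j n} _ := LinearMap.mk₂ R (fun a b : A => (gradedCommutator R i j a b : A))
    (fun (a a' b : A) => by
      change gradedCommutator R i j (a + a') b
        = gradedCommutator R i j a b + gradedCommutator R i j a' b
      simp only [gradedCommutator, add_mul, mul_add, smul_add]; abel)
    (fun r (a b : A) => by
      change gradedCommutator R i j (r • a) b = r • gradedCommutator R i j a b
      simp only [gradedCommutator, smul_mul_assoc, mul_smul_comm, smul_sub, smul_comm r])
    (fun (a b b' : A) => by
      change gradedCommutator R i j a (b + b')
        = gradedCommutator R i j a b + gradedCommutator R i j a b'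
      simp only [gradedCommutator, add_mul, mul_add, smul_add]; abel)
    (fun r (a b : A) => by
      change gradedCommutator R i j a (r • b) = r • gradedCommutator R i j a b
      simp only [gradedCommutator, smul_mul_assoc, mul_smul_comm, smul_sub, smul_comm r])
  sq _ _ a := (show A from a) * (show A from a)
  skew {i j n} _ _ (x : A) (y : A) := by
    change gradedCommutator R i j x y = -(koszulSign R i j • gradedCommutator R j i y x)
    simp only [gradedCommutator, koszulSign_comm R j i, smul_sub, smul_smul,
      koszulSign_mul_self, one_smul]
    abel
  jacobi {i j l a b c n} h₁ _ h₃ _ h₅ _ (x : A) (y : A) (z : A) := by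
    subst h₁ h₃ h₅
    change gradedCommutator R i (j + l) x (gradedCommutator R j l y z)
      = gradedCommutator R (i + j) l (gradedCommutator R i j x y) z
        + koszulSign R i j • gradedCommutator R j (i + l) y (gradedCommutator R i l x z)
    have e := koszulSign_mul_self R i j
    simp only [gradedCommutator, koszulSign_add_right, koszulSign_add_left,
      koszulSign_comm R j i, mul_sub, sub_mul, smul_sub, smul_smul, mul_smul_comm,
      smul_mul_assoc, mul_assoc, mul_left_comm (koszulSign R i j), ← mul_assoc (koszulSign R i j)
        (koszulSign R i j), e, one_mul]
    simp only [mul_comm (koszulSign R j l)]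
    abel
  sq_smul _ _ r (x : A) := by
    change (r • x) * (r • x) = r ^ 2 • (x * x)
    rw [smul_mul_smul_comm, sq]
  sq_add {i n} ho _ (x : A) (y : A) := by
    change (x + y) * (x + y) = x * x + y * y + gradedCommutator R i i x y
    rw [gradedCommutator, koszulSign_odd R ho, neg_one_smul, add_mul, mul_add, mul_add]
    abel
  br_self {i n} he _ (x : A) := by
    change gradedCommutator R i i x x = 0
    rw [gradedCommutator, koszulSign_even R he, one_smul, sub_self]
  two_sq {i n} ho _ (x : A) := by
    change (2 : R) • (x * x) = gradedCommutator R i i x x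
    rw [gradedCommutator, koszulSign_odd R ho, neg_one_smul, sub_neg_eq_add, two_smul]
  br_self_sq {i n p} ho h _ (x : A) := by
    change gradedCommutator R i n x (x * x) = 0
    rw [gradedCommutator, ← h, koszulSign_comm, koszulSign_even R ⟨i, rfl⟩, one_smul, mul_assoc,
      sub_self]
  br_sq {i j n a p} ho h _ h₁ _ (y : A) (x : A) := by
    change gradedCommutator R j n y (x * x)
      = gradedCommutator R a i (gradedCommutator R j i y x) x
    subst h h₁
    rw [gradedCommutator, gradedCommutator, gradedCommutator, koszulSign_add_left,
      koszulSign_add_right, koszulSign_odd R ho, koszulSign_mul_self]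
    simp only [sub_mul, mul_sub, smul_sub, smul_smul, mul_smul_comm, smul_mul_assoc, mul_neg,
      neg_mul, mul_one, neg_smul, one_smul, koszulSign_mul_self, mul_assoc]
    abel

end Assoc

noncomputable section Tensor

variable (R : Type u) [CommRing R] (V : ℤ → Type v)
  [∀ i, AddCommGroup (V i)] [∀ i, Module R (V i)]

/-- The tensor algebra `T(V)` of the graded module `V`. -/
abbrev GTensorAlgebra : Type (max u v) := TensorAlgebra R (⨁ i, V i)

variable {V}

/-- The inclusion of `V` into `T(V)`, degree by degree. -/
def tensorOf (i : ℤ) : V i →ₗ[R] GTensorAlgebra R V :=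
  (TensorAlgebra.ι R).comp (DirectSum.lof R ℤ V i)

/-- The inclusion of `V m ⊗ V m` into `T(V)`. -/
def tensorOf₂ (m : ℤ) : V m ⊗[R] V m →ₗ[R] GTensorAlgebra R V :=
  TensorProduct.lift ((LinearMap.mul R (GTensorAlgebra R V)).compl₁₂ (tensorOf R m) (tensorOf R m))

/-- The canonical homomorphism `F(V) → T(V)` of graded Lie algebras, which is the inclusion on
`V`. -/
def FreeGLie.toTensor (n : ℤ) : FreeGLie R V n →ₗ[R] GTensorAlgebra R V :=
  (FreeGLie.lift (L := AssocGLie (GTensorAlgebra R V)) (fun i => tensorOf R i)).map n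

end Tensor

noncomputable section Main

variable {R : Type u} [CommRing R]

/-- The matrix of coefficients of a 2-tensor with respect to a basis: `t = ∑ g i j • b i ⊗ b j`. -/
def tensorMatrix {M : Type v} [AddCommGroup M] [Module R M] {k : ℕ}
    (b : Module.Basis (Fin k) R M) (t : M ⊗[R] M) : Matrix (Fin k) (Fin k) R :=
  Matrix.of fun i j => (b.tensorProduct b).repr t (i, j)

/-- The graded free module with basis a graded set `X`, `deg : X → ℤ`. -/
def GradedFree (R : Type u) [CommRing R] {X : Type v} (deg : X → ℤ) : ℤ → Type (max u v) :=
  fun i => {x : X // deg x = i} →₀ R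

instance {X : Type v} (deg : X → ℤ) (i : ℤ) : AddCommGroup (GradedFree R deg i) :=
  inferInstanceAs (AddCommGroup ({x : X // deg x = i} →₀ R))

instance {X : Type v} (deg : X → ℤ) (i : ℤ) : Module R (GradedFree R deg i) :=
  inferInstanceAs (Module R ({x : X // deg x = i} →₀ R))

/-- A generator `x` of degree `i`, as an element of the free graded Lie algebra on `X`. -/
def freeGen (R : Type u) [CommRing R] {X : Type v} (deg : X → ℤ) (x : X) {i : ℤ} (h : deg x = i) :
    FreeGLie R (GradedFree R deg) i :=
  FreeGLie.of i (show GradedFree R deg i from Finsupp.single ⟨x, h⟩ 1)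

/-- Degrees of the generators `v_1, …, v_r` (degree `m`), `w_1, …, w_r` (degree `2m`). -/
def vwDeg (r : ℕ) (m : ℤ) : Fin r ⊕ Fin r → ℤ := Sum.elim (fun _ => m) (fun _ => 2 * m)

/-- The free graded Lie algebra `F(v_1, …, v_r, w_1, …, w_r)`. -/
abbrev FreeVW (R : Type u) [CommRing R] (r : ℕ) (m : ℤ) : ℤ → Type u :=
  FreeGLie R (GradedFree R (vwDeg r m))

/-- The generator `v_a` of `F(v_1, …, v_r, w_1, …, w_r)`. -/
def genV (R : Type u) [CommRing R] {r : ℕ} (m : ℤ) (a : Fin r) : FreeVW R r m m :=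
  freeGen R (vwDeg r m) (Sum.inl a) rfl

/-- The generator `w_a` of `F(v_1, …, v_r, w_1, …, w_r)`. -/
def genW (R : Type u) [CommRing R] {r : ℕ} (m : ℤ) (a : Fin r) : FreeVW R r m (2 * m) :=
  freeGen R (vwDeg r m) (Sum.inr a) rfl

/-- The element `∑ [v_a, w_a]` of `F(v_1, …, v_r, w_1, …, w_r)`. -/
def vwRelator (R : Type u) [CommRing R] (r : ℕ) (m : ℤ) : FreeVW R r m (3 * m) :=
  ∑ a : Fin r, GLie.br (R := R) (show m + 2 * m = 3 * m by ring) (genV R m a) (genW R m a)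

/-- The ideal `(∑ [v_a, w_a])`. -/
def vwIdeal (R : Type u) [CommRing R] (r : ℕ) (m : ℤ) : GLieIdeal R (FreeVW R r m) :=
  GLieIdeal.gen (vwRelator R r m)

variable {V : ℤ → Type v} [∀ i, AddCommGroup (V i)] [∀ i, Module R (V i)]

/-- For `V` concentrated in the odd degree `m`, `l` in `F(V)` of degree `d`, and `W` a submodule of
`V`, the graded Lie subalgebra of `F(V) / (l)` which is the image of `W` in degree `m` and
everything in all the other degrees. -/
def LieW {m : ℤ} (hm : Odd m) (hV : ∀ i, i ≠ m → Subsingleton (V i)) {d : ℤ}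
    (l : FreeGLie R V d) (W : Submodule R (V m)) :
    GLieSub R (GLieIdeal.gen (R := R) l).Quot where
  carrier i := ⨅ h : i = m,
    (W.map (((GLieIdeal.gen (R := R) l).proj m).comp (FreeGLie.of m))).comap
      (LinearEquiv.cast (R := R) (M := (GLieIdeal.gen (R := R) l).Quot) h).toLinearMap
  br_mem {i j n} h x y _ _ := by
    refine (Submodule.mem_iInf _).2 fun hn => ?_
    subst hn
    obtain ⟨x, rfl⟩ := GLieIdeal.proj_surjective _ _ x
    obtain ⟨y, rfl⟩ := GLieIdeal.proj_surjective _ _ y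
    have key : GLie.br (R := R) h x y = 0 := by
      by_cases hi : ∃ r : ℕ, 1 ≤ r ∧ i = r * n
      · by_cases hj : ∃ r : ℕ, 1 ≤ r ∧ j = r * n
        · obtain ⟨r, hr, rfl⟩ := hi
          obtain ⟨s, hs, rfl⟩ := hj
          have h2 : ((r : ℤ) + s - 1) * n = 0 := by linear_combination h
          rcases mul_eq_zero.1 h2 with h3 | h3
          · omega
          · exact absurd (h3 ▸ hm : Odd (0 : ℤ)) (by decide)
        · rw [FreeGLie.eq_zero_of_degree hV hj y, map_zero]
      · rw [FreeGLie.eq_zero_of_degree hV hi x, map_zero, LinearMap.zero_apply]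
    change GLieIdeal.proj _ n (GLie.br (R := R) h x y) ∈ _
    rw [key, map_zero]
    exact zero_mem _
  sq_mem {i n} ho h x _ := by
    refine (Submodule.mem_iInf _).2 fun hn => ?_
    subst hn
    exact absurd hm (Int.not_odd_iff_even.2 ⟨i, h.symm⟩)

theorem LieW_self {m : ℤ} (hm : Odd m) (hV : ∀ i, i ≠ m → Subsingleton (V i)) {d : ℤ}
    (l : FreeGLie R V d) (W : Submodule R (V m)) :
    (LieW hm hV l W).carrier m
      = W.map (((GLieIdeal.gen (R := R) l).proj m).comp (FreeGLie.of m)) := by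
  ext x
  exact ⟨fun h => (Submodule.mem_iInf _).1 h rfl, fun h => (Submodule.mem_iInf _).2 fun _ => h⟩

theorem LieW_of_ne {m : ℤ} (hm : Odd m) (hV : ∀ i, i ≠ m → Subsingleton (V i)) {d : ℤ}
    (l : FreeGLie R V d) (W : Submodule R (V m)) {i : ℤ} (hi : i ≠ m) :
    (LieW hm hV l W).carrier i = ⊤ :=
  iInf_neg hi

end Main

/-! ### Signs and commutation rules -/

section Signs

variable {R : Type u} [CommRing R]

/-! Write `r = k - 1` and complete `v_1, …, v_r` to a basis `u, v_1, …, v_r` of `V`, with `u` of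
index 0. Let `g` be the symmetric coefficient matrix of the tensor `l`, `h` its inverse, and `λ` the
part of `l` involving only the `v_i`. In `F(V)`, `l = g_00 u² + ∑ g_0j [u, v_j] + λ`. The other rows
of `g` give the elements sought: `w_a = g_a0 u² + ∑ g_aj [u, v_j]`. Hence modulo `l` the matrix `g`
carries the family `y = (u², [u, v_1], …, [u, v_r])` to `x = (-λ, w_1, …, w_r)`, and `y = h x` is
expressed through the `v_i` and `w_i` alone.

Item 1 is the identity `∑ [v_a, w_a] = -[u, l]`, valid already in `F(V)` (`sum_br_wElt`). For item
2, contracting the second tensor factor with the coordinate dual to `u` kills `V ⊗ W` and sends `l,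
w_1, …, w_r` to the rows of `g`, which form a basis of `V` because `g` is invertible.

Item 3, surjectivity: the image of `P = F(v, w) / (∑ [v_a, w_a])` contains `u²` and all `[u, v_j]`,
so `u` normalizes it; together with the line `R u` it is a subalgebra containing `V`, and this line
only matters in degree `m` (`surjective_aux`).

Item 3, injectivity: the operator `ad u` is rebuilt on `P`. There is a derivation `D` of degree `m`
with `D v_i = y_i` and `D w_i = [y_0, z_i]`, where `z_i = ∑ g_ij v_j`. It respects the relation
because `∑ [y_i, w_i]` and `∑ [v_i, [y_0, z_i]]` both equal `[y_0, λ]` (`sum_br_yFam`,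
`sum_br_zFam`). Moreover `D y_0 = 0` and `D² = ad y_0` (`GLieDer.map_yFam_zero`, `vwDer_vwDer`), so
`E = P ⊕ R u` with `[u, x] = D x`, `u² = y_0` is a graded Lie algebra. The relator `l` vanishes in
`E` (`quad_extBasis`), which yields a homomorphism `F(V) / (l) → E`; its composite with the map from
`P` is the inclusion `P → E`.

Since 2 need not be invertible, squares are carried along everywhere: `D` comes from a homomorphism
to dual numbers, and quadratic elements are written with squares on the diagonal. -/

theorem koszulSign_of_odd {i j : ℤ} (hi : Odd i) (hj : Odd j) : koszulSign R i j = -1 := by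
  rw [koszulSign, Int.negOnePow_odd _ (hi.mul hj)]
  simp

theorem koszulSign_of_even_right {j : ℤ} (h : Even j) (i : ℤ) : koszulSign R i j = 1 := by
  rw [koszulSign_comm, koszulSign_even R h]

variable {L : ℤ → Type v} [∀ i, AddCommGroup (L i)] [∀ i, Module R (L i)] [GLie R L]

theorem GLie.br_comm_of_odd {i j n : ℤ} (hi : Odd i) (hj : Odd j) (h : i + j = n) (h' : j + i = n)
    (x : L i) (y : L j) : GLie.br (R := R) h x y = GLie.br (R := R) h' y x := by
  rw [GLie.skew h h', koszulSign_of_odd hi hj, neg_one_smul, neg_neg]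

theorem GLie.br_anticomm_of_even_left {i j n : ℤ} (hi : Even i) (h : i + j = n) (h' : j + i = n)
    (x : L i) (y : L j) : GLie.br (R := R) h x y = -GLie.br (R := R) h' y x := by
  rw [GLie.skew h h', koszulSign_even R hi, one_smul]

theorem GLie.br_anticomm_of_even_right {i j n : ℤ} (hj : Even j) (h : i + j = n) (h' : j + i = n)
    (x : L i) (y : L j) : GLie.br (R := R) h x y = -GLie.br (R := R) h' y x := by
  rw [GLie.skew h h', koszulSign_of_even_right hj, one_smul]

theorem GLie.sq_zero {i n : ℤ} (ho : Odd i) (h : i + i = n) :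
    GLie.sq (R := R) ho h (0 : L i) = 0 := by
  rw [← zero_smul R (0 : L i), GLie.sq_smul]
  simp

/-- The Jacobi identity with two elements of odd degree, written with right multiplications. -/
theorem GLie.br_br_of_odd {i j k a b c n : ℤ} (hj : Odd j) (hk : Odd k) (hjk : j + k = a)
    (hia : i + a = n) (hij : i + j = b) (hbk : b + k = n) (hik : i + k = c) (hcj : c + j = n)
    (x : L i) (y : L j) (z : L k) :
    GLie.br (R := R) hia x (GLie.br (R := R) hjk y z)
      = GLie.br (R := R) hbk (GLie.br (R := R) hij x y) z
        + GLie.br (R := R) hcj (GLie.br (R := R) hik x z) y := by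
  have hyc : j + c = n := by rw [← hcj, add_comm]
  rw [GLie.jacobi hjk hia hij hbk hik hyc, GLie.skew hyc hcj,
    show koszulSign R j c = koszulSign R j i * koszulSign R j k by
      rw [← hik, koszulSign_add_right],
    koszulSign_of_odd hj hk, smul_neg, smul_smul, koszulSign_comm R i j, ← mul_assoc,
    koszulSign_mul_self]
  simp

/-- For `u` of odd degree, `ad u ∘ ad u = ad u²`. -/
theorem GLie.br_br_self {i j a b n : ℤ} (hi : Odd i) (hij : i + j = a) (hia : i + a = n)
    (h : i + i = b) (hb : b + j = n) (u : L i) (x : L j) :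
    GLie.br (R := R) hia u (GLie.br (R := R) hij u x)
      = GLie.br (R := R) hb (GLie.sq (R := R) hi h u) x := by
  have hji : j + i = a := by rw [← hij, add_comm]
  have hai : a + i = n := by rw [← hia, add_comm]
  have hjb : j + b = n := by rw [← hb, add_comm]
  have hbe : Even b := h ▸ hi.add_odd hi
  rw [GLie.br_anticomm_of_even_left hbe hb hjb, GLie.br_sq hi h hjb hji hai, GLie.skew hia hai,
    GLie.skew hij hji]
  rw [map_neg, map_smul, LinearMap.neg_apply, LinearMap.smul_apply,
    show koszulSign R i a = koszulSign R i i * koszulSign R i j by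
      rw [← hij, koszulSign_add_right], koszulSign_odd R hi]
  simp [smul_smul, koszulSign_mul_self]

end Signs

/-! ### Homomorphisms, ideals and generators -/

section Homs

variable {R : Type u} [CommRing R] {L : ℤ → Type v} [∀ i, AddCommGroup (L i)]
  [∀ i, Module R (L i)] [GLie R L] {L' : ℤ → Type w} [∀ i, AddCommGroup (L' i)]
  [∀ i, Module R (L' i)] [GLie R L']

/-- Composition of homomorphisms of graded Lie algebras. -/
def GLieHom.comp {L'' : ℤ → Type*} [∀ i, AddCommGroup (L'' i)] [∀ i, Module R (L'' i)]
    [GLie R L''] (g : GLieHom R L' L'') (f : GLieHom R L L') : GLieHom R L L'' where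
  map i := (g.map i).comp (f.map i)
  map_br h x y := by simp [f.map_br, g.map_br]
  map_sq ho h x := by simp [f.map_sq, g.map_sq]

/-- The kernel of a homomorphism of graded Lie algebras. -/
def GLieHom.ker (f : GLieHom R L L') : GLieIdeal R L where
  carrier i := LinearMap.ker (f.map i)
  br_mem h x y hy := by
    rw [LinearMap.mem_ker] at hy ⊢
    rw [f.map_br, hy, map_zero]
  sq_mem ho h x hx := by
    rw [LinearMap.mem_ker] at hx ⊢
    rw [f.map_sq, hx, GLie.sq_zero]

theorem GLieIdeal.mem_gen_self {d : ℤ} (r : L d) :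
    r ∈ (GLieIdeal.gen (R := R) r).carrier d :=
  (Submodule.mem_iInf _).2 fun J => J.2

theorem GLieIdeal.gen_le {d : ℤ} {r : L d} (J : GLieIdeal R L) (hr : r ∈ J.carrier d) (i : ℤ) :
    (GLieIdeal.gen (R := R) r).carrier i ≤ J.carrier i :=
  iInf_le (fun J : {J : GLieIdeal R L // r ∈ J.carrier d} => J.1.carrier i) ⟨J, hr⟩

/-- The projection `L → L / I`. -/
def GLieIdeal.projHom (I : GLieIdeal R L) : GLieHom R L I.Quot where
  map := I.proj
  map_br _ _ _ := rfl
  map_sq _ _ _ := rfl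

/-- The inclusion of a graded Lie subalgebra. -/
def GLieSub.inclHom (S : GLieSub R L) : GLieHom R S.Carrier L where
  map := S.incl
  map_br _ _ _ := rfl
  map_sq _ _ _ := rfl

/-- The homomorphism out of `L / (r)` induced by a homomorphism which vanishes on `r`. -/
def GLieIdeal.genLift {d : ℤ} {r : L d} (f : GLieHom R L L') (hr : f.map d r = 0) :
    GLieHom R (GLieIdeal.gen (R := R) r).Quot L' where
  map i := ((GLieIdeal.gen (R := R) r).carrier i).liftQ (f.map i)
    (GLieIdeal.gen_le f.ker (LinearMap.mem_ker.2 hr) i)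
  map_br h x y := by
    obtain ⟨x, rfl⟩ := GLieIdeal.proj_surjective _ _ x
    obtain ⟨y, rfl⟩ := GLieIdeal.proj_surjective _ _ y
    exact f.map_br h x y
  map_sq ho h x := by
    obtain ⟨x, rfl⟩ := GLieIdeal.proj_surjective _ _ x
    exact f.map_sq ho h x

/-- A graded Lie subalgebra of `F(V)` which contains `V` is everything. -/
theorem FreeGLie.mem_of_generators {V : ℤ → Type w} [∀ i, AddCommGroup (V i)]
    [∀ i, Module R (V i)] (S : GLieSub R (FreeGLie R V))
    (hS : ∀ i (x : V i), FreeGLie.of i x ∈ S.carrier i) {i : ℤ} (x : FreeGLie R V i) :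
    x ∈ S.carrier i := by
  obtain ⟨x, rfl⟩ := FreeGLie.mk_surjective x
  induction x with
  | of x => exact hS _ x
  | zero => exact zero_mem _
  | add a b iha ihb => exact add_mem iha ihb
  | smul r a ih => exact Submodule.smul_mem _ r ih
  | br h a b iha ihb => exact S.br_mem h _ _ iha ihb
  | sq ho h a ih => exact S.sq_mem ho h _ ih

/-- Reduces a check on the whole generating module to its basis, in the form required by
`FreeGLie.mem_of_generators`. -/
theorem freeGen_mem {X : Type w} {deg : X → ℤ}
    (S : ∀ i, Submodule R (FreeGLie R (GradedFree R deg) i))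
    (hS : ∀ x, freeGen R deg x rfl ∈ S (deg x)) (i : ℤ) (x : GradedFree R deg i) :
    FreeGLie.of i x ∈ S i := by
  change x ∈ (S i).comap (FreeGLie.of i)
  induction x using Finsupp.induction_linear with
  | zero => exact zero_mem _
  | add f g hf hg => exact add_mem hf hg
  | single a r =>
    obtain ⟨a, rfl⟩ := a
    have : (Finsupp.single (⟨a, rfl⟩ : {x // deg x = deg a}) r : GradedFree R deg (deg a))
        = r • (show GradedFree R deg (deg a) from Finsupp.single ⟨a, rfl⟩ 1) := by
      change _ = r • (Finsupp.single _ _ : _ →₀ R)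
      rw [Finsupp.smul_single, smul_eq_mul, mul_one]
    rw [this]
    exact Submodule.smul_mem _ _ (hS a)

/-- The homomorphism out of the free graded Lie algebra on a graded set, with given values on the
generators. -/
noncomputable def freeGenLift {X : Type w} {deg : X → ℤ} (e : ∀ x, L (deg x)) :
    GLieHom R (FreeGLie R (GradedFree R deg)) L :=
  FreeGLie.lift (fun i => (Finsupp.linearCombination R
    (fun p : {x : X // deg x = i} => (p.2 ▸ e p.1 : L i)) : (_ →₀ R) →ₗ[R] L i))

theorem freeGenLift_freeGen {X : Type w} {deg : X → ℤ} (e : ∀ x, L (deg x)) (x : X) :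
    (freeGenLift (R := R) e).map (deg x) (freeGen R deg x rfl) = e x := by
  change Finsupp.linearCombination R _ (Finsupp.single _ _) = _
  simp

/-- The graded submodule on which two homomorphisms agree. -/
def GLieHom.eqLocus (f g : GLieHom R L L') : GLieSub R L where
  carrier i := LinearMap.eqLocus (f.map i) (g.map i)
  br_mem h x y hx hy := by
    rw [LinearMap.mem_eqLocus] at hx hy ⊢
    rw [f.map_br, g.map_br, hx, hy]
  sq_mem ho h x hx := by
    rw [LinearMap.mem_eqLocus] at hx ⊢
    rw [f.map_sq, g.map_sq, hx]

theorem freeGen_hom_ext {X : Type*} {deg : X → ℤ}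
    {f g : GLieHom R (FreeGLie R (GradedFree R deg)) L}
    (h : ∀ x, f.map (deg x) (freeGen R deg x rfl) = g.map (deg x) (freeGen R deg x rfl)) {i : ℤ}
    (x : FreeGLie R (GradedFree R deg) i) : f.map i x = g.map i x :=
  FreeGLie.mem_of_generators (f.eqLocus g) (freeGen_mem (f.eqLocus g).carrier h) x

end Homs

/-! ### Derivations of odd degree -/

section Derivation

variable (R : Type u) [CommRing R] (L : ℤ → Type v) [∀ i, AddCommGroup (L i)]
  [∀ i, Module R (L i)] [GLie R L]

/-- Derivations of degree `m` of a graded Lie algebra (`m` odd). -/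
structure GLieDer (m : ℤ) where
  map : ∀ {j n : ℤ}, m + j = n → (L j →ₗ[R] L n)
  map_br : ∀ {i j k a b n : ℤ} (hij : i + j = k) (hk : m + k = n) (hi : m + i = a)
    (haj : a + j = n) (hj : m + j = b) (hib : i + b = n) (x : L i) (y : L j),
    map hk (GLie.br (R := R) hij x y) = GLie.br (R := R) haj (map hi x) y
      + koszulSign R m i • GLie.br (R := R) hib x (map hj y)
  map_sq : ∀ {i k a n : ℤ} (ho : Odd i) (h : i + i = k) (hk : m + k = n) (hi : m + i = a)
    (ha : a + i = n) (x : L i),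
    map hk (GLie.sq (R := R) ho h x) = GLie.br (R := R) ha (map hi x) x

variable {R}

/-- The graded Lie algebra of dual numbers `x + ε y`, with `ε` of degree `-m`. -/
def DualGLie (m : ℤ) : ℤ → Type v := fun i => L i × L (m + i)

instance (m i : ℤ) : AddCommGroup (DualGLie L m i) :=
  inferInstanceAs (AddCommGroup (L i × L (m + i)))

instance (m i : ℤ) : Module R (DualGLie L m i) := inferInstanceAs (Module R (L i × L (m + i)))

variable {L}

namespace DualGLie

variable {m : ℤ}

/-- The bracket of dual numbers. -/
def brk {i j n : ℤ} (h : i + j = n) :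
    DualGLie L m i →ₗ[R] DualGLie L m j →ₗ[R] DualGLie L m n :=
  LinearMap.mk₂ R (fun x y => ((GLie.br (R := R) h x.1 y.1,
      GLie.br (R := R) (show m + i + j = m + n by rw [← h, add_assoc]) x.2 y.1
        + koszulSign R m i • GLie.br (R := R) (show i + (m + j) = m + n by
            rw [← h, add_left_comm]) x.1 y.2) : L n × L (m + n)))
    (fun x x' y => Prod.ext ((GLie.br (R := R) h).map_add₂ x.1 x'.1 y.1) (by
      change GLie.br (R := R) _ (x.2 + x'.2) y.1 + _ • GLie.br (R := R) _ (x.1 + x'.1) y.2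
        = (GLie.br (R := R) _ x.2 y.1 + _ • GLie.br (R := R) _ x.1 y.2)
          + (GLie.br (R := R) _ x'.2 y.1 + _ • GLie.br (R := R) _ x'.1 y.2)
      simp only [map_add, LinearMap.add_apply, smul_add]; abel))
    (fun a x y => Prod.ext ((GLie.br (R := R) h).map_smul₂ a x.1 y.1) (by
      change GLie.br (R := R) _ (a • x.2) y.1 + _ • GLie.br (R := R) _ (a • x.1) y.2
        = a • (GLie.br (R := R) _ x.2 y.1 + _ • GLie.br (R := R) _ x.1 y.2)
      simp only [map_smul, LinearMap.smul_apply, smul_add, smul_comm a]))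
    (fun x y y' => Prod.ext (map_add (GLie.br (R := R) h x.1) y.1 y'.1) (by
      change GLie.br (R := R) _ x.2 (y.1 + y'.1) + _ • GLie.br (R := R) _ x.1 (y.2 + y'.2)
        = (GLie.br (R := R) _ x.2 y.1 + _ • GLie.br (R := R) _ x.1 y.2)
          + (GLie.br (R := R) _ x.2 y'.1 + _ • GLie.br (R := R) _ x.1 y'.2)
      simp only [map_add, smul_add]; abel))
    (fun a x y => Prod.ext (map_smul (GLie.br (R := R) h x.1) a y.1) (by
      change GLie.br (R := R) _ x.2 (a • y.1) + _ • GLie.br (R := R) _ x.1 (a • y.2)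
        = a • (GLie.br (R := R) _ x.2 y.1 + _ • GLie.br (R := R) _ x.1 y.2)
      simp only [map_smul, smul_add, smul_comm a]))

end DualGLie

open DualGLie in
-- The second component of each axiom is its first-order variation, and follows from axioms of `L`
-- with one argument moved to degree `m + i`. Oddness of `m` enters through the squares: if `x.1`
-- has odd degree then `x.2` has even degree, so the two cross terms with `x.1` and `x.2` agree
-- instead of cancelling.
instance {m : ℤ} [hm : Fact (Odd m)] : GLie R (DualGLie L m) where
  br h := brk h
  sq {i n} ho h x := ((GLie.sq (R := R) ho h x.1,
    GLie.br (R := R) (show m + i + i = m + n by rw [← h, add_assoc]) x.2 x.1) : L n × L (m + n))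
  skew {i j n} h h' x y := by
    refine Prod.ext (GLie.skew h h' x.1 y.1) ?_
    change GLie.br (R := R) _ x.2 y.1 + koszulSign R m i • GLie.br (R := R) _ x.1 y.2
      = -(koszulSign R i j • (GLie.br (R := R) _ y.2 x.1
        + koszulSign R m j • GLie.br (R := R) _ y.1 x.2))
    rw [GLie.skew _ (show j + (m + i) = m + n by rw [← h', add_left_comm]) x.2 y.1,
      GLie.skew _ (show m + j + i = m + n by rw [← h', add_assoc]) x.1 y.2]
    simp only [koszulSign_add_left, koszulSign_add_right, smul_add, smul_neg, smul_smul,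
      koszulSign_comm R i m, ← mul_assoc, koszulSign_mul_self, one_mul,
      mul_comm (koszulSign R m j)]
    abel
  jacobi {i j l a b c n} h₁ h₂ h₃ h₄ h₅ h₆ x y z := by
    refine Prod.ext (GLie.jacobi h₁ h₂ h₃ h₄ h₅ h₆ x.1 y.1 z.1) ?_
    change GLie.br (R := R) _ x.2 (GLie.br (R := R) h₁ y.1 z.1)
        + koszulSign R m i • GLie.br (R := R) _ x.1 (GLie.br (R := R) _ y.2 z.1
          + koszulSign R m j • GLie.br (R := R) _ y.1 z.2)
      = (GLie.br (R := R) _ (GLie.br (R := R) _ x.2 y.1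
          + koszulSign R m i • GLie.br (R := R) _ x.1 y.2) z.1
          + koszulSign R m b • GLie.br (R := R) _ (GLie.br (R := R) h₃ x.1 y.1) z.2)
        + koszulSign R i j • (GLie.br (R := R) _ y.2 (GLie.br (R := R) h₅ x.1 z.1)
          + koszulSign R m j • GLie.br (R := R) _ y.1 (GLie.br (R := R) _ x.2 z.1
            + koszulSign R m i • GLie.br (R := R) _ x.1 z.2))
    subst h₁ h₃ h₅ h₂
    rw [GLie.jacobi rfl _ (show m + i + j = m + (i + j) by ring) (by ring)
        (show m + i + l = m + (i + l) by ring) (by ring) x.2 y.1 z.1]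
    simp only [map_add, map_smul, smul_add, LinearMap.add_apply, LinearMap.smul_apply]
    rw [GLie.jacobi (show m + j + l = m + (j + l) by ring) _
        (show i + (m + j) = m + (i + j) by ring) (by ring) (show i + l = i + l from rfl) (by ring)
        x.1 y.2 z.1,
      GLie.jacobi (show j + (m + l) = m + (j + l) by ring) _
        (show i + j = i + j from rfl) (by ring) (show i + (m + l) = m + (i + l) by ring) (by ring)
        x.1 y.1 z.2]
    simp only [koszulSign_add_left, koszulSign_add_right, smul_add, smul_smul,
      koszulSign_comm R i m]
    have e := koszulSign_mul_self R m i
    have e1 : koszulSign R m i * (koszulSign R m i * koszulSign R i j) = koszulSign R i j := by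
      rw [← mul_assoc, e, one_mul]
    simp only [e1, mul_comm, mul_left_comm]
    abel
  sq_smul {i n} ho h a x := by
    refine Prod.ext (GLie.sq_smul ho h a x.1) ?_
    change GLie.br (R := R) _ (a • x.2) (a • x.1) = a ^ 2 • GLie.br (R := R) _ x.2 x.1
    simp [smul_smul, sq]
  sq_add {i n} ho h x y := by
    refine Prod.ext (GLie.sq_add ho h x.1 y.1) ?_
    change GLie.br (R := R) _ (x.2 + y.2) (x.1 + y.1) = GLie.br (R := R) _ x.2 x.1
      + GLie.br (R := R) _ y.2 y.1
      + (GLie.br (R := R) _ x.2 y.1 + koszulSign R m i • GLie.br (R := R) _ x.1 y.2)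
    rw [GLie.br_anticomm_of_even_right (hm.out.add_odd ho) _
      (show m + i + i = m + n by rw [← h, add_assoc]) x.1 y.2, koszulSign_of_odd hm.out ho]
    simp only [map_add, LinearMap.add_apply, neg_smul, one_smul, neg_neg]
    abel
  br_self {i n} he h x := by
    refine Prod.ext (GLie.br_self he h x.1) ?_
    change GLie.br (R := R) _ x.2 x.1 + koszulSign R m i • GLie.br (R := R) _ x.1 x.2 = 0
    rw [GLie.br_anticomm_of_even_left he _ (show m + i + i = m + n by rw [← h, add_assoc]) x.1 x.2,
      koszulSign_of_even_right he]
    simp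
  two_sq {i n} ho h x := by
    refine Prod.ext (GLie.two_sq ho h x.1) ?_
    change (2 : R) • GLie.br (R := R) _ x.2 x.1
      = GLie.br (R := R) _ x.2 x.1 + koszulSign R m i • GLie.br (R := R) _ x.1 x.2
    rw [GLie.br_anticomm_of_even_right (hm.out.add_odd ho) _
      (show m + i + i = m + n by rw [← h, add_assoc]) x.1 x.2, koszulSign_of_odd hm.out ho]
    simp [two_smul]
  br_self_sq {i n p} ho h h' x := by
    refine Prod.ext (GLie.br_self_sq ho h h' x.1) ?_
    change GLie.br (R := R) _ x.2 (GLie.sq (R := R) ho h x.1)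
      + koszulSign R m i • GLie.br (R := R) _ x.1 (GLie.br (R := R) _ x.2 x.1) = 0
    have hn : Odd (m + n) := hm.out.add_even (h ▸ ho.add_odd ho)
    rw [GLie.br_sq ho h _ (show m + i + i = m + n by rw [← h, add_assoc])
      (show m + n + i = m + p by rw [← h']; ring), koszulSign_of_odd hm.out ho,
      GLie.br_comm_of_odd ho hn _ (show m + n + i = m + p by rw [← h']; ring)]
    simp
  br_sq {i j n a p} ho h h' h₁ h₂ y x := by
    refine Prod.ext (GLie.br_sq ho h h' h₁ h₂ y.1 x.1) ?_
    change GLie.br (R := R) _ y.2 (GLie.sq (R := R) ho h x.1)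
        + koszulSign R m j • GLie.br (R := R) _ y.1 (GLie.br (R := R) _ x.2 x.1)
      = GLie.br (R := R) _ (GLie.br (R := R) _ y.2 x.1
          + koszulSign R m j • GLie.br (R := R) _ y.1 x.2) x.1
        + koszulSign R m a • GLie.br (R := R) _ (GLie.br (R := R) h₁ y.1 x.1) x.2
    subst h h₁ h₂
    rw [GLie.br_sq ho rfl _ (show m + j + i = m + (j + i) by ring)
      (show m + (j + i) + i = m + (j + i + i) by ring),
      GLie.jacobi (show m + i + i = m + (i + i) by ring) _
        (show j + (m + i) = m + (j + i) by ring) (by ring) rfl (by ring) y.1 x.2 x.1,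
      GLie.skew (show m + i + (j + i) = m + (j + i + i) by ring) (by ring) x.2]
    simp only [map_add, map_smul, LinearMap.add_apply, LinearMap.smul_apply, smul_add, smul_neg,
      smul_smul, koszulSign_add_left, koszulSign_add_right, koszulSign_odd R ho,
      koszulSign_of_odd hm.out ho, koszulSign_comm R j m, koszulSign_comm R j i]
    have e := koszulSign_mul_self R m j
    have e' := koszulSign_mul_self R i j
    simp only [add_assoc]
    congr 2
    rw [← neg_smul]
    congr 1
    linear_combination (-koszulSign R m j * koszulSign R i j ^ 2) * e - koszulSign R m j * e'

/-- The projection of the dual numbers to `L`. -/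
def DualGLie.fst (m : ℤ) [Fact (Odd m)] : GLieHom R (DualGLie L m) L where
  map i := LinearMap.fst R (L i) (L (m + i))
  map_br _ _ _ := rfl
  map_sq _ _ _ := rfl

/-- A section of the projection from the dual numbers is a derivation. -/
def GLieDer.ofSection {m : ℤ} [hm : Fact (Odd m)] (f : GLieHom R L (DualGLie L m))
    (hf : ∀ i (x : L i), (f.map i x).1 = x) : GLieDer R L m where
  map {j n} h := (LinearEquiv.cast (R := R) (M := L) h).toLinearMap.comp
    ((LinearMap.snd R (L j) (L (m + j))).comp (f.map j))
  map_br {i j k a b n} hij hk hi haj hj hib x y := by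
    subst hij hi hj hk
    have := congrArg Prod.snd (f.map_br (R := R) rfl x y)
    refine this.trans ?_
    change GLie.br (R := R) _ (f.map i x).2 (f.map j y).1
      + koszulSign R m i • GLie.br (R := R) _ (f.map i x).1 (f.map j y).2 = _
    rw [hf, hf]
    rfl
  map_sq {i k a n} ho h hk hi ha x := by
    subst h hi hk
    have := congrArg Prod.snd (f.map_sq (R := R) ho rfl x)
    refine this.trans ?_
    change GLie.br (R := R) _ (f.map i x).2 (f.map i x).1 = _
    rw [hf]
    rfl

theorem GLieDer.ofSection_map {m : ℤ} [hm : Fact (Odd m)] (f : GLieHom R L (DualGLie L m))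
    (hf : ∀ i (x : L i), (f.map i x).1 = x) {j : ℤ} (x : L j) :
    (GLieDer.ofSection f hf).map rfl x = (f.map j x).2 := rfl

theorem GLieDer.map_cast {m : ℤ} (D : GLieDer R L m) {j n n' : ℤ} (h : m + j = n)
    (h' : m + j = n') (e : n = n') (x : L j) :
    D.map h' x = LinearEquiv.cast (R := R) (M := L) e (D.map h x) := by
  subst e
  rfl

end Derivation

/-! ### Extensions of graded Lie algebras by abelian ones -/

section Extension

variable (R : Type u) [CommRing R] (L : ℤ → Type v) [∀ i, AddCommGroup (L i)]
  [∀ i, Module R (L i)] [GLie R L] (U : ℤ → Type w) [∀ i, AddCommGroup (U i)]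
  [∀ i, Module R (U i)]

/-- The data of an extension of the abelian graded Lie algebra `U` by `L` with a linear section:
`U` acts by derivations, and the section has brackets `br` and squares `sq` in `L`. -/
structure GLieExt where
  act : ∀ {i j n : ℤ}, i + j = n → (U i →ₗ[R] L j →ₗ[R] L n)
  br : ∀ {i j n : ℤ}, i + j = n → (U i →ₗ[R] U j →ₗ[R] L n)
  sq : ∀ {i n : ℤ}, Odd i → i + i = n → U i → L n
  act_br : ∀ {i j l a b c n : ℤ} (hjl : j + l = a) (hia : i + a = n) (hij : i + j = b)
    (hbl : b + l = n) (hil : i + l = c) (hjc : j + c = n) (a : U i) (y : L j) (z : L l),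
    act hia a (GLie.br (R := R) hjl y z) = GLie.br (R := R) hbl (act hij a y) z
      + koszulSign R i j • GLie.br (R := R) hjc y (act hil a z)
  act_sq : ∀ {i j b k n : ℤ} (ho : Odd j) (h : j + j = k) (hik : i + k = n) (hij : i + j = b)
    (hb : b + j = n) (a : U i) (y : L j),
    act hik a (GLie.sq (R := R) ho h y) = GLie.br (R := R) hb (act hij a y) y
  act_act : ∀ {i j l b c d n : ℤ} (hjl : j + l = c) (hic : i + c = n) (hij : i + j = b)
    (hbl : b + l = n) (hil : i + l = d) (hjd : j + d = n) (a : U i) (b : U j) (z : L l),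
    act hic a (act hjl b z) = GLie.br (R := R) hbl (br hij a b) z
      + koszulSign R i j • act hjd b (act hil a z)
  act_act_self : ∀ {i j b c n : ℤ} (ho : Odd i) (hij : i + j = c) (hic : i + c = n)
    (h : i + i = b) (hb : b + j = n) (a : U i) (y : L j),
    act hic a (act hij a y) = GLie.br (R := R) hb (sq ho h a) y
  act_of_br : ∀ {i j l b n : ℤ} (hjl : j + l = b) (hib : i + b = n) (a : U i) (b : U j) (c : U l),
    act hib a (br hjl b c) = 0
  act_of_sq : ∀ {i j b n : ℤ} (ho : Odd j) (h : j + j = b) (hib : i + b = n) (a : U i) (b : U j),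
    act hib a (sq ho h b) = 0
  skew : ∀ {i j n : ℤ} (h : i + j = n) (h' : j + i = n) (a : U i) (b : U j),
    br h a b = -(koszulSign R i j • br h' b a)
  br_self : ∀ {i n : ℤ} (_ : Even i) (h : i + i = n) (a : U i), br h a a = 0
  sq_smul : ∀ {i n : ℤ} (ho : Odd i) (h : i + i = n) (r : R) (a : U i),
    sq ho h (r • a) = r ^ 2 • sq ho h a
  sq_add : ∀ {i n : ℤ} (ho : Odd i) (h : i + i = n) (a b : U i),
    sq ho h (a + b) = sq ho h a + sq ho h b + br h a b
  two_sq : ∀ {i n : ℤ} (ho : Odd i) (h : i + i = n) (a : U i), (2 : R) • sq ho h a = br h a a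

variable {R L U}

namespace GLieExt

/-- The total space of an extension. -/
def Total (_ : GLieExt R L U) : ℤ → Type (max v w) := fun i => L i × U i

variable (e : GLieExt R L U)

instance (i : ℤ) : AddCommGroup (e.Total i) := inferInstanceAs (AddCommGroup (L i × U i))

instance (i : ℤ) : Module R (e.Total i) := inferInstanceAs (Module R (L i × U i))

/-- The bracket of an extension. -/
def brk {i j n : ℤ} (h : i + j = n) : e.Total i →ₗ[R] e.Total j →ₗ[R] e.Total n :=
  LinearMap.mk₂ R (fun x y => ((GLie.br (R := R) h x.1 y.1 + e.act h x.2 y.1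
      - koszulSign R i j • e.act ((add_comm j i).trans h) y.2 x.1 + e.br h x.2 y.2, 0) : L n × U n))
    (fun x x' y => Prod.ext (by
      change GLie.br (R := R) h (x.1 + x'.1) y.1 + e.act h (x.2 + x'.2) y.1
          - koszulSign R i j • e.act ((add_comm j i).trans h) y.2 (x.1 + x'.1)
          + e.br h (x.2 + x'.2) y.2
        = (GLie.br (R := R) h x.1 y.1 + e.act h x.2 y.1
          - koszulSign R i j • e.act ((add_comm j i).trans h) y.2 x.1 + e.br h x.2 y.2)
          + (GLie.br (R := R) h x'.1 y.1 + e.act h x'.2 y.1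
          - koszulSign R i j • e.act ((add_comm j i).trans h) y.2 x'.1 + e.br h x'.2 y.2)
      simp only [map_add, LinearMap.add_apply, smul_add]; abel) (add_zero (0 : U n)).symm)
    (fun a x y => Prod.ext (by
      change GLie.br (R := R) h (a • x.1) y.1 + e.act h (a • x.2) y.1
          - koszulSign R i j • e.act ((add_comm j i).trans h) y.2 (a • x.1)
          + e.br h (a • x.2) y.2
        = a • (GLie.br (R := R) h x.1 y.1 + e.act h x.2 y.1
          - koszulSign R i j • e.act ((add_comm j i).trans h) y.2 x.1 + e.br h x.2 y.2)
      simp only [map_smul, LinearMap.smul_apply, smul_add, smul_sub, smul_comm a])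
      (smul_zero a : a • (0 : U n) = 0).symm)
    (fun x y y' => Prod.ext (by
      change GLie.br (R := R) h x.1 (y.1 + y'.1) + e.act h x.2 (y.1 + y'.1)
          - koszulSign R i j • e.act ((add_comm j i).trans h) (y.2 + y'.2) x.1
          + e.br h x.2 (y.2 + y'.2)
        = (GLie.br (R := R) h x.1 y.1 + e.act h x.2 y.1
          - koszulSign R i j • e.act ((add_comm j i).trans h) y.2 x.1 + e.br h x.2 y.2)
          + (GLie.br (R := R) h x.1 y'.1 + e.act h x.2 y'.1
          - koszulSign R i j • e.act ((add_comm j i).trans h) y'.2 x.1 + e.br h x.2 y'.2)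
      simp only [map_add, LinearMap.add_apply, smul_add]; abel) (add_zero (0 : U n)).symm)
    (fun a x y => Prod.ext (by
      change GLie.br (R := R) h x.1 (a • y.1) + e.act h x.2 (a • y.1)
          - koszulSign R i j • e.act ((add_comm j i).trans h) (a • y.2) x.1
          + e.br h x.2 (a • y.2)
        = a • (GLie.br (R := R) h x.1 y.1 + e.act h x.2 y.1
          - koszulSign R i j • e.act ((add_comm j i).trans h) y.2 x.1 + e.br h x.2 y.2)
      simp only [map_smul, LinearMap.smul_apply, smul_add, smul_sub, smul_comm a])
      (smul_zero a : a • (0 : U n) = 0).symm)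

/-- Sorted by the number of arguments from `U`, the identity splits into the Jacobi identity of `L`
(none), the derivation property of the action (one, `t2` to `t4`), the commutator rule for two
actions (two, `t5` to `t7`) and the vanishing of the action on brackets of the section (three). The
remaining `t8` to `t10` only bring brackets into a common order. -/
theorem jacobi_aux {i j l a b c n : ℤ} (hyz : j + l = a) (hxa : i + a = n)
    (hxy : i + j = b) (hbz : b + l = n) (hxz : i + l = c) (hyc : j + c = n) (hzb : l + b = n)
    (hji : j + i = b) (hlj : l + j = a) (hli : l + i = c)
    (x : L i) (x' : U i) (y : L j) (y' : U j) (z : L l) (z' : U l) :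
    GLie.br (R := R) hxa x (GLie.br (R := R) hyz y z + e.act hyz y' z
        - koszulSign R j l • e.act hlj z' y + e.br hyz y' z')
      + e.act hxa x' (GLie.br (R := R) hyz y z + e.act hyz y' z
        - koszulSign R j l • e.act hlj z' y + e.br hyz y' z')
    = (GLie.br (R := R) hbz (GLie.br (R := R) hxy x y + e.act hxy x' y
        - koszulSign R i j • e.act hji y' x + e.br hxy x' y') z
      - koszulSign R b l • e.act hzb z' (GLie.br (R := R) hxy x y + e.act hxy x' y
        - koszulSign R i j • e.act hji y' x + e.br hxy x' y'))
      + koszulSign R i j • (GLie.br (R := R) hyc y (GLie.br (R := R) hxz x z + e.act hxz x' z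
        - koszulSign R i l • e.act hli z' x + e.br hxz x' z')
      + e.act hyc y' (GLie.br (R := R) hxz x z + e.act hxz x' z
        - koszulSign R i l • e.act hli z' x + e.br hxz x' z')) := by
  have hcj : c + j = n := by rw [← hyc, add_comm]
  have hai : a + i = n := by rw [← hxa, add_comm]
  have sb : koszulSign R b l = koszulSign R i l * koszulSign R j l := by
    rw [← hxy, koszulSign_add_left]
  have s1 := koszulSign_mul_self R i j
  have s2 := koszulSign_mul_self R i l
  have s3 := koszulSign_mul_self R j l
  have t1 := GLie.jacobi (R := R) hyz hxa hxy hbz hxz hyc x y z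
  have t2 := e.act_br hyz hxa hxy hbz hxz hyc x' y z
  have t3 := e.act_br hxz hyc hji hbz hyz hxa y' x z
  have t4 := e.act_br hxy hzb hli hcj hlj hxa z' x y
  have t5 := e.act_act hyz hxa hxy hbz hxz hyc x' y' z
  have t6 := e.act_act hlj hxa hxz hcj hxy hzb x' z' y
  have t7 := e.act_act hli hyc hyz hai hji hzb y' z' x
  have t8 := GLie.skew (R := R) hyc hcj y (e.act hli z' x)
  have t9 := GLie.skew (R := R) hyc hcj y (e.br hxz x' z')
  have t10 := GLie.skew (R := R) hxa hai x (e.br hyz y' z')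
  have sc : koszulSign R j c = koszulSign R i j * koszulSign R j l := by
    rw [← hxz, koszulSign_add_right, koszulSign_comm R j i]
  have sa : koszulSign R i a = koszulSign R i j * koszulSign R i l := by
    rw [← hyz, koszulSign_add_right]
  rw [sc] at t8 t9
  rw [sa] at t10
  rw [koszulSign_comm R j i] at t3
  rw [koszulSign_comm R l i] at t4
  simp only [map_add, map_sub, map_smul, LinearMap.add_apply, LinearMap.sub_apply,
    LinearMap.smul_apply, e.act_of_br, add_zero, smul_add, smul_sub, smul_smul, sb]
  rw [t1, t2, t3, t4, t5, t6, t7, t8, t9, t10]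
  -- Only the fact that the three signs square to one is still needed, so they are treated as
  -- scalars.
  generalize koszulSign R i j = p at *
  generalize koszulSign R i l = q at *
  generalize koszulSign R j l = r at *
  simp only [smul_add, smul_neg, smul_smul]
  match_scalars <;> try ring1
  · linear_combination -s1
  · linear_combination r * s2
  · linear_combination r * s1
  · linear_combination -(q * r) * s1

/-- All brackets and squares have zero component in `U`, so in iterated brackets the terms with that
component drop out; for the Jacobi identity this leaves exactly `jacobi_aux`. -/
instance : GLie R e.Total where
  br h := e.brk h
  sq {i n} ho h x := ((GLie.sq (R := R) ho h x.1 + e.act h x.2 x.1 + e.sq ho h x.2, 0) :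
    L n × U n)
  skew {i j n} h h' x y := by
    refine Prod.ext ?_ (by change (0 : U n) = -(koszulSign R i j • 0); simp)
    change GLie.br (R := R) h x.1 y.1 + e.act h x.2 y.1 - koszulSign R i j • e.act h' y.2 x.1
        + e.br h x.2 y.2
      = -(koszulSign R i j • (GLie.br (R := R) h' y.1 x.1 + e.act h' y.2 x.1
        - koszulSign R j i • e.act h x.2 y.1 + e.br h' y.2 x.2))
    rw [GLie.skew h h', e.skew h h', koszulSign_comm R j i]
    simp only [smul_add, smul_sub, smul_smul, koszulSign_mul_self, one_smul]
    abel
  jacobi {i j l a b c n} h₁ h₂ h₃ h₄ h₅ h₆ x y z := by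
    refine Prod.ext ?_ (by change (0 : U n) = 0 + koszulSign R i j • 0; simp)
    have := e.jacobi_aux h₁ h₂ h₃ h₄ h₅ h₆ ((add_comm _ _).trans h₄) ((add_comm _ _).trans h₃)
      ((add_comm _ _).trans h₁) ((add_comm _ _).trans h₅) x.1 x.2 y.1 y.2 z.1 z.2
    refine Eq.trans ?_ (this.trans ?_)
    · change _ + _ - koszulSign R i a • e.act _ (0 : U a) x.1 + e.br _ x.2 (0 : U a) = _
      simp only [map_zero, LinearMap.zero_apply, smul_zero, sub_zero, add_zero]
      rfl
    · change _ = (_ + e.act _ (0 : U b) z.1 - _ + e.br _ (0 : U b) z.2)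
        + koszulSign R i j • (_ + _ - koszulSign R j c • e.act _ (0 : U c) y.1
          + e.br _ y.2 (0 : U c))
      simp only [map_zero, LinearMap.zero_apply, smul_zero, sub_zero, add_zero]
      rfl
  sq_smul {i n} ho h a x := by
    refine Prod.ext ?_ (smul_zero (a ^ 2) : a ^ 2 • (0 : U n) = 0).symm
    change GLie.sq (R := R) ho h (a • x.1) + e.act h (a • x.2) (a • x.1) + e.sq ho h (a • x.2)
      = a ^ 2 • (GLie.sq (R := R) ho h x.1 + e.act h x.2 x.1 + e.sq ho h x.2)
    simp [GLie.sq_smul, e.sq_smul, smul_smul, ← pow_two]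
  sq_add {i n} ho h x y := by
    refine Prod.ext ?_ (by change (0 : U n) = 0 + 0 + 0; simp)
    change GLie.sq (R := R) ho h (x.1 + y.1) + e.act h (x.2 + y.2) (x.1 + y.1)
        + e.sq ho h (x.2 + y.2)
      = (GLie.sq (R := R) ho h x.1 + e.act h x.2 x.1 + e.sq ho h x.2)
        + (GLie.sq (R := R) ho h y.1 + e.act h y.2 y.1 + e.sq ho h y.2)
        + (GLie.br (R := R) h x.1 y.1 + e.act h x.2 y.1 - koszulSign R i i • e.act h y.2 x.1
          + e.br h x.2 y.2)
    rw [GLie.sq_add, e.sq_add, koszulSign_odd R ho]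
    simp only [map_add, LinearMap.add_apply, neg_smul, one_smul]
    abel
  br_self {i n} he h x := by
    refine Prod.ext ?_ rfl
    change GLie.br (R := R) h x.1 x.1 + e.act h x.2 x.1 - koszulSign R i i • e.act h x.2 x.1
      + e.br h x.2 x.2 = 0
    rw [GLie.br_self he, e.br_self he, koszulSign_even R he]
    simp
  two_sq {i n} ho h x := by
    refine Prod.ext ?_ (smul_zero (2 : R) : (2 : R) • (0 : U n) = 0)
    change (2 : R) • (GLie.sq (R := R) ho h x.1 + e.act h x.2 x.1 + e.sq ho h x.2)
      = GLie.br (R := R) h x.1 x.1 + e.act h x.2 x.1 - koszulSign R i i • e.act h x.2 x.1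
        + e.br h x.2 x.2
    rw [← GLie.two_sq ho, ← e.two_sq ho, koszulSign_odd R ho]
    simp only [smul_add, neg_smul, one_smul, two_smul]
    abel
  br_self_sq {i n p} ho h h' x := by
    refine Prod.ext ?_ rfl
    have hn : Even n := h ▸ ho.add_odd ho
    have hni : n + i = p := by rw [← h', add_comm]
    change GLie.br (R := R) h' x.1 (GLie.sq (R := R) ho h x.1 + e.act h x.2 x.1 + e.sq ho h x.2)
      + e.act h' x.2 (GLie.sq (R := R) ho h x.1 + e.act h x.2 x.1 + e.sq ho h x.2)
      - koszulSign R i n • e.act hni (0 : U n) x.1 + e.br h' x.2 (0 : U n) = 0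
    simp only [map_add, map_zero, LinearMap.zero_apply, GLie.br_self_sq, e.act_of_sq,
      e.act_act_self ho h h' h hni, e.act_sq ho h h' h hni]
    rw [GLie.br_anticomm_of_even_right hn h' hni, GLie.br_anticomm_of_even_right hn h' hni]
    simp only [smul_zero, sub_zero, add_zero, zero_add]
    abel
  br_sq {i j n a p} ho h h' h₁ h₂ y x := by
    refine Prod.ext ?_ rfl
    have hn : Even n := h ▸ ho.add_odd ho
    have hnj : n + j = p := by rw [← h', add_comm]
    have hia : i + a = p := by rw [← h₂, add_comm]
    have hij : i + j = a := by rw [← h₁, add_comm]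
    change GLie.br (R := R) h' y.1 (GLie.sq (R := R) ho h x.1 + e.act h x.2 x.1 + e.sq ho h x.2)
      + e.act h' y.2 (GLie.sq (R := R) ho h x.1 + e.act h x.2 x.1 + e.sq ho h x.2)
      - koszulSign R j n • e.act hnj (0 : U n) y.1 + e.br h' y.2 (0 : U n)
      = GLie.br (R := R) h₂ (GLie.br (R := R) h₁ y.1 x.1 + e.act h₁ y.2 x.1
        - koszulSign R j i • e.act hij x.2 y.1 + e.br h₁ y.2 x.2) x.1
      + e.act h₂ (0 : U a) x.1
      - koszulSign R a i • e.act hia x.2 (GLie.br (R := R) h₁ y.1 x.1 + e.act h₁ y.2 x.1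
        - koszulSign R j i • e.act hij x.2 y.1 + e.br h₁ y.2 x.2)
      + e.br h₂ (0 : U a) x.2
    have sa : koszulSign R a i = -koszulSign R j i := by
      rw [← h₁, koszulSign_add_left, koszulSign_odd R ho]; simp
    have s1 := koszulSign_mul_self R j i
    have t1 := GLie.br_sq (R := R) ho h h' h₁ h₂ y.1 x.1
    have t2 := e.act_sq ho h h' h₁ h₂ y.2 x.1
    have t3 := e.act_act h h' h₁ h₂ h₁ hia y.2 x.2 x.1
    have t4 := e.act_act_self ho hij hia h hnj x.2 y.1
    have t5 := e.act_br h₁ hia hij h₂ h h' x.2 y.1 x.1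
    rw [koszulSign_comm R i j] at t5
    have t6 := GLie.br_anticomm_of_even_right (R := R) hn h' hnj y.1 (e.sq ho h x.2)
    simp only [map_add, map_sub, map_smul, map_zero, LinearMap.zero_apply, LinearMap.add_apply,
      LinearMap.sub_apply, LinearMap.smul_apply, e.act_of_sq, e.act_of_br, sa]
    rw [t1, t2, t3, t4, t5, t6]
    generalize koszulSign R j i = s at *
    match_scalars <;> try ring1
    · linear_combination -s1
    · linear_combination s1

/-- The inclusion of the ideal of an extension. -/
def inl : GLieHom R L e.Total where
  map i := LinearMap.inl R (L i) (U i)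
  map_br {i j n} h x y := by
    refine Prod.ext ?_ rfl
    change GLie.br (R := R) h x y = GLie.br (R := R) h x y + e.act h (0 : U i) y
      - koszulSign R i j • e.act _ (0 : U j) x + e.br h (0 : U i) (0 : U j)
    simp
  map_sq {i n} ho h x := by
    refine Prod.ext ?_ rfl
    have : e.sq ho h (0 : U i) = 0 := by
      rw [← zero_smul R (0 : U i), e.sq_smul]; simp
    change GLie.sq (R := R) ho h x = GLie.sq (R := R) ho h x + e.act h (0 : U i) x
      + e.sq ho h (0 : U i)
    simp [this]

/-- The linear section of an extension. -/
def inr (i : ℤ) : U i →ₗ[R] e.Total i := LinearMap.inr R (L i) (U i)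

theorem br_inr_inl {i j n : ℤ} (h : i + j = n) (a : U i) (x : L j) :
    GLie.br (R := R) h (e.inr i a) (e.inl.map j x) = e.inl.map n (e.act h a x) := by
  refine Prod.ext ?_ rfl
  change GLie.br (R := R) h (0 : L i) x + e.act h a x
      - koszulSign R i j • e.act _ (0 : U j) (0 : L i) + e.br h a (0 : U j) = e.act h a x
  simp

theorem sq_inr {i n : ℤ} (ho : Odd i) (h : i + i = n) (a : U i) :
    GLie.sq (R := R) ho h (e.inr i a) = e.inl.map n (e.sq ho h a) := by
  refine Prod.ext ?_ rfl
  change GLie.sq (R := R) ho h (0 : L i) + e.act h a (0 : L i) + e.sq ho h a = e.sq ho h a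
  simp [GLie.sq_zero]

end GLieExt
end Extension

/-! ### Adjoining an element which acts by a given derivation -/

section ExtOfDer

variable (R : Type u) [CommRing R]

/-- The free module of rank one in degree `m`. -/
def RankOne (m i : ℤ) : Submodule R R where
  carrier := {c | i ≠ m → c = 0}
  add_mem' ha hb h := by rw [ha h, hb h, add_zero]
  zero_mem' _ := rfl
  smul_mem' a c hc h := by rw [hc h, smul_zero]

/-- The generator of `RankOne`. -/
def RankOne.gen (m : ℤ) : RankOne R m m := ⟨1, fun h => absurd rfl h⟩

variable {R}

theorem RankOne.eq_zero {m i : ℤ} (h : i ≠ m) (a : RankOne R m i) : a = 0 :=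
  Subtype.ext (a.2 h)

variable {L : ℤ → Type v} [∀ i, AddCommGroup (L i)] [∀ i, Module R (L i)]

namespace GLieDer

variable {m : ℤ} (q : L (2 * m))

/-- The brackets `[a, b] = 2 a b q`. -/
noncomputable def extBr {i j n : ℤ} (h : i + j = n) :
    RankOne R m i →ₗ[R] RankOne R m j →ₗ[R] L n :=
  -- The factor 2 is forced by `[u, u] = 2 u²`.
  if hij : i = m ∧ j = m then
    ((LinearMap.mul R R).compl₁₂ (RankOne R m i).subtype (RankOne R m j).subtype).compr₂
      (LinearMap.toSpanSingleton R _ ((2 : R) • LinearEquiv.cast (R := R) (M := L)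
        (show 2 * m = n by rw [← h, hij.1, hij.2, two_mul]) q))
  else 0

/-- The squares `a² = a ^ 2 q`. -/
noncomputable def extSq {i n : ℤ} (h : i + i = n) (a : RankOne R m i) : L n :=
  if hi : i = m then
    (a : R) ^ 2 • LinearEquiv.cast (R := R) (M := L) (show 2 * m = n by rw [← h, hi, two_mul]) q
  else 0

theorem extBr_self {n : ℤ} (h : m + m = n) (h' : 2 * m = n) (a b : RankOne R m m) :
    extBr q h a b = ((a : R) * b) • (2 : R) • LinearEquiv.cast (R := R) (M := L) h' q := by
  simp [extBr]

theorem extSq_self {n : ℤ} (h : m + m = n) (h' : 2 * m = n) (a : RankOne R m m) :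
    extSq q h a = (a : R) ^ 2 • LinearEquiv.cast (R := R) (M := L) h' q := by
  simp [extSq]

theorem extSq_of_ne {i n : ℤ} (hi : i ≠ m) (h : i + i = n) (a : RankOne R m i) :
    extSq q h a = 0 := by
  simp [extSq, hi]

variable [GLie R L] (D : GLieDer R L m)

/-- The action of `RankOne` by multiples of a derivation. -/
noncomputable def act {i j n : ℤ} (h : i + j = n) : RankOne R m i →ₗ[R] L j →ₗ[R] L n :=
  if hi : i = m then
    (LinearMap.toSpanSingleton R _ (D.map (hi ▸ h))).comp (RankOne R m i).subtype
  else 0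

theorem act_self {j n : ℤ} (h : m + j = n) (a : RankOne R m m) (x : L j) :
    D.act h a x = (a : R) • D.map h x := by
  simp [act]

/-- The degrees `m + m` and `2 * m` are not definitionally equal; this absorbs the resulting
transport into the degree proof of the bracket. -/
theorem br_cast_left {i i' j n : ℤ} (e : i = i') (h : i' + j = n) (h' : i + j = n) (x : L i)
    (y : L j) : GLie.br (R := R) h (LinearEquiv.cast (R := R) (M := L) e x) y
      = GLie.br (R := R) h' x y := by
  subst e; rfl

/-- The extension of `L` by an element `u` of odd degree `m` which acts by the derivation `D` and
has square `q`. -/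
noncomputable def ext (hm : Odd m) (hq : ∀ {n : ℤ} (h : m + 2 * m = n), D.map h q = 0)
    (hD : ∀ {j a n : ℤ} (h : m + j = a) (h' : m + a = n) (h'' : 2 * m + j = n) (x : L j),
      D.map h' (D.map h x) = GLie.br (R := R) h'' q x) : GLieExt R L (fun i => RankOne R m i) where
  act h := D.act h
  br h := extBr q h
  sq _ h := extSq q h
  act_br {i j l a b c n} hjl hia hij hbl hil hjc u y z := by
    by_cases hi : i = m
    · subst hi
      simp only [act_self, D.map_br hjl hia hij hbl hil hjc, smul_add, map_smul,
        LinearMap.smul_apply, smul_comm (u : R)]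
    · simp [RankOne.eq_zero hi u]
  act_sq {i j b k n} ho h hik hij hb u y := by
    by_cases hi : i = m
    · subst hi
      simp only [act_self, D.map_sq ho h hik hij hb, map_smul, LinearMap.smul_apply]
    · simp [RankOne.eq_zero hi u]
  act_act {i j l b c d n} hjl hic hij hbl hil hjd u u' z := by
    by_cases hi : i = m
    · by_cases hj : j = m
      · subst hi hj
        -- For multiples `a u`, `b u` the required identity reads `a b D² = 2 a b ad q - a b D²`,
        -- the sign coming from the odd degree of `u`; it is `D² = ad q`.
        obtain rfl : c = d := by rw [← hjl, ← hil]
        have e : 2 * j = b := by rw [← hij, two_mul]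
        simp only [act_self, extBr_self q hij e, map_smul, LinearMap.smul_apply,
          br_cast_left e hbl (by rw [e, hbl]), koszulSign_odd R hm,
          hD hjl hic (by rw [e, hbl])]
        module
      · simp [RankOne.eq_zero hj u']
    · simp [RankOne.eq_zero hi u]
  act_act_self {i j b c n} ho hij hic h hb u y := by
    by_cases hi : i = m
    · subst hi
      have e : 2 * i = b := by rw [← h, two_mul]
      simp only [act_self, extSq_self q h e, map_smul, LinearMap.smul_apply,
        br_cast_left e hb (by rw [e, hb]), hD hij hic (by rw [e, hb])]
      module
    · simp [RankOne.eq_zero hi u, extSq_of_ne q hi]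
  act_of_br {i j l b n} hjl hib u u' u'' := by
    by_cases hi : i = m
    · by_cases hj : j = m
      · by_cases hl : l = m
        · subst hi hj hl
          obtain rfl : 2 * l = b := by rw [← hjl, two_mul]
          simp [act_self, extBr_self q hjl rfl, hq]
        · simp [RankOne.eq_zero hl u'']
      · simp [RankOne.eq_zero hj u']
    · simp [RankOne.eq_zero hi u]
  act_of_sq {i j b n} ho h hib u u' := by
    by_cases hi : i = m
    · by_cases hj : j = m
      · subst hi hj
        obtain rfl : 2 * j = b := by rw [← h, two_mul]
        simp [act_self, extSq_self q h rfl, hq]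
      · simp [extSq_of_ne q hj]
    · simp [RankOne.eq_zero hi u]
  skew {i j n} h h' u u' := by
    by_cases hi : i = m
    · by_cases hj : j = m
      · subst hi hj
        have e : 2 * j = n := by rw [← h, two_mul]
        rw [extBr_self q h e, extBr_self q h' e, koszulSign_odd R hm, mul_comm]
        simp
      · simp [RankOne.eq_zero hj u']
    · simp [RankOne.eq_zero hi u]
  br_self {i n} he h u := by
    have hi : i ≠ m := by
      rintro rfl
      exact Int.not_even_iff_odd.2 hm he
    simp [RankOne.eq_zero hi u]
  sq_smul {i n} ho h r u := by
    by_cases hi : i = m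
    · subst hi
      have e : 2 * i = n := by rw [← h, two_mul]
      rw [extSq_self q h e, extSq_self q h e]
      simp [mul_pow, smul_smul]
    · simp [extSq_of_ne q hi]
  sq_add {i n} ho h u u' := by
    by_cases hi : i = m
    · subst hi
      have e : 2 * i = n := by rw [← h, two_mul]
      rw [extSq_self q h e, extSq_self q h e, extSq_self q h e, extBr_self q h e]
      simp only [Submodule.coe_add]
      module
    · simp [RankOne.eq_zero hi u, extSq_of_ne q hi]
  two_sq {i n} ho h u := by
    by_cases hi : i = m
    · subst hi
      have e : 2 * i = n := by rw [← h, two_mul]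
      rw [extSq_self q h e, extBr_self q h e]
      module
    · simp [RankOne.eq_zero hi u, extSq_of_ne q hi]

/-- The elements on which `D ∘ D` is the bracket with `q`. -/
def squareLocus (hm : Odd m) : GLieSub R L where
  carrier i := LinearMap.eqLocus
    ((D.map (rfl : m + (m + i) = m + (m + i))).comp (D.map (rfl : m + i = m + i)))
    (GLie.br (R := R) (show 2 * m + i = m + (m + i) by ring) q)
  br_mem {i j n} h x y hx hy := by
    subst h
    rw [LinearMap.mem_eqLocus, LinearMap.comp_apply] at hx hy ⊢
    -- `D²` is a derivation of even degree: since `m` is odd, the two cross terms `[D x, D y]`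
    -- cancel. By the Jacobi identity `ad q` obeys the same rule.
    rw [D.map_br rfl rfl rfl (by ring) rfl (by ring) x y, map_add, map_smul,
      D.map_br _ rfl rfl (show m + (m + i) + j = m + (m + (i + j)) by ring) rfl
        (show m + i + (m + j) = m + (m + (i + j)) by ring) (D.map rfl x) y,
      D.map_br _ rfl rfl (show m + i + (m + j) = m + (m + (i + j)) by ring) rfl
        (show i + (m + (m + j)) = m + (m + (i + j)) by ring) x (D.map rfl y), hx, hy,
      GLie.jacobi rfl _ (show 2 * m + i = m + (m + i) by ring)
        (show m + (m + i) + j = m + (m + (i + j)) by ring)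
        (show 2 * m + j = m + (m + j) by ring)
        (show i + (m + (m + j)) = m + (m + (i + j)) by ring) q x y,
      koszulSign_even R (even_two_mul m), koszulSign_add_right, koszulSign_odd R hm, smul_add,
      smul_smul, koszulSign_mul_self]
    module
  sq_mem {i n} ho h x hx := by
    subst h
    rw [LinearMap.mem_eqLocus, LinearMap.comp_apply] at hx ⊢
    -- Here the cross term is `[D x, D x]`, which vanishes because `D x` has even degree.
    rw [D.map_sq ho rfl rfl rfl (by ring) x,
      D.map_br _ rfl rfl (show m + (m + i) + i = m + (m + (i + i)) by ring) rfl
        (show m + i + (m + i) = m + (m + (i + i)) by ring) (D.map rfl x) x,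
      GLie.br_self (hm.add_odd ho), smul_zero, add_zero, hx, GLie.br_sq]

end GLieDer

end ExtOfDer

/-! ### Quadratic elements -/

section Quadratic

theorem sum_sum_eq_diag_add {M : Type*} [AddCommMonoid M] {k : ℕ} (f : Fin k → Fin k → M) :
    ∑ i, ∑ j, f i j = ∑ i, f i i + ∑ i, ∑ j, if i < j then f i j + f j i else 0 := by
  have h : ∀ i j, f i j
      = (if i = j then f i j else 0) + ((if i < j then f i j else 0)
        + if j < i then f i j else 0) := by
    intro i j
    rcases lt_trichotomy i j with h | h | h
    · simp [h, h.ne, h.not_gt]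
    · simp [h]
    · simp [h, h.ne', h.not_gt]
  have h2 : ∑ i, ∑ j, (if j < i then f i j else 0) = ∑ i, ∑ j, if i < j then f j i else 0 :=
    Finset.sum_comm
  rw [Finset.sum_congr rfl fun i _ => Finset.sum_congr rfl fun j _ => h i j]
  simp only [Finset.sum_add_distrib, h2]
  simp only [← Finset.sum_add_distrib]
  simp [Finset.sum_add_distrib, ← ite_add_zero]

variable {R : Type u} [CommRing R] {L : ℤ → Type v} [∀ i, AddCommGroup (L i)]
  [∀ i, Module R (L i)] [GLie R L]

/-- The element `∑ g i i • x i ² + ∑_{i < j} g i j • [x i, x j]` attached to a symmetric matrix `g`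
and to elements `x i` of odd degree. -/
def quad {m n : ℤ} (hm : Odd m) (h : m + m = n) {k : ℕ} (g : Matrix (Fin k) (Fin k) R)
    (x : Fin k → L m) : L n :=
  ∑ i, g i i • GLie.sq (R := R) hm h (x i)
    + ∑ i, ∑ j, if i < j then g i j • GLie.br (R := R) h (x i) (x j) else 0

/-- A linear map under which `x²` and `[x, y]` become the diagonal and the symmetrization of one
function `B` turns `quad` into the full double sum: the two halves of each off-diagonal pair
recombine by symmetry of `g`. The cases of use are `ad y`, a derivation, and the map to the tensor
algebra. -/
theorem map_quad {m n : ℤ} (hm : Odd m) (h : m + m = n) {k : ℕ} {g : Matrix (Fin k) (Fin k) R}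
    (hg : g.IsSymm) (x : Fin k → L m) {M : Type*} [AddCommGroup M] [Module R M] (T : L n →ₗ[R] M)
    (B : L m → L m → M) (hsq : ∀ x, T (GLie.sq (R := R) hm h x) = B x x)
    (hbr : ∀ x y, T (GLie.br (R := R) h x y) = B x y + B y x) :
    T (quad hm h g x) = ∑ i, ∑ j, g i j • B (x i) (x j) := by
  rw [sum_sum_eq_diag_add]
  simp only [quad, map_add, map_sum, map_smul, hsq]
  congr 1
  refine Finset.sum_congr rfl fun i _ => Finset.sum_congr rfl fun j _ => ?_
  split_ifs
  · rw [map_smul, hbr, smul_add, hg.apply i j]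
  · exact map_zero _

theorem GLieHom.map_quad {L' : ℤ → Type w} [∀ i, AddCommGroup (L' i)] [∀ i, Module R (L' i)]
    [GLie R L'] (f : GLieHom R L L') {m n : ℤ} (hm : Odd m) (h : m + m = n) {k : ℕ}
    (g : Matrix (Fin k) (Fin k) R) (x : Fin k → L m) :
    f.map n (quad hm h g x) = quad hm h g (fun i => f.map m (x i)) := by
  simp only [quad, map_add, map_sum, map_smul, f.map_sq]
  congr 1
  refine Finset.sum_congr rfl fun i _ => Finset.sum_congr rfl fun j _ => ?_
  split_ifs
  · rw [map_smul, f.map_br]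
  · exact map_zero _

theorem br_quad {m n d a p : ℤ} (hm : Odd m) (h : m + m = n) {k : ℕ}
    {g : Matrix (Fin k) (Fin k) R} (hg : g.IsSymm) (x : Fin k → L m) (hd : d + n = p)
    (hda : d + m = a) (ha : a + m = p) (y : L d) :
    GLie.br (R := R) hd y (quad hm h g x)
      = ∑ i, ∑ j, g i j • GLie.br (R := R) ha (GLie.br (R := R) hda y (x i)) (x j) :=
  _root_.map_quad hm h hg x (GLie.br (R := R) hd y)
    (fun x x' => GLie.br (R := R) ha (GLie.br (R := R) hda y x) x')
    (fun x => GLie.br_sq hm h hd hda ha y x)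
    (fun x x' => GLie.br_br_of_odd hm hm h hd hda ha hda ha y x x')

theorem GLieDer.map_quad {m n a p : ℤ} (D : GLieDer R L m) (hm : Odd m) (h : m + m = n) {k : ℕ}
    {g : Matrix (Fin k) (Fin k) R} (hg : g.IsSymm) (x : Fin k → L m) (hp : m + n = p)
    (ha : m + m = a) (hap : a + m = p) :
    D.map hp (quad hm h g x)
      = ∑ i, ∑ j, g i j • GLie.br (R := R) hap (D.map ha (x i)) (x j) := by
  refine _root_.map_quad hm h hg x (D.map hp)
    (fun x x' => GLie.br (R := R) hap (D.map ha x) x') (fun x => D.map_sq hm h hp ha hap x)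
    (fun x y => ?_)
  have hma : m + a = p := by rw [← hap, add_comm]
  rw [D.map_br h hp ha hap ha hma, koszulSign_odd R hm,
    GLie.br_anticomm_of_even_right (ha ▸ hm.add_odd hm) hma hap]
  simp

/-- Splitting off the first variable. -/
theorem quad_succ {m n : ℤ} (hm : Odd m) (h : m + m = n) {r : ℕ}
    (g : Matrix (Fin (r + 1)) (Fin (r + 1)) R) (x : Fin (r + 1) → L m) :
    quad hm h g x = g 0 0 • GLie.sq (R := R) hm h (x 0)
      + ∑ j : Fin r, g 0 j.succ • GLie.br (R := R) h (x 0) (x j.succ)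
      + quad hm h (g.submatrix Fin.succ Fin.succ) (fun i => x i.succ) := by
  simp only [quad, Fin.sum_univ_succ, Matrix.submatrix_apply, Fin.succ_pos, if_true,
    if_false, Fin.not_lt_zero, Fin.succ_lt_succ_iff, zero_add]
  abel

end Quadratic

/-! ### Matrices and their inverses acting on families of elements -/

section Families

variable {R : Type u} [CommRing R] {M : Type v} [AddCommGroup M] [Module R M]

theorem sum_smul_sum_smul {k : ℕ} {g h : Matrix (Fin k) (Fin k) R} (hgh : g * h = 1)
    (x : Fin k → M) (i : Fin k) : ∑ l, g i l • ∑ j, h l j • x j = x i := by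
  simp only [Finset.smul_sum, smul_smul]
  rw [Finset.sum_comm]
  simp only [← Finset.sum_smul, ← Matrix.mul_apply, hgh]
  simp [Matrix.one_apply]

end Families

/-! ### The families `x`, `y`, `z` and the identities behind the derivation `D` -/

section Pair

variable {R : Type u} [CommRing R] {L : ℤ → Type v} [∀ i, AddCommGroup (L i)]
  [∀ i, Module R (L i)] [GLie R L] {m : ℤ} (hm : Odd m) {r : ℕ}
  (g h : Matrix (Fin (r + 1)) (Fin (r + 1)) R) (v : Fin r → L m) (w : Fin r → L (2 * m))

/-- The family `-λ, w_1, …, w_r`, for `λ` the quadratic element in the `v_i`. -/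
def xFam : Fin (r + 1) → L (2 * m) :=
  Fin.cons (-quad hm (two_mul m).symm (g.submatrix Fin.succ Fin.succ) v) w

/-- The family which is to become `u², [u, v_1], …, [u, v_r]`. -/
def yFam (l : Fin (r + 1)) : L (2 * m) := ∑ i, h l i • xFam hm g v w i

/-- The images of `v_1, …, v_r` under the matrix `g`. -/
def zFam (l : Fin (r + 1)) : L m := ∑ j : Fin r, g l j.succ • v j

variable {g h}

theorem sum_smul_yFam (hgh : g * h = 1) (i : Fin (r + 1)) :
    ∑ l, g i l • yFam hm g h v w l = xFam hm g v w i :=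
  sum_smul_sum_smul hgh _ i

omit [GLie R L] in
-- The family `z` is `g` applied to `(0, v_1, …, v_r)`, so `h` undoes it. The zero in position 0 is
-- what later gives `D y_0 = 0`.
theorem sum_smul_zFam (hhg : h * g = 1) (i : Fin (r + 1)) :
    ∑ l, h i l • zFam g v l = (Fin.cons 0 v : Fin (r + 1) → L m) i := by
  refine Eq.trans ?_ (sum_smul_sum_smul hhg (Fin.cons 0 v : Fin (r + 1) → L m) i)
  simp [zFam, Fin.sum_univ_succ]

/-- The sum of `[y_i, x_i]` over all indices is `∑ h_ij [x_j, x_i]`, which vanishes because `h` is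
symmetric while the bracket in even degree is alternating. The term of index 0 is `-[y_0, λ]`;
moving it to the other side gives the claim. -/
theorem sum_br_yFam (hh : h.IsSymm) {p : ℤ} (hp : 2 * m + 2 * m = p) :
    ∑ i : Fin r, GLie.br (R := R) hp (yFam hm g h v w i.succ) (w i)
      = GLie.br (R := R) hp (yFam hm g h v w 0)
        (quad hm (two_mul m).symm (g.submatrix Fin.succ Fin.succ) v) := by
  have key : ∑ i, GLie.br (R := R) hp (yFam hm g h v w i) (xFam hm g v w i) = 0 := by
    simp only [yFam, map_sum, LinearMap.sum_apply, map_smul, LinearMap.smul_apply]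
    rw [sum_sum_eq_diag_add]
    simp only [GLie.br_self (even_two_mul m), smul_zero, Finset.sum_const_zero, zero_add]
    refine Finset.sum_eq_zero fun i _ => Finset.sum_eq_zero fun j _ => ?_
    split_ifs
    · rw [GLie.br_anticomm_of_even_left (even_two_mul m) hp hp (xFam hm g v w j), hh.apply]
      simp
    · rfl
  rw [Fin.sum_univ_succ] at key
  simp only [xFam, Fin.cons_zero, Fin.cons_succ, map_neg] at key
  exact (neg_add_eq_zero.1 key).symm

/-- Both sides expand to `∑ g_ij [v_i, [q, v_j]]`, using that `ad q` acts on `λ` through `br_quad`.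
With `q = y_0` this matches `sum_br_yFam`, so the derivation respects the relator. -/
theorem sum_br_zFam (hg : g.IsSymm) {a p : ℤ} (hp : 2 * m + 2 * m = p) (ha : 2 * m + m = a)
    (hap : m + a = p) (q : L (2 * m)) :
    ∑ i : Fin r, GLie.br (R := R) hap (v i) (GLie.br (R := R) ha q (zFam g v i.succ))
      = GLie.br (R := R) hp q
        (quad hm (two_mul m).symm (g.submatrix Fin.succ Fin.succ) v) := by
  have ham : a + m = p := by rw [← hap, add_comm]
  have hao : Odd a := ha ▸ (even_two_mul m).add_odd hm
  rw [br_quad hm _ (hg.submatrix _) v hp ha ham, Finset.sum_comm]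
  refine Finset.sum_congr rfl fun i _ => ?_
  simp only [zFam, map_sum, map_smul]
  refine Finset.sum_congr rfl fun j _ => ?_
  rw [GLie.br_comm_of_odd hm hao hap ham, Matrix.submatrix_apply, hg.apply]

/-! Derivations with prescribed values on `v` and `w`. -/

variable (D : GLieDer R L m) (hg : g.IsSymm) (hgh : g * h = 1) (hhg : h * g = 1)
  (hDv : ∀ i, D.map (two_mul m).symm (v i) = yFam hm g h v w i.succ)
  (hDw : ∀ i, D.map (rfl : m + 2 * m = m + 2 * m) (w i) = GLie.br (R := R) (add_comm (2 * m) m)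
    (yFam hm g h v w 0) (zFam g v i.succ))
  (hvw : ∑ i, GLie.br (R := R) (rfl : m + 2 * m = m + 2 * m) (v i) (w i) = 0)

include hg hgh hDv hvw hDw

/-- For positive index this is the prescribed value on `w_i`. For index 0, `D (-λ) = -∑ g_ij [y_i,
v_j]`; by `g y = x` this is `∑ [v_j, w_j] + ∑ g_0j [y_0, v_j]`, and the first sum is the relation.
-/
theorem GLieDer.map_xFam (i : Fin (r + 1)) :
    D.map (rfl : m + 2 * m = m + 2 * m) (xFam hm g v w i) = GLie.br (R := R) (add_comm (2 * m) m)
      (yFam hm g h v w 0) (zFam g v i) := by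
  refine Fin.cases ?_ (fun i => hDw i) i
  -- Row `j` of `g y = x` without its term of index 0, written as a column sum by symmetry of `g`.
  have e : ∀ j : Fin r, ∑ i : Fin r, g i.succ j.succ • yFam hm g h v w i.succ
      = w j - g 0 j.succ • yFam hm g h v w 0 := by
    intro j
    have := sum_smul_yFam hm v w hgh j.succ
    rw [Fin.sum_univ_succ] at this
    simp only [xFam, Fin.cons_succ] at this
    rw [eq_sub_iff_add_eq', ← hg.apply, ← this]
    simp only [hg.apply j.succ]
  have key := D.map_quad hm (two_mul m).symm (hg.submatrix Fin.succ) v rfl (two_mul m).symm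
    (add_comm (2 * m) m)
  rw [Finset.sum_comm] at key
  have e2 : ∀ j : Fin r, ∑ i : Fin r, g.submatrix Fin.succ Fin.succ i j •
      GLie.br (R := R) (add_comm (2 * m) m) (D.map (two_mul m).symm (v i)) (v j)
      = -GLie.br (R := R) (rfl : m + 2 * m = m + 2 * m) (v j) (w j)
        - g 0 j.succ • GLie.br (R := R) (add_comm (2 * m) m) (yFam hm g h v w 0) (v j) := by
    intro j
    rw [← GLie.br_anticomm_of_even_left (even_two_mul m) (add_comm (2 * m) m),
      ← LinearMap.smul_apply, ← map_smul, ← LinearMap.sub_apply, ← map_sub, ← e j]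
    simp [hDv]
  rw [Finset.sum_congr rfl fun j _ => e2 j] at key
  simp only [xFam, Fin.cons_zero, map_neg, key, Finset.sum_sub_distrib, Finset.sum_neg_distrib, hvw,
    zFam, map_sum, map_smul]
  simp

include hhg

/-- Apply `h` to `D x_i = [y_0, z_i]` and use `h z = (0, v_1, …, v_r)`. -/
theorem GLieDer.map_yFam (l : Fin (r + 1)) :
    D.map (rfl : m + 2 * m = m + 2 * m) (yFam hm g h v w l) = GLie.br (R := R) (add_comm (2 * m) m)
      (yFam hm g h v w 0) ((Fin.cons 0 v : Fin (r + 1) → L m) l) := by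
  rw [← sum_smul_zFam v hhg, yFam]
  simp only [map_sum, map_smul, D.map_xFam hm v w hg hgh hDv hDw hvw]

theorem GLieDer.map_yFam_zero {n : ℤ} (hn : m + 2 * m = n) :
    D.map hn (yFam hm g h v w 0) = 0 := by
  subst hn
  rw [D.map_yFam hm v w hg hgh hhg hDv hDw hvw, Fin.cons_zero, map_zero]

/-- `D² v_i = D y_i = [y_0, v_i]`; what remains is the transport between equal expressions for the
degree. -/
theorem GLieDer.map_map_v (i : Fin r) :
    D.map (rfl : m + (m + m) = m + (m + m)) (D.map rfl (v i))
      = GLie.br (R := R) (show 2 * m + m = m + (m + m) by ring) (yFam hm g h v w 0) (v i) := by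
  have e : ∀ (a b c : ℤ) (ha : m + m = a) (hb : m + m = b) (hac : m + a = c) (hbc : m + b = c),
      D.map hac (D.map ha (v i)) = D.map hbc (D.map hb (v i)) := by
    rintro a b c rfl rfl _ _; rfl
  rw [e _ _ _ _ (two_mul m).symm _ (by ring), hDv]
  have := D.map_yFam hm v w hg hgh hhg hDv hDw hvw i.succ
  rw [Fin.cons_succ] at this
  have e' : ∀ (a b : ℤ) (ha : m + 2 * m = a) (ha' : 2 * m + m = a) (hb : m + 2 * m = b)
      (hb' : 2 * m + m = b), D.map ha (yFam hm g h v w i.succ)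
        = GLie.br (R := R) ha' (yFam hm g h v w 0) (v i) → D.map hb (yFam hm g h v w i.succ)
        = GLie.br (R := R) hb' (yFam hm g h v w 0) (v i) := by
    rintro a b rfl _ rfl _ h; exact h
  exact e' _ _ _ _ _ _ this

/-- Since `D y_0 = 0`, `D² w_i = [y_0, D z_i]`, and `D z_i` is row `i` of `g y = x` without its
first term, that is `w_i - g_i0 y_0`; the correction disappears because `[y_0, y_0] = 0`. -/
theorem GLieDer.map_map_w (i : Fin r) :
    D.map (rfl : m + (m + 2 * m) = m + (m + 2 * m)) (D.map rfl (w i))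
      = GLie.br (R := R) (show 2 * m + 2 * m = m + (m + 2 * m) by ring) (yFam hm g h v w 0)
        (w i) := by
  have e : D.map (two_mul m).symm (zFam g v i.succ)
      = w i - g i.succ 0 • yFam hm g h v w 0 := by
    have := sum_smul_yFam hm v w hgh i.succ
    rw [Fin.sum_univ_succ] at this
    simp only [xFam, Fin.cons_succ] at this
    rw [eq_sub_iff_add_eq', ← this]
    simp [zFam, hDv]
  rw [hDw, D.map_br _ rfl rfl (show m + 2 * m + m = m + (m + 2 * m) by ring) (two_mul m).symm
    (show 2 * m + 2 * m = m + (m + 2 * m) by ring),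
    D.map_yFam_zero hm v w hg hgh hhg hDv hDw hvw, e, map_sub, map_smul,
    GLie.br_self (even_two_mul m), koszulSign_of_even_right (even_two_mul m)]
  simp

end Pair

/-! ### The canonical map to the tensor algebra in degree `2 m` -/

section TensorTwo

variable {R : Type u} [CommRing R] {V : ℤ → Type v} [∀ i, AddCommGroup (V i)]
  [∀ i, Module R (V i)]

theorem toTensor_of {i : ℤ} (x : V i) :
    FreeGLie.toTensor R i (FreeGLie.of i x) = tensorOf R i x := rfl

theorem toTensor_br {i j n : ℤ} (h : i + j = n) (x : FreeGLie R V i) (y : FreeGLie R V j) :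
    FreeGLie.toTensor R n (GLie.br (R := R) h x y)
      = gradedCommutator R i j (FreeGLie.toTensor R i x) (FreeGLie.toTensor R j y) :=
  (FreeGLie.lift (L := AssocGLie (GTensorAlgebra R V)) (fun i => tensorOf R i)).map_br h x y

theorem toTensor_sq {i n : ℤ} (ho : Odd i) (h : i + i = n) (x : FreeGLie R V i) :
    FreeGLie.toTensor R n (GLie.sq (R := R) ho h x)
      = FreeGLie.toTensor R i x * FreeGLie.toTensor R i x :=
  (FreeGLie.lift (L := AssocGLie (GTensorAlgebra R V)) (fun i => tensorOf R i)).map_sq ho h x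

theorem gradedCommutator_of_odd {A : Type*} [Ring A] [Algebra R A] {i j : ℤ} (hi : Odd i)
    (hj : Odd j) (a b : A) : gradedCommutator R i j a b = a * b + b * a := by
  rw [gradedCommutator, koszulSign_of_odd hi hj, neg_one_smul, sub_neg_eq_add]

theorem tensorOf₂_tmul {m : ℤ} (x y : V m) :
    tensorOf₂ R m (x ⊗ₜ y) = tensorOf R m x * tensorOf R m y := rfl

theorem toTensor_quad {m n : ℤ} (hm : Odd m) (h : m + m = n) {k : ℕ}
    {g : Matrix (Fin k) (Fin k) R} (hg : g.IsSymm) (x : Fin k → V m) :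
    FreeGLie.toTensor R n (quad hm h g (fun i => FreeGLie.of m (x i)))
      = tensorOf₂ R m (∑ i, ∑ j, g i j • x i ⊗ₜ x j) := by
  rw [map_quad hm h hg _ (FreeGLie.toTensor R n)
    (fun x y => FreeGLie.toTensor R m x * FreeGLie.toTensor R m y) (fun x => toTensor_sq hm h x)
    (fun x y => by rw [toTensor_br, gradedCommutator_of_odd hm hm])]
  simp only [map_sum, map_smul, tensorOf₂_tmul, toTensor_of]

theorem eq_sum_tensorMatrix {M : Type v} [AddCommGroup M] [Module R M] {k : ℕ}
    (b : Module.Basis (Fin k) R M) (t : M ⊗[R] M) :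
    t = ∑ i, ∑ j, tensorMatrix b t i j • b i ⊗ₜ b j := by
  conv_lhs => rw [← (b.tensorProduct b).sum_repr t]
  rw [Fintype.sum_prod_type]
  simp [tensorMatrix]

theorem tensorMatrix_isSymm {M : Type v} [AddCommGroup M] [Module R M] {k : ℕ}
    (b : Module.Basis (Fin k) R M) {t : M ⊗[R] M} (ht : TensorProduct.comm R M M t = t) :
    (tensorMatrix b t).IsSymm := by
  have key : ∀ (s : M ⊗[R] M) (i j : Fin k),
      tensorMatrix b (TensorProduct.comm R M M s) i j = tensorMatrix b s j i := by
    intro s i j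
    simp only [tensorMatrix, Matrix.of_apply]
    induction s with
    | zero => simp
    | tmul x y => simp [Module.Basis.tensorProduct_repr_tmul_apply, mul_comm]
    | add x y hx hy => simp [hx, hy]
  ext i j
  rw [Matrix.transpose_apply, ← key, ht]

/-- The coefficients of the products of two basis vectors of `V m` in an element of `T(V)`. -/
noncomputable def tensorCoeff {m : ℤ} {k : ℕ} (b : Module.Basis (Fin k) R (V m)) :
    GTensorAlgebra R V →ₗ[R] Matrix (Fin k) (Fin k) R where
  toFun a := Matrix.of fun i j => (TensorAlgebra.lift R
    ((b.constr R fun i => MonoidAlgebra.single (FreeMonoid.of i) (1 : R)).comp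
      (DirectSum.component R ℤ V m)) a).coeff (FreeMonoid.of i * FreeMonoid.of j)
  map_add' a a' := by ext; simp
  map_smul' c a := by ext; simp

/-- The coefficients are read off in the algebra of the free monoid on the basis, where words of
length two determine their letters. -/
theorem tensorCoeff_mul {m : ℤ} {k : ℕ} (b : Module.Basis (Fin k) R (V m)) (i j : Fin k) :
    tensorCoeff b (tensorOf R m (b i) * tensorOf R m (b j)) = Matrix.single i j 1 := by
  have inj : ∀ i' j' : Fin k, FreeMonoid.of i * FreeMonoid.of j
      = FreeMonoid.of i' * FreeMonoid.of j' ↔ i = i' ∧ j = j' := fun i' j' =>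
    ⟨fun e => by simpa using congrArg FreeMonoid.toList e, fun e => by rw [e.1, e.2]⟩
  classical
  ext i' j'
  simp [tensorCoeff, tensorOf, DirectSum.component.lof_self, MonoidAlgebra.single_mul_single,
    Finsupp.single_apply, Matrix.single_apply, inj]

end TensorTwo

/-! ### Quadratic elements as a linear function of the coefficient matrix -/

section QuadLinear

variable {R : Type u} [CommRing R] {L : ℤ → Type v} [∀ i, AddCommGroup (L i)]
  [∀ i, Module R (L i)] [GLie R L] {m n : ℤ} (hm : Odd m) (h : m + m = n) {k : ℕ} (x : Fin k → L m)

/-- `quad` as a linear function of the matrix. -/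
def quadMap : Matrix (Fin k) (Fin k) R →ₗ[R] L n where
  toFun g := quad hm h g x
  map_add' g g' := by
    simp only [quad, Matrix.add_apply, add_smul, Finset.sum_add_distrib, ite_add_zero]
    abel
  map_smul' c g := by
    simp only [quad, Matrix.smul_apply, smul_add, Finset.smul_sum, smul_ite, smul_zero, smul_smul,
      smul_eq_mul, RingHom.id_apply]

theorem quadMap_single (a b : Fin k) :
    quadMap hm h x (Matrix.single a b (1 : R)) = (if a = b then GLie.sq (R := R) hm h (x a) else 0)
      + if a < b then GLie.br (R := R) h (x a) (x b) else 0 := by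
  change quad hm h _ x = _
  have e : ∀ i j, (if i < j then Matrix.single a b (1 : R) i j • GLie.br (R := R) h (x i) (x j)
      else 0) = if a = i then if b = j then if i < j then GLie.br (R := R) h (x i) (x j) else 0
        else 0 else 0 := by
    intro i j
    rw [Matrix.single_apply]
    split_ifs <;> simp_all
  have e' : ∀ i, Matrix.single a b (1 : R) i i • GLie.sq (R := R) hm h (x i)
      = if a = i then if a = b then GLie.sq (R := R) hm h (x i) else 0 else 0 := by
    intro i
    rw [Matrix.single_apply]
    split_ifs <;> simp_all
  simp only [quad, e, e', Finset.sum_ite_eq, Finset.mem_univ, if_true]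
  congr 1
  rw [Finset.sum_eq_single a (fun i _ hi => Finset.sum_eq_zero fun j _ => if_neg hi.symm)
    (fun h => absurd (Finset.mem_univ a) h)]
  simp

/-- `quad` ignores entries below the diagonal, so exactly one of the two matrix units contributes
when `a ≠ b`; for `a = b` the claim is `2 x² = [x, x]`. -/
theorem quadMap_single_add (a b : Fin k) :
    quadMap hm h x (Matrix.single a b (1 : R) + Matrix.single b a 1)
      = GLie.br (R := R) h (x a) (x b) := by
  rw [map_add, quadMap_single, quadMap_single]
  rcases lt_trichotomy a b with hab | rfl | hab
  · simp [hab, hab.ne, hab.ne', hab.not_gt]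
  · simp [← GLie.two_sq hm, two_smul]
  · simp [hab, hab.ne, hab.ne', hab.not_gt, GLie.br_comm_of_odd hm hm h h (x a)]

end QuadLinear

/-! ### The free graded Lie algebra in degrees `m` and `2 m` -/

section DegreeTwo

variable {R : Type u} [CommRing R] {V : ℤ → Type v} [∀ i, AddCommGroup (V i)]
  [∀ i, Module R (V i)] {m : ℤ}

theorem FreeGLie.degree_eq_of_add_eq_two_mul (hm : Odd m) {i j : ℤ} (h : i + j = 2 * m)
    (hi : ∃ r : ℕ, 1 ≤ r ∧ i = r * m) (hj : ∃ r : ℕ, 1 ≤ r ∧ j = r * m) : i = m ∧ j = m := by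
  obtain ⟨r, hr, rfl⟩ := hi
  obtain ⟨s, hs, rfl⟩ := hj
  have h2 : ((r : ℤ) + s - 2) * m = 0 := by linear_combination h
  rcases mul_eq_zero.1 h2 with h3 | h3
  · obtain rfl : r = 1 := by omega
    obtain rfl : s = 1 := by omega
    simp
  · exact absurd (h3 ▸ hm : Odd (0 : ℤ)) (by decide)

/-- Nonzero elements live in positive multiples of `m`, and a sum of two such degrees is never `m`;
squares have even degree. So only the generators contribute in degree `m`. -/
theorem FreeGLie.of_surjective (hm : Odd m) (hV : ∀ i, i ≠ m → Subsingleton (V i)) :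
    Function.Surjective (FreeGLie.of (R := R) (V := V) m) := by
  have hm0 : m ≠ 0 := by rintro rfl; exact absurd hm (by decide)
  have key : ∀ {n : ℤ} (a : FreeGLie.Pre R V n), n = m →
      FreeGLie.mk a ∈ LinearMap.range (FreeGLie.of (R := R) (V := V) n) := by
    intro n a hn
    induction a with
    | of x => exact ⟨x, rfl⟩
    | zero => exact zero_mem _
    | add a b iha ihb => exact add_mem (iha hn) (ihb hn)
    | smul r a ih => exact Submodule.smul_mem _ r (ih hn)
    | @br i j n h a a' _ _ =>
      rw [FreeGLie.mk_br]
      by_cases hi : ∃ r : ℕ, 1 ≤ r ∧ i = r * m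
      · by_cases hj : ∃ r : ℕ, 1 ≤ r ∧ j = r * m
        · obtain ⟨r, hr, rfl⟩ := hi
          obtain ⟨s, hs, rfl⟩ := hj
          have h2 : ((r : ℤ) + s - 1) * m = 0 := by linear_combination h + hn
          rcases mul_eq_zero.1 h2 with h3 | h3
          · omega
          · exact absurd h3 hm0
        · rw [FreeGLie.eq_zero_of_degree hV hj (FreeGLie.mk a'), map_zero]
          exact zero_mem _
      · rw [FreeGLie.eq_zero_of_degree hV hi (FreeGLie.mk a), map_zero]
        exact zero_mem _
    | @sq i n ho h a _ =>
      exact absurd (hn ▸ hm) (Int.not_odd_iff_even.2 ⟨i, h.symm⟩)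
  intro x
  obtain ⟨a, rfl⟩ := FreeGLie.mk_surjective x
  exact key a rfl

/-- The canonical map from `F(V)` to `T(V)` is injective in degree `2 m`. -/
theorem toTensor_injective (hm : Odd m) (hV : ∀ i, i ≠ m → Subsingleton (V i)) {k : ℕ}
    (b : Module.Basis (Fin k) R (V m)) :
    Function.Injective (FreeGLie.toTensor (R := R) (V := V) (2 * m)) := by
  -- A candidate left inverse: read the coefficient matrix of the image in `T(V)` and form the
  -- corresponding quadratic element. It is stated for every `n` with `m + m = n`, to allow
  -- induction on formal expressions.
  let f : ∀ {n : ℤ}, m + m = n → FreeGLie R V n →ₗ[R] FreeGLie R V n := fun {n} h =>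
    ((quadMap hm h fun i => FreeGLie.of m (b i)).comp (tensorCoeff b)).comp
      (FreeGLie.toTensor R n)
  have hbr : ∀ {n : ℤ} (h : m + m = n) (x y : V m),
      f h (GLie.br (R := R) h (FreeGLie.of m x) (FreeGLie.of m y))
        = GLie.br (R := R) h (FreeGLie.of m x) (FreeGLie.of m y) := by
    intro n h x y
    let B := (GLie.br (R := R) h).compl₁₂ (FreeGLie.of (R := R) (V := V) m) (FreeGLie.of m)
    suffices B.compr₂ (f h) = B from LinearMap.congr_fun (LinearMap.congr_fun this x) y
    refine b.ext fun i => b.ext fun j => ?_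
    change quadMap hm h _ (tensorCoeff b (FreeGLie.toTensor R n (GLie.br (R := R) h
      (FreeGLie.of m (b i)) (FreeGLie.of m (b j))))) = GLie.br (R := R) h
      (FreeGLie.of m (b i)) (FreeGLie.of m (b j))
    rw [toTensor_br, gradedCommutator_of_odd hm hm, toTensor_of, toTensor_of, map_add,
      tensorCoeff_mul, tensorCoeff_mul, quadMap_single_add]
  have hsq : ∀ {n : ℤ} (h : m + m = n) (x : V m),
      f h (GLie.sq (R := R) hm h (FreeGLie.of m x)) = GLie.sq (R := R) hm h (FreeGLie.of m x) := by
    intro n h x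
    -- Squaring is not linear, so the claim is extended from the basis by induction over the span;
    -- the cross term in a sum is covered by `hbr`.
    have hx : x ∈ Submodule.span R (Set.range b) := by rw [b.span_eq]; trivial
    induction hx using Submodule.span_induction with
    | mem x hx =>
      obtain ⟨i, rfl⟩ := hx
      change quadMap hm h (fun i => FreeGLie.of (R := R) m (b i)) (tensorCoeff b
        (FreeGLie.toTensor R n (GLie.sq (R := R) hm h (FreeGLie.of m (b i))))) = _
      rw [toTensor_sq, toTensor_of, tensorCoeff_mul, quadMap_single]
      simp
    | zero => rw [map_zero, GLie.sq_zero (R := R), map_zero]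
    | add x y _ _ hx hy => rw [map_add, GLie.sq_add, map_add, map_add, hx, hy, hbr]
    | smul c x _ hx => rw [map_smul, GLie.sq_smul, map_smul, hx]
  have key : ∀ {n : ℤ} (a : FreeGLie.Pre R V n) (h : m + m = n), f h (FreeGLie.mk a)
      = FreeGLie.mk a := by
    intro n a hn
    induction a with
    | @of n x =>
      have : Subsingleton (V n) := hV n (fun e => by
        rw [e] at hn
        exact absurd hm (by rw [show m = 0 by omega]; decide))
      change f hn (FreeGLie.of n x) = FreeGLie.of n x
      rw [Subsingleton.elim x 0, map_zero, map_zero]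
    | zero => exact map_zero _
    | add a b iha ihb => rw [FreeGLie.mk_add, map_add, iha, ihb]
    | smul r a ih => rw [FreeGLie.mk_smul, map_smul, ih]
    | @br i j n h a a' _ _ =>
      rw [FreeGLie.mk_br]
      by_cases hi : ∃ r : ℕ, 1 ≤ r ∧ i = r * m
      · by_cases hj : ∃ r : ℕ, 1 ≤ r ∧ j = r * m
        -- A bracket in degree `2 m` can only be nonzero if both factors have degree `m`, where they
        -- are elements of `V`.
        · obtain ⟨rfl, rfl⟩ := FreeGLie.degree_eq_of_add_eq_two_mul hm
            (by rw [h, ← hn, two_mul]) hi hj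
          obtain ⟨x, hx⟩ := FreeGLie.of_surjective (R := R) hm hV (FreeGLie.mk a)
          obtain ⟨y, hy⟩ := FreeGLie.of_surjective (R := R) hm hV (FreeGLie.mk a')
          rw [← hx, ← hy, hbr]
        · rw [FreeGLie.eq_zero_of_degree hV hj (FreeGLie.mk a'), map_zero, map_zero]
      · rw [FreeGLie.eq_zero_of_degree hV hi (FreeGLie.mk a), map_zero, LinearMap.zero_apply,
          map_zero]
    | @sq i n ho h a _ =>
      obtain rfl : i = m := by omega
      obtain ⟨x, hx⟩ := FreeGLie.of_surjective (R := R) hm hV (FreeGLie.mk a)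
      rw [FreeGLie.mk_sq, ← hx, hsq]
  intro x y hxy
  obtain ⟨x, rfl⟩ := FreeGLie.mk_surjective x
  obtain ⟨y, rfl⟩ := FreeGLie.mk_surjective y
  rw [← key x (two_mul m).symm, ← key y (two_mul m).symm]
  simp only [f, LinearMap.comp_apply, hxy]

end DegreeTwo

/-! ### The derivation of `F(v_1, …, v_r, w_1, …, w_r) / (∑ [v_i, w_i])` -/

section Presented

theorem vw_hom_ext {R : Type u} [CommRing R] {r : ℕ} {m : ℤ} {L : ℤ → Type w}
    [∀ i, AddCommGroup (L i)] [∀ i, Module R (L i)] [GLie R L] {f f' : GLieHom R (FreeVW R r m) L}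
    (hv : ∀ a, f.map m (genV R m a) = f'.map m (genV R m a))
    (hw : ∀ a, f.map (2 * m) (genW R m a) = f'.map (2 * m) (genW R m a)) {i : ℤ}
    (x : FreeVW R r m i) : f.map i x = f'.map i x :=
  freeGen_hom_ext (deg := vwDeg r m) (by rintro (a | a); exacts [hv a, hw a]) x

theorem vw_mem_of_generators {R : Type u} [CommRing R] {r : ℕ} {m : ℤ}
    (S : GLieSub R (FreeVW R r m)) (hv : ∀ a, genV R m a ∈ S.carrier m)
    (hw : ∀ a, genW R m a ∈ S.carrier (2 * m)) {i : ℤ} (x : FreeVW R r m i) : x ∈ S.carrier i :=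
  FreeGLie.mem_of_generators S
    (freeGen_mem S.carrier (by rintro (a | a); exacts [hv a, hw a])) x

section Lift

variable {R : Type u} [CommRing R] {r : ℕ} {m : ℤ} {L : ℤ → Type w}
    [∀ i, AddCommGroup (L i)] [∀ i, Module R (L i)] [GLie R L]

/-- Values on the generators `v_1, …, v_r, w_1, …, w_r`. -/
def vwVal (v : Fin r → L m) (w : Fin r → L (2 * m)) : ∀ x, L (vwDeg r m x)
  | Sum.inl a => v a
  | Sum.inr a => w a

/-- The homomorphism out of `F(v_1, …, v_r, w_1, …, w_r)` with given values on the generators. -/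
noncomputable def vwLift (v : Fin r → L m) (w : Fin r → L (2 * m)) : GLieHom R (FreeVW R r m) L :=
  freeGenLift (vwVal v w)

theorem vwLift_genV (v : Fin r → L m) (w : Fin r → L (2 * m)) (a : Fin r) :
    (vwLift (R := R) v w).map m (genV R m a) = v a :=
  freeGenLift_freeGen (vwVal v w) (Sum.inl a)

theorem vwLift_genW (v : Fin r → L m) (w : Fin r → L (2 * m)) (a : Fin r) :
    (vwLift (R := R) v w).map (2 * m) (genW R m a) = w a :=
  freeGenLift_freeGen (vwVal v w) (Sum.inr a)

end Lift

theorem map_vwRelator {R : Type u} [CommRing R] {r : ℕ} {m : ℤ} {L : ℤ → Type w}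
    [∀ i, AddCommGroup (L i)] [∀ i, Module R (L i)] [GLie R L] (f : GLieHom R (FreeVW R r m) L) :
    f.map (3 * m) (vwRelator R r m) = ∑ a, GLie.br (R := R) (show m + 2 * m = 3 * m by ring)
      (f.map m (genV R m a)) (f.map (2 * m) (genW R m a)) := by
  simp only [vwRelator, map_sum, f.map_br]

/-- The preimage of a graded Lie subalgebra under a homomorphism. -/
def GLieSub.comap {R : Type u} [CommRing R] {L : ℤ → Type v} [∀ i, AddCommGroup (L i)]
    [∀ i, Module R (L i)] [GLie R L] {L' : ℤ → Type w} [∀ i, AddCommGroup (L' i)]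
    [∀ i, Module R (L' i)] [GLie R L'] (f : GLieHom R L L') (S : GLieSub R L') : GLieSub R L where
  carrier i := (S.carrier i).comap (f.map i)
  br_mem h x y hx hy := by
    rw [Submodule.mem_comap] at hx hy ⊢
    rw [f.map_br]
    exact S.br_mem h _ _ hx hy
  sq_mem ho h x hx := by
    rw [Submodule.mem_comap] at hx ⊢
    rw [f.map_sq]
    exact S.sq_mem ho h _ hx

variable (R : Type u) [CommRing R] (r : ℕ) (m : ℤ)

/-- The class of `v_a` in `F(v_1, …, v_r, w_1, …, w_r) / (∑ [v_a, w_a])`. -/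
noncomputable def quotV (a : Fin r) : (vwIdeal R r m).Quot m := (vwIdeal R r m).proj m (genV R m a)

/-- The class of `w_a` in `F(v_1, …, v_r, w_1, …, w_r) / (∑ [v_a, w_a])`. -/
noncomputable def quotW (a : Fin r) : (vwIdeal R r m).Quot (2 * m) :=
  (vwIdeal R r m).proj (2 * m) (genW R m a)

theorem sum_br_quotV_quotW {n : ℤ} (h : m + 2 * m = n) :
    ∑ a, GLie.br (R := R) h (quotV R r m a) (quotW R r m a) = 0 := by
  obtain rfl : 3 * m = n := by rw [← h]; ring
  exact (map_vwRelator (vwIdeal R r m).projHom).symm.trans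
    (GLieIdeal.proj_eq_zero _ (GLieIdeal.mem_gen_self _))

variable {R r m} [hm : Fact (Odd m)] (g h : Matrix (Fin (r + 1)) (Fin (r + 1)) R)

/-- The dual number with components `v_a` and its image under the derivation. -/
noncomputable def dualV (a : Fin r) : DualGLie (vwIdeal R r m).Quot m m :=
  (quotV R r m a, LinearEquiv.cast (R := R) (M := (vwIdeal R r m).Quot) (two_mul m)
    (yFam hm.out g h (quotV R r m) (quotW R r m) a.succ))

/-- The dual number with components `w_a` and its image under the derivation. -/
noncomputable def dualW (a : Fin r) : DualGLie (vwIdeal R r m).Quot m (2 * m) :=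
  (quotW R r m a, GLie.br (R := R) (add_comm (2 * m) m)
    (yFam hm.out g h (quotV R r m) (quotW R r m) 0) (zFam g (quotV R r m) a.succ))

/-- The homomorphism to dual numbers which corresponds to the derivation. -/
noncomputable def freeDual : GLieHom R (FreeVW R r m) (DualGLie (vwIdeal R r m).Quot m) :=
  vwLift (dualV g h) (dualW g h)

theorem freeDual_genV (a : Fin r) : (freeDual g h).map m (genV R m a) = dualV g h a :=
  vwLift_genV _ _ a

theorem freeDual_genW (a : Fin r) : (freeDual g h).map (2 * m) (genW R m a) = dualW g h a :=
  vwLift_genW _ _ a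

theorem freeDual_fst {i : ℤ} (x : FreeVW R r m i) :
    ((freeDual g h).map i x).1 = (vwIdeal R r m).proj i x :=
  vw_hom_ext (f := (DualGLie.fst m).comp (freeDual g h)) (f' := (vwIdeal R r m).projHom)
    (fun a => congrArg Prod.fst (freeDual_genV g h a))
    (fun a => congrArg Prod.fst (freeDual_genW g h a)) x

variable {g h} (hg : g.IsSymm) (hh : h.IsSymm)

include hg hh in
-- The first component is the relator itself, zero in the quotient. The second is `∑ ([y_a, w_a] -
-- [v_a, [y_0, z_a]])`, a difference of two sums both equal to `[y_0, λ]`.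
theorem freeDual_relator : (freeDual g h).map (3 * m) (vwRelator R r m) = 0 := by
  refine Prod.ext ((freeDual_fst g h _).trans
    (GLieIdeal.proj_eq_zero _ (GLieIdeal.mem_gen_self _))) ?_
  rw [map_vwRelator]
  refine (map_sum (LinearMap.snd R ((vwIdeal R r m).Quot (3 * m))
    ((vwIdeal R r m).Quot (m + 3 * m))) _ _).trans ?_
  have e1 : 2 * m + 2 * m = m + 3 * m := by ring
  have e2 : m + (m + 2 * m) = m + 3 * m := by ring
  have key := (sum_br_yFam hm.out (g := g) (quotV R r m) (quotW R r m) hh e1).trans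
    (sum_br_zFam hm.out (quotV R r m) hg e1 (add_comm (2 * m) m) e2 _).symm
  rw [← sub_eq_zero, ← Finset.sum_sub_distrib] at key
  refine Eq.trans (Finset.sum_congr rfl fun a _ => ?_) key
  rw [freeDual_genV, freeDual_genW]
  change GLie.br (R := R) (show m + m + 2 * m = m + 3 * m by ring)
      (LinearEquiv.cast (R := R) (M := (vwIdeal R r m).Quot) (two_mul m)
      (yFam hm.out g h (quotV R r m) (quotW R r m) a.succ)) (quotW R r m a)
    + koszulSign R m m • GLie.br (R := R) e2 (quotV R r m a)
      (GLie.br (R := R) (add_comm (2 * m) m) (yFam hm.out g h (quotV R r m) (quotW R r m) 0)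
        (zFam g (quotV R r m) a.succ)) = _
  rw [GLieDer.br_cast_left (two_mul m) _ e1, koszulSign_odd R hm.out, neg_one_smul, sub_eq_add_neg]

/-- The section of the dual numbers which corresponds to the derivation. -/
noncomputable def vwDual : GLieHom R (vwIdeal R r m).Quot (DualGLie (vwIdeal R r m).Quot m) :=
  GLieIdeal.genLift (freeDual g h) (freeDual_relator hg hh)

theorem vwDual_proj {i : ℤ} (x : FreeVW R r m i) :
    (vwDual hg hh).map i ((vwIdeal R r m).proj i x) = (freeDual g h).map i x := rfl

theorem vwDual_fst (i : ℤ) (x : (vwIdeal R r m).Quot i) : ((vwDual hg hh).map i x).1 = x := by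
  obtain ⟨x, rfl⟩ := (vwIdeal R r m).proj_surjective _ x
  exact freeDual_fst g h x

/-- The derivation of `F(v_1, …, v_r, w_1, …, w_r) / (∑ [v_a, w_a])` given by a symmetric matrix and
its inverse. -/
noncomputable def vwDer : GLieDer R (vwIdeal R r m).Quot m :=
  GLieDer.ofSection (vwDual hg hh) (vwDual_fst hg hh)

theorem vwDer_quotV (a : Fin r) : (vwDer hg hh).map (two_mul m).symm (quotV R r m a)
    = yFam hm.out g h (quotV R r m) (quotW R r m) a.succ := by
  rw [GLieDer.map_cast _ rfl _ (two_mul m).symm, vwDer, GLieDer.ofSection_map, quotV, vwDual_proj,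
    freeDual_genV]
  simp [dualV]

theorem vwDer_quotW (a : Fin r) :
    (vwDer hg hh).map (rfl : m + 2 * m = m + 2 * m) (quotW R r m a)
      = GLie.br (R := R) (add_comm (2 * m) m)
        (yFam hm.out g h (quotV R r m) (quotW R r m) 0) (zFam g (quotV R r m) a.succ) := by
  rw [vwDer, GLieDer.ofSection_map]
  exact congrArg Prod.snd (freeDual_genW g h a)

variable (hgh : g * h = 1) (hhg : h * g = 1)

include hgh hhg in
-- The elements with `D² x = [y_0, x]` form a subalgebra, so the generators `v_a` and `w_a` suffice.
theorem vwDer_vwDer {j a n : ℤ} (h₁ : m + j = a) (h₂ : m + a = n) (h₃ : 2 * m + j = n)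
    (x : (vwIdeal R r m).Quot j) :
    (vwDer hg hh).map h₂ ((vwDer hg hh).map h₁ x)
      = GLie.br (R := R) h₃ (yFam hm.out g h (quotV R r m) (quotW R r m) 0) x := by
  subst h₁ h₂
  obtain ⟨x, rfl⟩ := (vwIdeal R r m).proj_surjective _ x
  refine LinearMap.mem_eqLocus.1 (vw_mem_of_generators (GLieSub.comap (vwIdeal R r m).projHom
    ((vwDer hg hh).squareLocus (yFam hm.out g h (quotV R r m) (quotW R r m) 0) hm.out))
    (fun a => ?_) (fun a => ?_) x)
  · exact (vwDer hg hh).map_map_v hm.out _ _ hg hgh hhg (vwDer_quotV hg hh) (vwDer_quotW hg hh)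
      (sum_br_quotV_quotW R r m rfl) a
  · exact (vwDer hg hh).map_map_w hm.out _ _ hg hgh hhg (vwDer_quotV hg hh) (vwDer_quotW hg hh)
      (sum_br_quotV_quotW R r m rfl) a

/-- The extension of `F(v_1, …, v_r, w_1, …, w_r) / (∑ [v_a, w_a])` by an element `u` of degree
`m`. -/
noncomputable def vwExt : GLieExt R (vwIdeal R r m).Quot (fun i => RankOne R m i) :=
  (vwDer hg hh).ext (yFam hm.out g h (quotV R r m) (quotW R r m) 0) hm.out
    (fun hn => (vwDer hg hh).map_yFam_zero hm.out _ _ hg hgh hhg (vwDer_quotV hg hh)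
      (vwDer_quotW hg hh) (sum_br_quotV_quotW R r m rfl) hn)
    (vwDer_vwDer hg hh hgh hhg)

/-- The family `u, v_1, …, v_r` in the extension. -/
noncomputable def extBasis : Fin (r + 1) → (vwExt (m := m) hg hh hgh hhg).Total m :=
  Fin.cons ((vwExt (m := m) hg hh hgh hhg).inr m (RankOne.gen R m))
    (fun a => (vwExt (m := m) hg hh hgh hhg).inl.map m (quotV R r m a))

theorem sq_extBasis : GLie.sq (R := R) hm.out (two_mul m).symm (extBasis (m := m) hg hh hgh hhg 0)
    = (vwExt (m := m) hg hh hgh hhg).inl.map (2 * m)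
      (yFam hm.out g h (quotV R r m) (quotW R r m) 0) := by
  rw [extBasis, Fin.cons_zero, GLieExt.sq_inr]
  congr 1
  refine (GLieDer.extSq_self _ (two_mul m).symm rfl _).trans ?_
  simp [RankOne.gen]

theorem br_extBasis (a : Fin r) : GLie.br (R := R) (two_mul m).symm
    (extBasis (m := m) hg hh hgh hhg 0)
    (extBasis (m := m) hg hh hgh hhg a.succ) = (vwExt (m := m) hg hh hgh hhg).inl.map (2 * m)
      (yFam hm.out g h (quotV R r m) (quotW R r m) a.succ) := by
  rw [extBasis, Fin.cons_zero, Fin.cons_succ, GLieExt.br_inr_inl]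
  congr 1
  refine (GLieDer.act_self _ (two_mul m).symm _ _).trans ?_
  rw [vwDer_quotV]
  simp [RankOne.gen]

/-- In the extension `(u², [u, v_1], …)` is the family `y`, so the terms involving `u` add up to row
0 of `g y = x`, which is `-λ`, and cancel the remaining part `λ`. -/
theorem quad_extBasis : quad (R := R)
    hm.out (two_mul m).symm g (extBasis (m := m) hg hh hgh hhg) = 0 := by
  rw [quad_succ, sq_extBasis]
  simp only [br_extBasis]
  have e : (fun i : Fin r => extBasis (m := m) hg hh hgh hhg i.succ)
      = fun a => (vwExt (m := m) hg hh hgh hhg).inl.map m (quotV R r m a) := rfl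
  rw [e, ← GLieHom.map_quad]
  simp only [← map_smul, ← map_sum, ← map_add]
  have := sum_smul_yFam hm.out (quotV R r m) (quotW R r m) hgh 0
  rw [Fin.sum_univ_succ] at this
  rw [this]
  simp [xFam]

/-- The remaining rows of `g y = x`: the expression defining `w_a` in `F(V)` evaluates in the
extension to the generator `w_a`. -/
theorem sum_extBasis (a : Fin r) :
    g a.succ 0 • GLie.sq (R := R) hm.out (two_mul m).symm (extBasis (m := m) hg hh hgh hhg 0)
      + ∑ j : Fin r, g a.succ j.succ • GLie.br (R := R) (two_mul m).symm
        (extBasis (m := m) hg hh hgh hhg 0) (extBasis (m := m) hg hh hgh hhg j.succ)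
      = (vwExt (m := m) hg hh hgh hhg).inl.map (2 * m) (quotW R r m a) := by
  rw [sq_extBasis]
  simp only [br_extBasis, ← map_smul, ← map_sum, ← map_add]
  have := sum_smul_yFam hm.out (quotV R r m) (quotW R r m) hgh a.succ
  rw [Fin.sum_univ_succ] at this
  rw [this]
  simp [xFam]

end Presented

/-! ### The elements `w_a` and the relation between them -/

section WElement

variable {R : Type u} [CommRing R] {L : ℤ → Type v} [∀ i, AddCommGroup (L i)]
  [∀ i, Module R (L i)] [GLie R L] {m n : ℤ} (hm : Odd m) (h : m + m = n) {r : ℕ}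
  (g : Matrix (Fin (r + 1)) (Fin (r + 1)) R)

/-- The element `g a 0 • x 0 ² + ∑ j, g a j • [x 0, x j]`, the sum being over nonzero indices. -/
def wElt (x : Fin (r + 1) → L m) (a : Fin r) : L n :=
  g a.succ 0 • GLie.sq (R := R) hm h (x 0)
    + ∑ j : Fin r, g a.succ j.succ • GLie.br (R := R) h (x 0) (x j.succ)

theorem GLieHom.map_wElt {L' : ℤ → Type w} [∀ i, AddCommGroup (L' i)] [∀ i, Module R (L' i)]
    [GLie R L'] (f : GLieHom R L L') (x : Fin (r + 1) → L m) (a : Fin r) :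
    f.map n (wElt hm h g x a) = wElt hm h g (fun i => f.map m (x i)) a := by
  simp only [wElt, map_add, map_sum, map_smul, f.map_br, f.map_sq]

variable {g}

/-- Expand `[u, l]` with `u = x 0`: `[u, u²] = 0`, `[u, [u, v_j]] = -[v_j, u²]`, and `[u, λ] = -∑
g_ij [v_j, [u, v_i]]`. Collecting the terms that start with `v_j` produces `-[v_j, w_j]`, by
symmetry of `g`. -/
theorem sum_br_wElt (hg : g.IsSymm) (x : Fin (r + 1) → L m) {p : ℤ} (hp : m + n = p) :
    ∑ a : Fin r, GLie.br (R := R) hp (x a.succ) (wElt hm h g x a)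
      = -GLie.br (R := R) hp (x 0) (quad hm h g x) := by
  have hnm : n + m = p := by rw [← hp, add_comm]
  have hn : Even n := h ▸ hm.add_odd hm
  have e : ∀ j : Fin r, GLie.br (R := R) hp (x 0) (GLie.br (R := R) h (x 0) (x j.succ))
      = -GLie.br (R := R) hp (x j.succ) (GLie.sq (R := R) hm h (x 0)) := fun j => by
    rw [GLie.br_br_self hm h hp h hnm, GLie.br_anticomm_of_even_left hn hnm hp]
  rw [quad_succ, map_add, map_add, br_quad hm h (hg.submatrix _) _ hp h hnm]
  simp only [map_smul, GLie.br_self_sq, smul_zero, zero_add, map_sum, e, wElt, map_add,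
    Finset.sum_add_distrib, smul_neg, Finset.sum_neg_distrib, neg_add, neg_neg, hg.apply 0]
  congr 1
  rw [Finset.sum_comm, ← Finset.sum_neg_distrib]
  refine Finset.sum_congr rfl fun i _ => ?_
  rw [← Finset.sum_neg_distrib]
  refine Finset.sum_congr rfl fun j _ => ?_
  rw [GLie.br_anticomm_of_even_left hn hnm hp, smul_neg, neg_neg, Matrix.submatrix_apply,
    hg.apply]

end WElement

/-! ### Adjoining one element to a subalgebra -/

section Adjoin

variable {R : Type u} [CommRing R] {L : ℤ → Type v} [∀ i, AddCommGroup (L i)]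
  [∀ i, Module R (L i)] {m : ℤ}

/-- The multiples of an element of degree `m`, as a graded submodule. -/
def lineAt (x : L m) (i : ℤ) : Submodule R (L i) :=
  ⨆ e : m = i, Submodule.span R {LinearEquiv.cast (R := R) (M := L) e x}

theorem mem_lineAt_self (x : L m) (y : L m) :
    y ∈ lineAt (R := R) x m ↔ ∃ c : R, c • x = y := by
  rw [lineAt, iSup_pos rfl, Submodule.mem_span_singleton]
  rfl

theorem eq_zero_of_mem_lineAt (x : L m) {i : ℤ} (hi : m ≠ i) {y : L i}
    (hy : y ∈ lineAt (R := R) x i) : y = 0 := by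
  rwa [lineAt, iSup_neg hi, Submodule.mem_bot] at hy

variable [GLie R L]

/-- The range of a homomorphism. -/
def GLieHom.range {L' : ℤ → Type w} [∀ i, AddCommGroup (L' i)] [∀ i, Module R (L' i)]
    [GLie R L'] (f : GLieHom R L' L) : GLieSub R L where
  carrier i := LinearMap.range (f.map i)
  br_mem h x y hx hy := by
    obtain ⟨x, rfl⟩ := hx
    obtain ⟨y, rfl⟩ := hy
    exact ⟨_, f.map_br h x y⟩
  sq_mem ho h x hx := by
    obtain ⟨x, rfl⟩ := hx
    exact ⟨_, f.map_sq ho h x⟩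

/-- The subalgebra generated by `S` and by an element `x` of odd degree which normalizes `S` and
whose square is in `S`. -/
def GLieSub.adjoin (S : GLieSub R L) (hm : Odd m) (x : L m)
    (hsq : ∀ {n : ℤ} (h : m + m = n), GLie.sq (R := R) hm h x ∈ S.carrier n)
    (hbr : ∀ {j n : ℤ} (h : m + j = n) (y : L j), y ∈ S.carrier j →
      GLie.br (R := R) h x y ∈ S.carrier n) : GLieSub R L where
  carrier i := S.carrier i ⊔ lineAt x i
  br_mem {i j n} h y z hy hz := by
    -- Brackets land in `S` itself; the only one not covered by closure of `S` and `hbr` is `[x, x]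
    -- = 2 x²`.
    refine Submodule.mem_sup_left ?_
    obtain ⟨y, hy₀, y', hy', rfl⟩ := Submodule.mem_sup.1 hy
    obtain ⟨z, hz₀, z', hz', rfl⟩ := Submodule.mem_sup.1 hz
    have hl : ∀ {a b : ℤ} (hab : a + b = n) (s s' : _), s ∈ lineAt (R := R) x a →
        s' ∈ S.carrier b → GLie.br (R := R) hab s s' ∈ S.carrier n := by
      intro a b hab s s' hs hs'
      by_cases ha : m = a
      · subst ha
        obtain ⟨c, rfl⟩ := (mem_lineAt_self x s).1 hs
        rw [map_smul, LinearMap.smul_apply]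
        exact Submodule.smul_mem _ _ (hbr hab _ hs')
      · rw [eq_zero_of_mem_lineAt x ha hs, map_zero]
        exact zero_mem _
    simp only [map_add, LinearMap.add_apply]
    refine add_mem (add_mem (S.br_mem h _ _ hy₀ hz₀) (hl h _ _ hy' hz₀)) (add_mem ?_ ?_)
    · rw [GLie.skew h ((add_comm j i).trans h)]
      exact neg_mem (Submodule.smul_mem _ _ (hl _ _ _ hz' hy₀))
    · by_cases hi : m = i
      · by_cases hj : m = j
        · subst hi hj
          obtain ⟨c, rfl⟩ := (mem_lineAt_self x y').1 hy'
          obtain ⟨d, rfl⟩ := (mem_lineAt_self x z').1 hz'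
          simp only [map_smul, LinearMap.smul_apply, ← GLie.two_sq hm]
          exact Submodule.smul_mem _ _ (Submodule.smul_mem _ _ (Submodule.smul_mem _ _ (hsq h)))
        · rw [eq_zero_of_mem_lineAt x hj hz', map_zero]
          exact zero_mem _
      · rw [eq_zero_of_mem_lineAt x hi hy', map_zero]
        exact zero_mem _
  sq_mem {i n} ho h y hy := by
    refine Submodule.mem_sup_left ?_
    obtain ⟨y, hy₀, y', hy', rfl⟩ := Submodule.mem_sup.1 hy
    by_cases hi : m = i
    · subst hi
      obtain ⟨c, rfl⟩ := (mem_lineAt_self x y').1 hy'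
      rw [GLie.sq_add, GLie.sq_smul, map_smul, GLie.br_comm_of_odd hm hm h h]
      exact add_mem (add_mem (S.sq_mem _ _ _ hy₀) (Submodule.smul_mem _ _ (hsq h)))
        (Submodule.smul_mem _ _ (hbr h _ hy₀))
    · rw [eq_zero_of_mem_lineAt x hi hy', add_zero]
      exact S.sq_mem _ _ _ hy₀

/-- Since `ad x` is a derivation, the elements of the free algebra whose image is sent by `ad x`
into the range of `f` form a subalgebra; hence generators suffice. -/
theorem range_normalized {r : ℕ} {f : GLieHom R (FreeVW R r m) L} (x : L m)
    (hv : ∀ {n : ℤ} (h : m + m = n) a,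
      GLie.br (R := R) h x (f.map m (genV R m a)) ∈ f.range.carrier n)
    (hw : ∀ {n : ℤ} (h : m + 2 * m = n) a,
      GLie.br (R := R) h x (f.map (2 * m) (genW R m a)) ∈ f.range.carrier n)
    {j n : ℤ} (h : m + j = n) (y : L j) (hy : y ∈ f.range.carrier j) :
      GLie.br (R := R) h x y ∈ f.range.carrier n := by
  subst h
  obtain ⟨y, rfl⟩ := hy
  let S : GLieSub R (FreeVW R r m) :=
    { carrier := fun i => (f.range.carrier (m + i)).comap
        ((GLie.br (R := R) (rfl : m + i = m + i) x).comp (f.map i))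
      br_mem := fun {i j n} h y z hy hz => by
        subst h
        rw [Submodule.mem_comap, LinearMap.comp_apply] at hy hz ⊢
        rw [f.map_br, GLie.jacobi rfl rfl rfl (show m + i + j = m + (i + j) by ring) rfl
          (show i + (m + j) = m + (i + j) by ring)]
        exact add_mem (f.range.br_mem _ _ _ hy ⟨z, rfl⟩)
          (Submodule.smul_mem _ _ (f.range.br_mem _ _ _ ⟨y, rfl⟩ hz))
      sq_mem := fun {i n} ho h y hy => by
        subst h
        rw [Submodule.mem_comap, LinearMap.comp_apply] at hy ⊢
        rw [f.map_sq, GLie.br_sq ho rfl rfl rfl (show m + i + i = m + (i + i) by ring)]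
        exact f.range.br_mem _ _ _ hy ⟨y, rfl⟩ }
  exact vw_mem_of_generators S (hv rfl) (hw rfl) y

end Adjoin

/-! ### Linear algebra -/

section LinearAlgebra

/-- A complement of `W` is a submodule of a free module over a principal ideal domain, hence free,
and its rank is one by additivity. Its generator takes index 0. -/
theorem exists_basis_succ {R : Type u} [CommRing R] [IsDomain R] [IsPrincipalIdealRing R]
    {M : Type v} [AddCommGroup M] [Module R M] [Module.Free R M] [Module.Finite R M] {r : ℕ}
    (hrank : Module.finrank R M = r + 1) {W C : Submodule R M} (hWC : IsCompl W C)
    (v : Module.Basis (Fin r) R W) :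
    ∃ b : Module.Basis (Fin (r + 1)) R M, ∀ i, b i.succ = v i := by
  have hC : Module.finrank R C = 1 := by
    have := (Submodule.prodEquivOfIsCompl W C hWC).finrank_eq
    rw [Module.finrank_prod, Module.finrank_eq_card_basis v, Fintype.card_fin, hrank] at this
    omega
  refine ⟨((v.prod (Module.basisUnique PUnit.{1} hC)).map
    (Submodule.prodEquivOfIsCompl W C hWC)).reindex
    ((finSuccEquiv r).trans (Equiv.optionEquivSumPUnit (Fin r))).symm, fun i => ?_⟩
  simp

variable {R : Type u} [CommRing R] {M : Type v} [AddCommGroup M] [Module R M] {r : ℕ}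
  (b : Module.Basis (Fin (r + 1)) R M) (g : Matrix (Fin (r + 1)) (Fin (r + 1)) R)

/-- The 2-tensor which corresponds to `wElt`. -/
noncomputable def wTensor (a : Fin r) : M ⊗[R] M :=
  g a.succ 0 • b 0 ⊗ₜ b 0 + ∑ j : Fin r, g a.succ j.succ • (b 0 ⊗ₜ b j.succ + b j.succ ⊗ₜ b 0)

variable {g h : Matrix (Fin (r + 1)) (Fin (r + 1)) R} (hg : g.IsSymm) (hgh : g * h = 1)
  (hhg : h * g = 1) {W : Submodule R M} (v : Module.Basis (Fin r) R W)
  (hv : ∀ i, b i.succ = v i)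

include hv in
theorem coord_zero_of_mem {x : M} (hx : x ∈ W) : b.coord 0 x = 0 := by
  have e : (b.coord 0).comp W.subtype = 0 := v.ext fun i => by
    rw [LinearMap.comp_apply, Submodule.subtype_apply, ← hv]
    simp
  exact LinearMap.congr_fun e ⟨x, hx⟩

include hg hgh hv in
-- The contraction `P` of the second factor with the coordinate dual to `b 0` kills `V ⊗ W` and maps
-- the symmetric tensor and the `w_a` to the rows of `g`, which are independent.
theorem linearIndependent_wTensor :
    LinearIndependent R (fun a => Submodule.mkQ
      (Submodule.span R {∑ i, ∑ j, g i j • b i ⊗ₜ[R] b j}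
        ⊔ LinearMap.range (LinearMap.lTensor M W.subtype)) (wTensor b g a)) := by
  let P : M ⊗[R] M →ₗ[R] M := (TensorProduct.rid R M).toLinearMap.comp
    (LinearMap.lTensor M (b.coord 0))
  have hP : ∀ x y, P (x ⊗ₜ y) = b.coord 0 y • x := fun x y => by simp [P]
  have hPt : P (∑ i, ∑ j, g i j • b i ⊗ₜ[R] b j) = ∑ k, g 0 k • b k := by
    simp only [map_sum, map_smul, hP]
    refine Finset.sum_congr rfl fun i _ => ?_
    rw [Finset.sum_eq_single 0]
    · simp [hg.apply 0 i]
    · intro j _ hj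
      simp [hj]
    · simp
  have hPw : ∀ a, P (wTensor b g a) = ∑ k, g a.succ k • b k := fun a => by
    simp [wTensor, hP, Fin.sum_univ_succ]
  have hPW : ∀ z ∈ LinearMap.range (LinearMap.lTensor M W.subtype), P z = 0 := by
    rintro _ ⟨z, rfl⟩
    induction z with
    | zero => simp
    | tmul x y => rw [LinearMap.lTensor_tmul, hP, Submodule.subtype_apply,
        coord_zero_of_mem b v hv y.2, zero_smul]
    | add x y hx hy => rw [map_add, map_add, hx, hy, add_zero]
  rw [Fintype.linearIndependent_iff]
  intro c hc
  simp only [← map_smul, ← map_sum] at hc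
  rw [Submodule.mkQ_apply, Submodule.Quotient.mk_eq_zero] at hc
  obtain ⟨_, hs, z, hz, hsz⟩ := Submodule.mem_sup.1 hc
  obtain ⟨s, rfl⟩ := Submodule.mem_span_singleton.1 hs
  have key := congrArg P hsz
  rw [map_add, map_smul, hPt, hPW z hz, add_zero, map_sum] at key
  simp only [map_smul, hPw] at key
  -- A relation `∑ c_a w_a = s t + z` with `z` in `V ⊗ W` contracts to a vanishing combination of
  -- the rows of `g` with coefficients `(-s, c)`.
  let d : Fin (r + 1) → R := Fin.cons (-s) c
  have hd : ∑ l, d l • ∑ k, g l k • b k = 0 := by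
    rw [Fin.sum_univ_succ]
    simp only [d, Fin.cons_zero, Fin.cons_succ, ← key]
    simp
  have hd' : Matrix.vecMul d g = 0 := by
    simp only [Finset.smul_sum, smul_smul] at hd
    rw [Finset.sum_comm] at hd
    simp only [← Finset.sum_smul] at hd
    funext k
    exact Fintype.linearIndependent_iff.1 b.linearIndependent _ hd k
  have hd0 : d = 0 := by
    rw [← Matrix.vecMul_one d, ← hgh, ← Matrix.vecMul_vecMul, hd', Matrix.zero_vecMul]
  exact fun a => congrFun hd0 a.succ

include hg hhg hv in
-- Modulo `V ⊗ W` only the classes of `b k ⊗ b 0` survive. Multiplying them by `g` gives 0 (from the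
-- symmetric tensor) and the classes of the `w_a`; multiplying by `h` recovers them from these.
theorem span_wTensor :
    Submodule.span R (Set.range fun a => Submodule.mkQ
      (Submodule.span R {∑ i, ∑ j, g i j • b i ⊗ₜ[R] b j}
        ⊔ LinearMap.range (LinearMap.lTensor M W.subtype)) (wTensor b g a)) = ⊤ := by
  set N := Submodule.span R {∑ i, ∑ j, g i j • b i ⊗ₜ[R] b j}
        ⊔ LinearMap.range (LinearMap.lTensor M W.subtype) with hN
  set Sp := Submodule.span R (Set.range fun a => N.mkQ (wTensor b g a))
  have h0 : ∀ x (j : Fin r), N.mkQ (x ⊗ₜ b j.succ) = 0 := fun x j => by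
    rw [Submodule.mkQ_apply, Submodule.Quotient.mk_eq_zero, hv]
    exact Submodule.mem_sup_right ⟨x ⊗ₜ v j, rfl⟩
  have ht : ∑ k, g 0 k • N.mkQ (b k ⊗ₜ b 0) = 0 := by
    have : N.mkQ (∑ i, ∑ j, g i j • b i ⊗ₜ[R] b j) = 0 := by
      rw [Submodule.mkQ_apply, Submodule.Quotient.mk_eq_zero]
      exact Submodule.mem_sup_left (Submodule.mem_span_singleton_self _)
    rw [← this]
    simp only [map_sum, map_smul]
    refine Finset.sum_congr rfl fun i _ => ?_
    rw [Fin.sum_univ_succ, hg.apply 0 i]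
    simp only [h0, smul_zero, Finset.sum_const_zero, add_zero]
  have hw : ∀ a : Fin r, ∑ k, g a.succ k • N.mkQ (b k ⊗ₜ b 0) = N.mkQ (wTensor b g a) := by
    intro a
    simp only [wTensor, map_add, map_sum, map_smul, h0, zero_add, Fin.sum_univ_succ]
  have hq : ∀ i, N.mkQ (b i ⊗ₜ b 0) ∈ Sp := fun i => by
    rw [← sum_smul_sum_smul hhg (fun i => N.mkQ (b i ⊗ₜ b 0)) i]
    refine Submodule.sum_mem _ fun l _ => Submodule.smul_mem _ _ ?_
    refine Fin.cases ?_ (fun a => ?_) l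
    · rw [ht]
      exact zero_mem _
    · rw [hw]
      exact Submodule.subset_span ⟨a, rfl⟩
  have hall : Sp.comap N.mkQ = ⊤ := by
    rw [eq_top_iff, ← (b.tensorProduct b).span_eq, Submodule.span_le]
    rintro _ ⟨⟨i, j⟩, rfl⟩
    rw [Module.Basis.tensorProduct_apply, SetLike.mem_coe, Submodule.mem_comap]
    refine Fin.cases (hq i) (fun j => ?_) j
    rw [h0]
    exact zero_mem _
  rw [eq_top_iff]
  intro z _
  obtain ⟨z, rfl⟩ := N.mkQ_surjective z
  exact (hall ▸ Submodule.mem_top : z ∈ Sp.comap N.mkQ)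

end LinearAlgebra

/-! ### The comparison homomorphism and the main theorem -/

section Main

variable {R : Type u} [CommRing R] {V : ℤ → Type v} [∀ i, AddCommGroup (V i)]
  [∀ i, Module R (V i)] {m : ℤ} {r : ℕ} {g h : Matrix (Fin (r + 1)) (Fin (r + 1)) R}

theorem toTensor_wElt (hm : Odd m) (b : Module.Basis (Fin (r + 1)) R (V m)) (a : Fin r) :
    FreeGLie.toTensor R (2 * m) (wElt hm (two_mul m).symm g (fun i => FreeGLie.of m (b i)) a)
      = tensorOf₂ R m (wTensor b g a) := by
  simp only [wElt, wTensor, map_add, map_sum, map_smul, toTensor_sq, toTensor_br, toTensor_of,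
    gradedCommutator_of_odd hm hm, tensorOf₂_tmul]

/-- The homomorphism `F(V) / (l) → E` to the extension. -/
theorem exists_hom_to_ext [hm : Fact (Odd m)] (hg : g.IsSymm) (hh : h.IsSymm) (hgh : g * h = 1)
    (hhg : h * g = 1) (b : Module.Basis (Fin (r + 1)) R (V m)) :
    ∃ ψ : GLieHom R (GLieIdeal.gen (R := R)
        (quad hm.out (two_mul m).symm g fun i => FreeGLie.of (R := R) m (b i))).Quot
        (vwExt (m := m) hg hh hgh hhg).Total,
      ∀ i, ψ.map m (GLieIdeal.proj _ m (FreeGLie.of m (b i)))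
        = extBasis (m := m) hg hh hgh hhg i := by
  -- The basis goes to `u, v_1, …, v_r`; the map is zero outside degree `m`.
  let f : ∀ i, V i →ₗ[R] (vwExt (m := m) hg hh hgh hhg).Total i :=
    Pi.single m (b.constr R (extBasis (m := m) hg hh hgh hhg))
  have hf : ∀ i, (FreeGLie.lift f).map m (FreeGLie.of m (b i))
      = extBasis (m := m) hg hh hgh hhg i := fun i => by
    rw [FreeGLie.lift_of]
    simp [f]
  refine ⟨GLieIdeal.genLift (FreeGLie.lift f) ?_, hf⟩
  rw [GLieHom.map_quad]
  simp only [hf]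
  exact quad_extBasis hg hh hgh hhg

/-- With `x 0` the class of `u`, the range of `f` plus the line of `x 0` is a subalgebra containing
the generators, and the line is zero in degrees other than `m`. -/
theorem surjective_aux (hm : Odd m) (hV : ∀ i, i ≠ m → Subsingleton (V i)) (hhg : h * g = 1)
    (b : Module.Basis (Fin (r + 1)) R (V m)) {L : ℤ → Type w} [∀ i, AddCommGroup (L i)]
    [∀ i, Module R (L i)] [GLie R L] (p : GLieHom R (FreeGLie R V) L)
    (hp : p.map (2 * m) (quad hm (two_mul m).symm g fun i => FreeGLie.of m (b i)) = 0)
    (f : GLieHom R (FreeVW R r m) L)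
    (hv : ∀ a, f.map m (genV R m a) = p.map m (FreeGLie.of m (b a.succ)))
    (hw : ∀ a, f.map (2 * m) (genW R m a) = p.map (2 * m)
      (wElt hm (two_mul m).symm g (fun i => FreeGLie.of m (b i)) a))
    {n : ℤ} (hn : n ≠ m) (y : FreeGLie R V n) : ∃ x, f.map n x = p.map n y := by
  let x : Fin (r + 1) → L m := fun i => p.map m (FreeGLie.of m (b i))
  rw [GLieHom.map_quad] at hp
  simp only [GLieHom.map_wElt] at hw
  have hx : ∀ a : Fin r, x a.succ ∈ f.range.carrier m := fun a => ⟨_, hv a⟩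
  let Y : Fin (r + 1) → L (2 * m) := Fin.cons (GLie.sq (R := R) hm (two_mul m).symm (x 0))
    (fun j => GLie.br (R := R) (two_mul m).symm (x 0) (x j.succ))
  -- Row 0 is `-λ`, by the relation `l = 0`, and the other rows are the `w_a`; all lie in the range,
  -- and `h` then recovers `u²` and the `[u, v_j]`.
  have hgY : ∀ i, ∑ l, g i l • Y l ∈ f.range.carrier (2 * m) := by
    refine Fin.cases ?_ (fun a => ?_)
    · have e : ∑ l, g 0 l • Y l = -f.map (2 * m) (quad hm (two_mul m).symm
          (g.submatrix Fin.succ Fin.succ) (genV R m)) := by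
        rw [GLieHom.map_quad, eq_neg_iff_add_eq_zero, Fin.sum_univ_succ, ← hp, quad_succ]
        simp only [hv]
        rfl
      rw [e]
      exact neg_mem ⟨_, rfl⟩
    · refine ⟨genW R m a, ?_⟩
      rw [hw, Fin.sum_univ_succ]
      rfl
  have hY : ∀ l, Y l ∈ f.range.carrier (2 * m) := fun l => by
    rw [← sum_smul_sum_smul hhg Y l]
    exact Submodule.sum_mem _ fun i _ => Submodule.smul_mem _ _ (hgY i)
  have hsq : ∀ {n : ℤ} (e : m + m = n), GLie.sq (R := R) hm e (x 0) ∈ f.range.carrier n := by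
    intro n e
    obtain rfl : 2 * m = n := by rw [← e, two_mul]
    exact hY 0
  have hbr : ∀ {j n : ℤ} (e : m + j = n) (y : L j), y ∈ f.range.carrier j →
      GLie.br (R := R) e (x 0) y ∈ f.range.carrier n := by
    refine range_normalized (x 0) (fun {n} e a => ?_) (fun {n} e a => ?_)
    · obtain rfl : 2 * m = n := by rw [← e, two_mul]
      rw [hv]
      exact hY a.succ
    -- `[u, w_a] = ∑ g_aj [u², v_j]`, because `[u, u²] = 0` and `(ad u)² = ad u²`.
    · have e' : 2 * m + m = n := by rw [← e, add_comm]
      rw [hw, wElt, map_add, map_smul, GLie.br_self_sq, smul_zero, zero_add, map_sum]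
      refine Submodule.sum_mem _ fun j _ => ?_
      rw [map_smul, GLie.br_br_self hm _ e (two_mul m).symm e']
      exact Submodule.smul_mem _ _ (f.range.br_mem _ _ _ (hsq _) (hx j))
  have hT : y ∈ ((f.range.adjoin hm (x 0) hsq hbr).comap p).carrier n := by
    refine FreeGLie.mem_of_generators _ (fun i z => ?_) y
    by_cases hi : i = m
    · subst hi
      have hz : z ∈ Submodule.span R (Set.range b) := by rw [b.span_eq]; trivial
      change z ∈ (((f.range.adjoin hm (x 0) hsq hbr).comap p).carrier i).comap (FreeGLie.of i)
      refine Submodule.span_le.2 ?_ hz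
      rintro _ ⟨k, rfl⟩
      refine Fin.cases ?_ (fun a => ?_) k
      · exact Submodule.mem_sup_right ((mem_lineAt_self (x 0) _).2 ⟨1, one_smul _ _⟩)
      · exact Submodule.mem_sup_left (hx a)
    · have := hV i hi
      rw [Subsingleton.elim z 0, map_zero]
      exact zero_mem _
  obtain ⟨s, hs, z, hz, hsz⟩ := Submodule.mem_sup.1 (Submodule.mem_comap.1 hT)
  rw [eq_zero_of_mem_lineAt (x 0) hn.symm hz, add_zero] at hsz
  rw [← hsz]
  exact hs

theorem exists_isomorphism (hm : Odd m) (hV : ∀ i, i ≠ m → Subsingleton (V i)) (hg : g.IsSymm)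
    (hh : h.IsSymm) (hgh : g * h = 1) (hhg : h * g = 1)
    (b : Module.Basis (Fin (r + 1)) R (V m)) {W : Submodule R (V m)}
    (v : Module.Basis (Fin r) R W) (hv : ∀ i, b i.succ = v i) {l : FreeGLie R V (2 * m)}
    (hl : l = quad hm (two_mul m).symm g fun i => FreeGLie.of m (b i)) :
    ∃ Φ : GLieHom R (vwIdeal R r m).Quot (LieW hm hV l W).Carrier,
      (∀ a, (LieW hm hV l W).incl m (Φ.map m ((vwIdeal R r m).proj m (genV R m a)))
        = (GLieIdeal.gen l).proj m (FreeGLie.of m (v a : V m))) ∧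
      (∀ a, (LieW hm hV l W).incl (2 * m)
          (Φ.map (2 * m) ((vwIdeal R r m).proj (2 * m) (genW R m a)))
        = (GLieIdeal.gen l).proj (2 * m)
          (wElt hm (two_mul m).symm g (fun i => FreeGLie.of m (b i)) a)) ∧
      ∀ i, Function.Bijective (Φ.map i) := by
  have : Fact (Odd m) := ⟨hm⟩
  subst hl
  set l : FreeGLie R V (2 * m) := quad hm (two_mul m).symm g fun i => FreeGLie.of m (b i) with hl
  have hm2 : 2 * m ≠ m := fun e => by
    rw [show m = 0 by omega] at hm
    exact absurd hm (by decide)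
  let w' : Fin r → FreeGLie R V (2 * m) :=
    wElt hm (two_mul m).symm g (fun i => FreeGLie.of m (b i))
  let p : GLieHom R (FreeGLie R V) (GLieIdeal.gen (R := R) l).Quot := (GLieIdeal.gen l).projHom
  have hpl : p.map (2 * m) l = 0 := GLieIdeal.proj_eq_zero _ (GLieIdeal.mem_gen_self l)
  let f : GLieHom R (FreeVW R r m) (LieW hm hV l W).Carrier := vwLift
    (fun a => (LieW hm hV l W).ofMem (p.map m (FreeGLie.of m (v a : V m)))
      (by rw [LieW_self]; exact ⟨v a, (v a).2, rfl⟩))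
    (fun a => (LieW hm hV l W).ofMem (p.map (2 * m) (w' a))
      (by rw [LieW_of_ne hm hV l W hm2]; trivial))
  let θ : GLieHom R (FreeVW R r m) (GLieIdeal.gen (R := R) l).Quot :=
    (LieW hm hV l W).inclHom.comp f
  have hθv : ∀ a, θ.map m (genV R m a) = p.map m (FreeGLie.of m (b a.succ)) := fun a => by
    rw [hv]
    exact congrArg ((LieW hm hV l W).incl m) (vwLift_genV _ _ a)
  have hθw : ∀ a, θ.map (2 * m) (genW R m a) = p.map (2 * m) (w' a) := fun a =>
    congrArg ((LieW hm hV l W).incl (2 * m)) (vwLift_genW _ _ a)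
  -- The relator maps to the class of `-[u, l]`, which is zero modulo `l`.
  have hrel : f.map (3 * m) (vwRelator R r m) = 0 := by
    apply (LieW hm hV l W).incl_injective
    refine Eq.trans (map_vwRelator θ) ?_
    simp only [hθv, hθw, ← p.map_br, ← map_sum]
    refine (congrArg (p.map (3 * m)) (sum_br_wElt hm (two_mul m).symm hg _ _)).trans ?_
    rw [map_neg, p.map_br, ← hl, hpl, map_zero, neg_zero, map_zero]
  let Φ : GLieHom R (vwIdeal R r m).Quot (LieW hm hV l W).Carrier := GLieIdeal.genLift f hrel
  have hΦ : ∀ {i : ℤ} (x : FreeVW R r m i),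
      (LieW hm hV l W).incl i (Φ.map i ((vwIdeal R r m).proj i x)) = θ.map i x := fun x => rfl
  refine ⟨Φ, fun a => by rw [hΦ, hθv, hv]; rfl, fun a => hθw a, fun i => ⟨?_, ?_⟩⟩
  · obtain ⟨ψ, hψ⟩ := exists_hom_to_ext (m := m) hg hh hgh hhg b
    -- The composite with `ψ` is the inclusion of the presented algebra into its extension.
    -- Comparing first components then gives injectivity.
    have key : ∀ {i : ℤ} (x : FreeVW R r m i), ψ.map i (θ.map i x)
        = (vwExt (m := m) hg hh hgh hhg).inl.map i ((vwIdeal R r m).proj i x) := by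
      intro i x
      refine vw_hom_ext (f := ψ.comp θ)
        (f' := (vwExt (m := m) hg hh hgh hhg).inl.comp (vwIdeal R r m).projHom)
        (fun a => ?_) (fun a => ?_) x
      · change ψ.map m (θ.map m (genV R m a)) = _
        rw [hθv]
        exact hψ a.succ
      · change ψ.map (2 * m) (θ.map (2 * m) (genW R m a)) = _
        rw [hθw, GLieHom.map_wElt, GLieHom.map_wElt]
        refine Eq.trans ?_ (sum_extBasis (m := m) hg hh hgh hhg a)
        have : (fun i => ψ.map m (p.map m (FreeGLie.of m (b i))))
            = extBasis (m := m) hg hh hgh hhg := funext hψ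
        rw [this]
        rfl
    intro x y hxy
    obtain ⟨x, rfl⟩ := (vwIdeal R r m).proj_surjective _ x
    obtain ⟨y, rfl⟩ := (vwIdeal R r m).proj_surjective _ y
    have e : θ.map i x = θ.map i y := congrArg ((LieW hm hV l W).incl i) hxy
    have e2 := (key x).symm.trans ((congrArg (ψ.map i) e).trans (key y))
    exact congrArg Prod.fst e2
  · intro z
    suffices ∃ x, θ.map i x = (LieW hm hV l W).incl i z by
      obtain ⟨x, hx⟩ := this
      exact ⟨(vwIdeal R r m).proj i x, (LieW hm hV l W).incl_injective i hx⟩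
    -- In degree `m` the target is the image of `W`, spanned by the `v_a`; in all other degrees it
    -- is everything, and `surjective_aux` applies.
    by_cases hi : i = m
    · subst hi
      have hz := (LieW hm hV l W).incl_mem z
      rw [LieW_self] at hz
      obtain ⟨x, hx, hxz⟩ := hz
      rw [← hxz]
      refine ⟨∑ a, v.repr ⟨x, hx⟩ a • genV R i a, ?_⟩
      have e : x = ∑ a, v.repr ⟨x, hx⟩ a • b a.succ := by
        have := congrArg W.subtype (v.sum_repr ⟨x, hx⟩)
        rw [map_sum] at this
        simpa [hv] using this.symm
      conv_rhs => rw [e]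
      simp only [map_sum, map_smul, hθv]
      rfl
    · obtain ⟨y, hy⟩ := (GLieIdeal.gen l).proj_surjective i ((LieW hm hV l W).incl i z)
      rw [← hy]
      exact surjective_aux hm hV hhg b p hpl θ hθv hθw hi y

end Main

theorem mainTheorem12 {R : Type u} [CommRing R] [IsDomain R] [IsPrincipalIdealRing R]
    {V : ℤ → Type v} [∀ i, AddCommGroup (V i)] [∀ i, Module R (V i)]
    {m : ℤ} (hm : Odd m) (hV : ∀ i, i ≠ m → Subsingleton (V i))
    [Module.Free R (V m)] [Module.Finite R (V m)]
    {k : ℕ} (hk : 1 ≤ k) (hrank : Module.finrank R (V m) = k)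
    (t : V m ⊗[R] V m) (hsymm : TensorProduct.comm R (V m) (V m) t = t)
    (hinv : ∀ b : Module.Basis (Fin k) R (V m), IsUnit (tensorMatrix b t))
    (W : Submodule R (V m)) (hW : ∃ C : Submodule R (V m), IsCompl W C)
    (v : Module.Basis (Fin (k - 1)) R W) :
    -- `t` is an element of `F(V)`, in exactly one way
    (∃! l : FreeGLie R V (2 * m), FreeGLie.toTensor R (2 * m) l = tensorOf₂ R m t) ∧
    ∀ l : FreeGLie R V (2 * m), FreeGLie.toTensor R (2 * m) l = tensorOf₂ R m t →
      -- `w a` is an element of `V ⊗ V`, and `w' a` is the same element in `F(V)`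
      ∃ (w : Fin (k - 1) → V m ⊗[R] V m) (w' : Fin (k - 1) → FreeGLie R V (2 * m)),
        (∀ a, FreeGLie.toTensor R (2 * m) (w' a) = tensorOf₂ R m (w a)) ∧
        (∑ a, gradedCommutator R m (2 * m) (tensorOf R m (v a : V m)) (tensorOf₂ R m (w a))
          ∈ TwoSidedIdeal.span {tensorOf₂ R m t}) ∧
        (LinearIndependent R (fun a => Submodule.mkQ
            (Submodule.span R {t} ⊔ LinearMap.range (LinearMap.lTensor (V m) W.subtype)) (w a)) ∧
          Submodule.span R (Set.range fun a => Submodule.mkQ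
            (Submodule.span R {t} ⊔ LinearMap.range (LinearMap.lTensor (V m) W.subtype)) (w a))
            = ⊤) ∧
        ∃ Φ : GLieHom R (vwIdeal R (k - 1) m).Quot (LieW hm hV l W).Carrier,
          (∀ a, (LieW hm hV l W).incl m (Φ.map m ((vwIdeal R (k - 1) m).proj m (genV R m a)))
            = (GLieIdeal.gen l).proj m (FreeGLie.of m (v a : V m))) ∧
          (∀ a, (LieW hm hV l W).incl (2 * m)
              (Φ.map (2 * m) ((vwIdeal R (k - 1) m).proj (2 * m) (genW R m a)))
            = (GLieIdeal.gen l).proj (2 * m) (w' a)) ∧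
          ∀ i, Function.Bijective (Φ.map i) := by
  revert v
  -- The subtraction is truncated; `1 ≤ k` allows `k = r + 1`, so that index 0 is free for the
  -- additional basis vector.
  generalize hr : k - 1 = r
  obtain rfl : k = r + 1 := by omega
  intro v
  obtain ⟨C, hWC⟩ := hW
  obtain ⟨b, hv⟩ := exists_basis_succ hrank hWC v
  obtain ⟨g, ht⟩ : ∃ g, tensorMatrix b t = g := ⟨_, rfl⟩
  have hg : g.IsSymm := ht ▸ tensorMatrix_isSymm b hsymm
  have hdet : IsUnit g.det := (Matrix.isUnit_iff_isUnit_det g).1 (ht ▸ hinv b)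
  have hgh : g * g⁻¹ = 1 := Matrix.mul_nonsing_inv g hdet
  have hhg : g⁻¹ * g = 1 := Matrix.nonsing_inv_mul g hdet
  have hh : g⁻¹.IsSymm := by rw [Matrix.IsSymm, Matrix.transpose_nonsing_inv, hg.eq]
  have htg : t = ∑ i, ∑ j, g i j • b i ⊗ₜ b j := ht ▸ eq_sum_tensorMatrix b t
  have hl₀ := toTensor_quad hm (two_mul m).symm hg b
  rw [← htg] at hl₀
  have huniq : ∀ l : FreeGLie R V (2 * m), FreeGLie.toTensor R (2 * m) l = tensorOf₂ R m t →
      l = quad hm (two_mul m).symm g fun i => FreeGLie.of m (b i) := fun l hl =>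
    toTensor_injective hm hV b (hl.trans hl₀.symm)
  refine ⟨⟨_, hl₀, huniq⟩, fun l hl => ?_⟩
  refine ⟨wTensor b g, wElt hm (two_mul m).symm g (fun i => FreeGLie.of m (b i)),
    toTensor_wElt hm b, ?_, ?_, exists_isomorphism hm hV hg hh hgh hhg b v hv (huniq l hl)⟩
  -- The identity `∑ [v_a, w_a] = -[u, l]` of `F(V)`, transported to the tensor algebra; the
  -- commutator with `t` visibly lies in the two-sided ideal.
  · have e : ∑ a, gradedCommutator R m (2 * m) (tensorOf R m (v a : V m))
        (tensorOf₂ R m (wTensor b g a))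
        = -gradedCommutator R m (2 * m) (tensorOf R m (b 0)) (tensorOf₂ R m t) := by
      have := congrArg (FreeGLie.toTensor R (m + 2 * m))
        (sum_br_wElt hm (two_mul m).symm hg (fun i => FreeGLie.of (R := R) m (b i)) rfl)
      rw [map_sum, map_neg, toTensor_br, hl₀] at this
      simp only [toTensor_br, toTensor_wElt, toTensor_of, hv] at this
      exact this
    rw [e, gradedCommutator, koszulSign_of_even_right (even_two_mul m), one_smul]
    have hmem : tensorOf₂ R m t ∈ TwoSidedIdeal.span {tensorOf₂ R m t} :=
      TwoSidedIdeal.subset_span rfl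
    exact neg_mem (sub_mem (TwoSidedIdeal.mul_mem_left _ _ _ hmem)
      (TwoSidedIdeal.mul_mem_right _ _ _ hmem))
  · rw [htg]
    exact ⟨linearIndependent_wTensor b hg hgh v hv, span_wTensor b hg hhg v hv⟩
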